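/- **Notation.** $x=(x^1,\dots,x^4)$ are the coordinates of $\mathbb R^4$; commas denote partial derivatives; repeated indices are summed, Roman ones over $1,\dots,4$ and Greek ones over $3,4$. $\mathfrak g$ is a finite-dimensional real Lie algebra with a non-degenerate symmetric bilinear form "$.$" satisfying $f.[k,l]=[f,k].l$. $V\in C^\infty(\mathbb R)$. For a Lorentzian metric $g$ of signature $-+++$, a $\mathfrak g$-valued potential $A=A_i\,dx^i$ and a $\mathfrak g$-valued function $\Phi$, put $$\Gamma^k_{ij}=\tfrac12g^{km}(g_{mj,i}+g_{mi,j}-g_{ij,m}),\quad \Gamma^k=g^{ij}\Gamma^k_{ij},\quad \Delta=\nabla_iA^i,\quad F_{ij}=A_{j,i}-A_{i,j}+[A_i,A_j],$$ $$\hat\nabla_i\Phi=\Phi_{,i}+[A_i,\Phi],\quad \hat\nabla_iF^{ij}=\nabla_iF^{ij}+[A_i,F^{ij}],\quad J_p=[\Phi,\hat\nabla_p\Phi],\quad \Phi^2=\Phi.\Phi,$$ $$R_{ij}=\Gamma^k_{ij,k}-\Gamma^k_{ik,j}+\Gamma^k_{kl}\Gamma^l_{ij}-\Gamma^k_{jl}\Gamma^l_{ik},\qquad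 \tilde R_{ij}=R_{ij}-\tfrac12(g_{ki}\Gamma^k_{,j}+g_{kj}\Gamma^k_{,i}),$$ $$\tau_{ij}=F_{ik}.F_j{}^k-\tfrac14g_{ij}F_{kl}.F^{kl}+\hat\nabla_i\Phi.\hat\nabla_j\Phi+\tfrac12g_{ij}V(\Phi^2),$$ $$LA_p=g_{jp}\hat\nabla_iF^{ij}+\Delta_{,p}+\Gamma^l_{,p}A_l+\Gamma^lA_{l,p}.$$ **Domain.** $L\subset\mathbb R^4$ is a compact domain, the closure of its interior, with $G^\omega=\{x\in L:x^\omega=0\}\subset\partial L$ for $\omega=1,2$. Let $\tau(x)=x^1+x^2$, $T_0=\sup_L\tau$, $0<T_1\le T_0$, $G^\omega_{T_1}=\{x\in G^\omega:0\le\tau(x)\le T_1\}$ and $\Gamma=G^1_{T_1}\cap G^2_{T_1}$. Assume that $G^1_{T_1}$ is contained in the closure of its interior relative to the hyperplane $x^1=0$, and that $(0,x^2,x^3,x^4)\in G^1_{T_1}$ implies $(0,s,x^3,x^4)\in G^1_{T_1}$ for $0\le s\le x^2$. **Data.** Let $g_{ij}=g_{ji}$, $A_i$, $\Phi$ be $C^\infty$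 on a neighbourhood of $G^1_{T_1}$, with $g$ Lorentzian on $G^1_{T_1}$, and suppose that on $G^1_{T_1}$ the following hold. 1. $g_{22}=g_{23}=g_{24}=0$ and $A_2=0$. 2. $g_{\alpha\beta}=e^vh_{\alpha\beta}$ with $v$, $h_{\alpha\beta}$ of class $C^\infty$, $\det(h_{\alpha\beta})=1$, and, with $(h^{\alpha\beta})$ the inverse of $(h_{\alpha\beta})$, $$2v_{,22}=-(v_{,2})^2-2e^{-v}h^{\alpha\beta}A_{\alpha,2}.A_{\beta,2}+\tfrac12h_{\alpha\beta,2}h^{\alpha\beta}_{,2}-2\,\Phi_{,2}.\Phi_{,2},\qquad g_{12,2}=\tfrac12g_{12}v_{,2}.$$ 3. $\tilde R_{22}=\tau_{22}$, and $g_{22,1}=2g_{12,2}$ on $\Gamma$. 4. $(g_{13},g_{14},A_1)$ solves the linear second order ODE system (for $\alpha=3,4$) $$g^{12}g_{1\alpha,22}+(g^{12})^2g_{12,2}g_{1\alpha,2}-g^{12}g^{\beta\lambda}g_{\alpha\beta,2}g_{1\lambda,2}+2g^{12}A_{\alpha,2}.A_{1,2}+\chi_\alpha^\lambda g_{1\lambda}+F_\alpha=0,$$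 $$-2g^{12}A_{1,22}-2(g^{12})^2g_{12,2}A_{1,2}+2g^{12}g^{\alpha\lambda}g_{1\lambda,2}A_{\alpha,2}+a^\lambda g_{1\lambda}+b=0,$$ where, with $S_\lambda=-2g^{12}g_{12,\lambda}+g^{\mu\theta}(2g_{\lambda\mu,\theta}-g_{\mu\theta,\lambda})$ and $D=g^{\alpha\beta}A_{\alpha,\beta}$, $$\chi_\alpha^\lambda=(g^{12})^2g_{12,2}g_{\alpha\beta}g^{\beta\lambda}_{,2}+\tfrac12\left(g_{\alpha\beta}g^{12}g^{\beta\lambda}_{,22}-g^{12}g^{\beta\lambda}g_{\alpha\beta,22}\right)-2g^{\nu\lambda}g^{12}A_{\alpha,2}.A_{\nu,2},$$ $$F_\alpha=c_\alpha+g^{\beta\lambda}(A_{\alpha,\lambda}-A_{\lambda,\alpha}+[A_\lambda,A_\alpha]).A_{\beta,2}+D.A_{\alpha,2}-\Phi_{,2}.(\Phi_{,\alpha}+[A_\alpha,\Phi]),$$ $$\begin{aligned}c_\alpha={}&\tfrac12g^{12}g_{12,2}S_\alpha+\tfrac14g_{\alpha\beta,2}g^{\beta\lambda}S_\lambda+\tfrac12(g^{\lambda\beta}g_{\alpha\beta,2})_{,\lambda}-3(g^{12}g_{12,2})_{,\alpha}-\tfrac12(g^{12})^2g_{12,2}g_{12,\alpha}\\&+\tfrac32g^{12}g_{12,2\alpha}+\tfrac14g^{\beta\lambda}_{,2}g_{\beta\lambda,\alpha}+\tfrac14g_{\alpha\beta,2}g^{\beta\lambda}g^{\mu\theta}g_{\mu\theta,\lambda}+\tfrac14g_{\alpha\beta}(g^{\beta\lambda}S_\lambda)_{,2},\end{aligned}$$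 $$a^\lambda=4(g^{12})^2g_{12,2}g^{\alpha\lambda}A_{\alpha,2}+(2g^{12}g^{\alpha\lambda}A_{\alpha,2})_{,2},$$ $$b=g^{\alpha\beta}_{,2}A_{\alpha,\beta}-2D_{,2}-2g^{12}g_{12,2}D-g^{\alpha\beta}[A_\beta,A_{\alpha,2}]-\left(\tfrac12g^{\alpha\beta}g^{\lambda\mu}g_{\lambda\mu,\beta}+g^{\alpha\beta}_{,\beta}\right)A_{\alpha,2}-[\Phi,\Phi_{,2}].$$ **Proposition.** (i) At every point of $G^1_{T_1}$, the reduced system $\tilde R_{2\alpha}=\tau_{2\alpha}$ $(\alpha=3,4)$, $LA_2=J_2$ is equivalent to the following homogeneous linear first order ODE system for $(\Gamma^3,\Gamma^4,\Delta)$ in the variable $x^2$: $$g_{\alpha\beta}\Gamma^\beta_{,2}+\left(g^{12}g_{12,2}g_{\alpha\beta}+\tfrac12g_{\alpha\beta,2}+A_\beta.A_{\alpha,2}\right)\Gamma^\beta+A_{\alpha,2}.\Delta=0\qquad(\alpha=3,4),$$ $$2A_\beta\Gamma^\beta_{,2}+2\Delta_{,2}+2g^{12}g_{12,2}\Delta+2\left(g^{12}g_{12,2}A_\beta+A_{\beta,2}\right)\Gamma^\beta=0.$$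 (ii) Suppose that the reduced system holds on $G^1_{T_1}$. If $\Gamma^3=\Gamma^4=0$ and $\Delta=0$ on $\Gamma$, then $\Gamma^3=\Gamma^4=0$ and $\Delta=0$ on all of $G^1_{T_1}$. -/

import Mathlib

open scoped ContDiff

noncomputable section

namespace EYMH

/-- Points of `ℝ⁴`. The coordinates `x¹, x², x³, x⁴` are numbered `0, 1, 2, 3`. -/
abbrev Pt := Fin 4 → ℝ

/-- Elements of the Lie algebra, written in components in a fixed basis. -/
abbrev Col (N : ℕ) := Fin N → ℝ

/-- The angular indices: `ang 0` is the index of `x³`, `ang 1` that of `x⁴`. -/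
def ang : Fin 2 → Fin 4 := ![2, 3]

/-- The partial derivative `f_{,i}`. -/
def pd {E : Type*} [NormedAddCommGroup E] [NormedSpace ℝ E] (i : Fin 4) (f : Pt → E) : Pt → E :=
  fun x => fderiv ℝ f x (Pi.single i 1)

/-- `f` is `C^∞` on the set `S`: it is smooth on an open neighbourhood of `S`. -/
def SmoothNear {E : Type*} [NormedAddCommGroup E] [NormedSpace ℝ E] (S : Set Pt) (f : Pt → E) :
    Prop :=
  ∃ U : Set Pt, IsOpen U ∧ S ⊆ U ∧ ContDiffOn ℝ ∞ f U

/-! ### The domain and the initial hypersurfaces -/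

/-- The time function `τ(x) = x¹ + x²`. -/
def timeFn (x : Pt) : ℝ := x 0 + x 1

/-- `T₀ = sup_L τ`. -/
def T0 (L : Set Pt) : ℝ := sSup (timeFn '' L)

/-- `{x ∈ L : x^k = 0}`; the surface `G¹` is `surf L 0`, the surface `G²` is `surf L 1`. -/
def surf (L : Set Pt) (k : Fin 4) : Set Pt := {x | x ∈ L ∧ x k = 0}

/-- The truncated surface `{x ∈ L : x^k = 0, 0 ≤ τ(x) ≤ t}`. -/
def surfT (L : Set Pt) (k : Fin 4) (t : ℝ) : Set Pt :=
  {x | x ∈ surf L k ∧ 0 ≤ timeFn x ∧ timeFn x ≤ t}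

/-- The intersection `Γ` of the two truncated initial surfaces. -/
def corner (L : Set Pt) (t : ℝ) : Set Pt := surfT L 0 t ∩ surfT L 1 t

/-- `L` is a compact domain (the closure of its interior) with `G¹ ∪ G² ⊆ ∂L`. -/
structure IsCharDomain (L : Set Pt) : Prop where
  isCompact : IsCompact L
  closure_interior : closure (interior L) = L
  surf_subset_frontier : surf L 0 ∪ surf L 1 ⊆ frontier L

/-- The part `S` of the hyperplane `x¹ = 0` is a `3`-dimensional surface: it is contained in the
closure of its interior relative to the hyperplane. -/
def IsThreeDim (S : Set Pt) : Prop :=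
  S ⊆ closure {x | x ∈ S ∧ ∀ᶠ y in nhdsWithin x {y : Pt | y 0 = 0}, y ∈ S}

/-- Every point of `S` can be joined to `x² = 0` inside `S` along its `x²`-coordinate line. -/
def IsRuled (S : Set Pt) : Prop :=
  ∀ x ∈ S, ∀ s : ℝ, 0 ≤ s → s ≤ x 1 → Function.update x 1 s ∈ S

/-! ### Metric geometry in coordinates -/

/-- The matrix `(g_{ij}(x))`. -/
def gMat (g : Fin 4 → Fin 4 → Pt → ℝ) (x : Pt) : Matrix (Fin 4) (Fin 4) ℝ :=
  Matrix.of fun i j => g i j x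

/-- The symmetric matrix `M` has signature `-+++`. -/
def IsLorentz (M : Matrix (Fin 4) (Fin 4) ℝ) : Prop :=
  ∃ P : Matrix (Fin 4) (Fin 4) ℝ, IsUnit P.det ∧
    P.transpose * M * P = Matrix.diagonal ![-1, 1, 1, 1]

/-- The components `g^{ij}` of the inverse metric. -/
def ginv (g : Fin 4 → Fin 4 → Pt → ℝ) (i j : Fin 4) : Pt → ℝ :=
  fun x => (gMat g x)⁻¹ i j

/-- The Christoffel symbols `Γ^k_{ij}`. -/
def christoffel (g : Fin 4 → Fin 4 → Pt → ℝ) (k i j : Fin 4) : Pt → ℝ := fun x =>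
  (1 / 2) * ∑ m, ginv g k m x * (pd i (g m j) x + pd j (g m i) x - pd m (g i j) x)

/-- `Γ^k = g^{ij} Γ^k_{ij}`. -/
def harmonic (g : Fin 4 → Fin 4 → Pt → ℝ) (k : Fin 4) : Pt → ℝ := fun x =>
  ∑ i, ∑ j, ginv g i j x * christoffel g k i j x

/-- The Ricci tensor `R_{ij}`. -/
def ricci (g : Fin 4 → Fin 4 → Pt → ℝ) (i j : Fin 4) : Pt → ℝ := fun x =>
  ∑ k, pd k (christoffel g k i j) x - ∑ k, pd j (christoffel g k i k) x
    + ∑ k, ∑ l, christoffel g k k l x * christoffel g l i j x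
    - ∑ k, ∑ l, christoffel g k j l x * christoffel g l i k x

/-- The reduced Ricci tensor `R̃_{ij} = R_{ij} - ½ (g_{ki} Γ^k_{,j} + g_{kj} Γ^k_{,i})`. -/
def reducedRicci (g : Fin 4 → Fin 4 → Pt → ℝ) (i j : Fin 4) : Pt → ℝ := fun x =>
  ricci g i j x
    - (1 / 2) * ∑ k, (g k i x * pd j (harmonic g k) x + g k j x * pd i (harmonic g k) x)

/-! ### The Lie algebra in components -/

section LieAlg

variable {𝔤 : Type*} [LieRing 𝔤] [LieAlgebra ℝ 𝔤] {N : ℕ}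

/-- The Lie bracket `[u, v]` in components. -/
def brk (b : Module.Basis (Fin N) ℝ 𝔤) (u v : Col N) : Col N :=
  b.equivFun ⁅b.equivFun.symm u, b.equivFun.symm v⁆

/-- The scalar product `u . v` in components. -/
def dot (b : Module.Basis (Fin N) ℝ 𝔤) (B : LinearMap.BilinForm ℝ 𝔤) (u v : Col N) : ℝ :=
  B (b.equivFun.symm u) (b.equivFun.symm v)

/-! ### Yang-Mills and Higgs fields -/

/-- The curvature `F_{ij} = A_{j,i} - A_{i,j} + [A_i, A_j]`. -/
def curv (b : Module.Basis (Fin N) ℝ 𝔤) (A : Fin 4 → Pt → Col N) (i j : Fin 4) : Pt → Col N :=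
  fun x => pd i (A j) x - pd j (A i) x + brk b (A i x) (A j x)

/-- `F^{ij} = g^{ia} g^{jc} F_{ac}`. -/
def curvUp (b : Module.Basis (Fin N) ℝ 𝔤) (g : Fin 4 → Fin 4 → Pt → ℝ) (A : Fin 4 → Pt → Col N)
    (i j : Fin 4) : Pt → Col N :=
  fun x => ∑ a, ∑ c, (ginv g i a x * ginv g j c x) • curv b A a c x

/-- `F_i{}^k = g^{ka} F_{ia}`. -/
def curvMix (b : Module.Basis (Fin N) ℝ 𝔤) (g : Fin 4 → Fin 4 → Pt → ℝ) (A : Fin 4 → Pt → Col N)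
    (i k : Fin 4) : Pt → Col N :=
  fun x => ∑ a, ginv g k a x • curv b A i a x

/-- The gauge covariant derivative of the Higgs field, `Φ_{,i} + [A_i, Φ]`. -/
def covHiggs (b : Module.Basis (Fin N) ℝ 𝔤) (A : Fin 4 → Pt → Col N) (Φ : Pt → Col N)
    (i : Fin 4) : Pt → Col N :=
  fun x => pd i Φ x + brk b (A i x) (Φ x)

/-- The source `τ_{ij}` of the reduced Einstein equations. -/
def source (b : Module.Basis (Fin N) ℝ 𝔤) (B : LinearMap.BilinForm ℝ 𝔤) (V : ℝ → ℝ)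
    (g : Fin 4 → Fin 4 → Pt → ℝ) (A : Fin 4 → Pt → Col N) (Φ : Pt → Col N)
    (i j : Fin 4) : Pt → ℝ := fun x =>
  ∑ k, dot b B (curv b A i k x) (curvMix b g A j k x)
    - (1 / 4) * g i j x * ∑ k, ∑ l, dot b B (curv b A k l x) (curvUp b g A k l x)
    + dot b B (covHiggs b A Φ i x) (covHiggs b A Φ j x)
    + (1 / 2) * g i j x * V (dot b B (Φ x) (Φ x))

/-- The Yang-Mills current with lowered index, `J_p = [Φ, Φ_{,p} + [A_p, Φ]]`. -/
def current (b : Module.Basis (Fin N) ℝ 𝔤) (A : Fin 4 → Pt → Col N) (Φ : Pt → Col N)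
    (p : Fin 4) : Pt → Col N :=
  fun x => brk b (Φ x) (covHiggs b A Φ p x)

/-- The gauge covariant divergence of the curvature,
`F^{ij}_{,i} + Γ^i_{im} F^{mj} + Γ^j_{im} F^{im} + [A_i, F^{ij}]`. -/
def divCurv (b : Module.Basis (Fin N) ℝ 𝔤) (g : Fin 4 → Fin 4 → Pt → ℝ) (A : Fin 4 → Pt → Col N)
    (j : Fin 4) : Pt → Col N := fun x =>
  ∑ i, (pd i (curvUp b g A i j) x
    + ∑ m, christoffel g i i m x • curvUp b g A m j x
    + ∑ m, christoffel g j i m x • curvUp b g A i m x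
    + brk b (A i x) (curvUp b g A i j x))

/-- `A^i = g^{ij} A_j`. -/
def potUp {N : ℕ} (g : Fin 4 → Fin 4 → Pt → ℝ) (A : Fin 4 → Pt → Col N) (i : Fin 4) :
    Pt → Col N :=
  fun x => ∑ j, ginv g i j x • A j x

/-- The Lorentz gauge function `Δ = ∇_i A^i`. -/
def lorenz {N : ℕ} (g : Fin 4 → Fin 4 → Pt → ℝ) (A : Fin 4 → Pt → Col N) : Pt → Col N :=
  fun x => ∑ i, (pd i (potUp g A i) x + ∑ m, christoffel g i i m x • potUp g A m x)

/-- The reduced Yang-Mills operator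
`L A_p = g_{jp} ∇̂_i F^{ij} + (Δ_{,p} + Γ^l_{,p} A_l + Γ^l A_{l,p})`. -/
def reducedYM (b : Module.Basis (Fin N) ℝ 𝔤) (g : Fin 4 → Fin 4 → Pt → ℝ)
    (A : Fin 4 → Pt → Col N) (p : Fin 4) : Pt → Col N := fun x =>
  ∑ j, g j p x • divCurv b g A j x
    + (pd p (lorenz g A) x
      + ∑ l, (pd p (harmonic g l) x • A l x + harmonic g l x • pd p (A l) x))

/-! ### The equations by which the data on `G¹` are constructed

Only derivatives tangential to `x¹ = 0` occur in this part. -/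

/-- The ODE for the logarithm `v` of the conformity factor,
`2 v_{,22} = -(v_{,2})² - 2 e^{-v} h^{αβ} A_{α,2}.A_{β,2} + ½ h_{αβ,2} h^{αβ}_{,2} - 2 (Φ_{,2})²`,
where `(h^{αβ})` is the inverse of `(h_{αβ})`. -/
def ConformalODE (b : Module.Basis (Fin N) ℝ 𝔤) (B : LinearMap.BilinForm ℝ 𝔤)
    (h : Fin 2 → Fin 2 → Pt → ℝ) (v : Pt → ℝ) (A : Fin 4 → Pt → Col N) (Φ : Pt → Col N)
    (x : Pt) : Prop :=
  2 * pd 1 (pd 1 v) x =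
    -(pd 1 v x) ^ 2
      - 2 * Real.exp (-v x) * ∑ α, ∑ β, (Matrix.of fun i j => h i j x)⁻¹ α β
          * dot b B (pd 1 (A (ang α)) x) (pd 1 (A (ang β)) x)
      + (1 / 2) * ∑ α, ∑ β, pd 1 (h α β) x
          * pd 1 (fun y => (Matrix.of fun i j => h i j y)⁻¹ α β) x
      - 2 * dot b B (pd 1 Φ x) (pd 1 Φ x)

/-- `S_λ = -2 g^{12} g_{12,λ} + g^{μθ} (2 g_{λμ,θ} - g_{μθ,λ})`. -/
def coefS (g : Fin 4 → Fin 4 → Pt → ℝ) (l : Fin 2) : Pt → ℝ := fun x =>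
  -2 * ginv g 0 1 x * pd (ang l) (g 0 1) x
    + ∑ μ, ∑ θ, ginv g (ang μ) (ang θ) x
        * (2 * pd (ang θ) (g (ang l) (ang μ)) x - pd (ang l) (g (ang μ) (ang θ)) x)

/-- The coefficient `c_α`. -/
def coefC (g : Fin 4 → Fin 4 → Pt → ℝ) (α : Fin 2) : Pt → ℝ := fun x =>
  (1 / 2) * ginv g 0 1 x * pd 1 (g 0 1) x * coefS g α x
    + (1 / 4) * ∑ β, ∑ l, pd 1 (g (ang α) (ang β)) x * ginv g (ang β) (ang l) x * coefS g l x
    + (1 / 2) * ∑ l, pd (ang l)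
        (fun y => ∑ β, ginv g (ang l) (ang β) y * pd 1 (g (ang α) (ang β)) y) x
    - 3 * pd (ang α) (fun y => ginv g 0 1 y * pd 1 (g 0 1) y) x
    - (1 / 2) * ginv g 0 1 x ^ 2 * pd 1 (g 0 1) x * pd (ang α) (g 0 1) x
    + (3 / 2) * ginv g 0 1 x * pd (ang α) (pd 1 (g 0 1)) x
    + (1 / 4) * ∑ β, ∑ l, pd 1 (ginv g (ang β) (ang l)) x * pd (ang α) (g (ang β) (ang l)) x
    + (1 / 4) * ∑ β, ∑ l, pd 1 (g (ang α) (ang β)) x * ginv g (ang β) (ang l) x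
        * ∑ μ, ∑ θ, ginv g (ang μ) (ang θ) x * pd (ang l) (g (ang μ) (ang θ)) x
    + (1 / 4) * ∑ β, g (ang α) (ang β) x
        * pd 1 (fun y => ∑ l, ginv g (ang β) (ang l) y * coefS g l y) x

/-- The coefficient `χ_α^λ` of `g_{1λ}`. -/
def coefChi (b : Module.Basis (Fin N) ℝ 𝔤) (B : LinearMap.BilinForm ℝ 𝔤)
    (g : Fin 4 → Fin 4 → Pt → ℝ) (A : Fin 4 → Pt → Col N) (α l : Fin 2) : Pt → ℝ := fun x =>
  ∑ β, (ginv g 0 1 x ^ 2 * pd 1 (g 0 1) x * g (ang α) (ang β) x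
          * pd 1 (ginv g (ang β) (ang l)) x
      + (1 / 2) * (g (ang α) (ang β) x * ginv g 0 1 x * pd 1 (pd 1 (ginv g (ang β) (ang l))) x
          - ginv g 0 1 x * ginv g (ang β) (ang l) x * pd 1 (pd 1 (g (ang α) (ang β))) x))
    - 2 * ∑ ν, ginv g (ang ν) (ang l) x * ginv g 0 1 x
        * dot b B (pd 1 (A (ang α)) x) (pd 1 (A (ang ν)) x)

/-- `D = g^{αβ} A_{α,β}`. -/
def angDiv {N : ℕ} (g : Fin 4 → Fin 4 → Pt → ℝ) (A : Fin 4 → Pt → Col N) : Pt → Col N := fun x =>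
  ∑ α, ∑ β, ginv g (ang α) (ang β) x • pd (ang β) (A (ang α)) x

/-- The inhomogeneity `F_α` of the equation for `g_{1α}`,
`c_α + g^{βλ} (A_{α,λ} - A_{λ,α} + [A_λ, A_α]).A_{β,2} + D.A_{α,2} - Φ_{,2}.(Φ_{,α} + [A_α, Φ])`. -/
def coefF (b : Module.Basis (Fin N) ℝ 𝔤) (B : LinearMap.BilinForm ℝ 𝔤)
    (g : Fin 4 → Fin 4 → Pt → ℝ) (A : Fin 4 → Pt → Col N) (Φ : Pt → Col N) (α : Fin 2) :
    Pt → ℝ := fun x =>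
  coefC g α x
    + ∑ β, ∑ l, ginv g (ang β) (ang l) x
        * dot b B (pd (ang l) (A (ang α)) x - pd (ang α) (A (ang l)) x
            + brk b (A (ang l) x) (A (ang α) x)) (pd 1 (A (ang β)) x)
    + dot b B (angDiv g A x) (pd 1 (A (ang α)) x)
    - dot b B (pd 1 Φ x) (pd (ang α) Φ x + brk b (A (ang α) x) (Φ x))

/-- The coefficient `a^λ = 4 (g^{12})² g_{12,2} g^{αλ} A_{α,2} + (2 g^{12} g^{αλ} A_{α,2})_{,2}`. -/
def coefA {N : ℕ} (g : Fin 4 → Fin 4 → Pt → ℝ) (A : Fin 4 → Pt → Col N) (l : Fin 2) :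
    Pt → Col N := fun x =>
  ∑ α, (4 * ginv g 0 1 x ^ 2 * pd 1 (g 0 1) x * ginv g (ang α) (ang l) x) • pd 1 (A (ang α)) x
    + pd 1 (fun y => ∑ α, (2 * ginv g 0 1 y * ginv g (ang α) (ang l) y) • pd 1 (A (ang α)) y) x

/-- The inhomogeneity of the equation for `A_1`,
`g^{αβ}_{,2} A_{α,β} - 2 D_{,2} - 2 g^{12} g_{12,2} D - g^{αβ} [A_β, A_{α,2}]
  - (½ g^{αβ} g^{λμ} g_{λμ,β} + g^{αβ}_{,β}) A_{α,2} - [Φ, Φ_{,2}]`. -/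
def coefB (b : Module.Basis (Fin N) ℝ 𝔤) (g : Fin 4 → Fin 4 → Pt → ℝ) (A : Fin 4 → Pt → Col N)
    (Φ : Pt → Col N) : Pt → Col N := fun x =>
  ∑ α, ∑ β, pd 1 (ginv g (ang α) (ang β)) x • pd (ang β) (A (ang α)) x
    - (2 : ℝ) • pd 1 (angDiv g A) x
    - (2 * ginv g 0 1 x * pd 1 (g 0 1) x) • angDiv g A x
    - ∑ α, ∑ β, ginv g (ang α) (ang β) x • brk b (A (ang β) x) (pd 1 (A (ang α)) x)
    - ∑ α, (∑ β, ((1 / 2) * ginv g (ang α) (ang β) x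
          * (∑ l, ∑ μ, ginv g (ang l) (ang μ) x * pd (ang β) (g (ang l) (ang μ)) x)
        + pd (ang β) (ginv g (ang α) (ang β)) x)) • pd 1 (A (ang α)) x
    - brk b (Φ x) (pd 1 Φ x)

/-- The second order linear ODE system in the variable `x²` for `(g_{13}, g_{14}, A_1)`. -/
def DataODE (b : Module.Basis (Fin N) ℝ 𝔤) (B : LinearMap.BilinForm ℝ 𝔤)
    (g : Fin 4 → Fin 4 → Pt → ℝ) (A : Fin 4 → Pt → Col N) (Φ : Pt → Col N) (x : Pt) : Prop :=
  (∀ α : Fin 2,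
    ginv g 0 1 x * pd 1 (pd 1 (g 0 (ang α))) x
      + ginv g 0 1 x ^ 2 * pd 1 (g 0 1) x * pd 1 (g 0 (ang α)) x
      - ∑ β, ∑ l, ginv g 0 1 x * ginv g (ang β) (ang l) x * pd 1 (g (ang α) (ang β)) x
          * pd 1 (g 0 (ang l)) x
      + 2 * ginv g 0 1 x * dot b B (pd 1 (A (ang α)) x) (pd 1 (A 0) x)
      + ∑ l, coefChi b B g A α l x * g 0 (ang l) x
      + coefF b B g A Φ α x = 0) ∧
  (-(2 * ginv g 0 1 x) • pd 1 (pd 1 (A 0)) x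
      - (2 * ginv g 0 1 x ^ 2 * pd 1 (g 0 1) x) • pd 1 (A 0) x
      + ∑ α, ∑ l, (2 * ginv g 0 1 x * ginv g (ang α) (ang l) x * pd 1 (g 0 (ang l)) x)
          • pd 1 (A (ang α)) x
      + ∑ l, g 0 (ang l) x • coefA g A l x
      + coefB b g A Φ x = 0)

/-! ### The two systems compared -/

/-- The reduced system `R̃_{2α} = τ_{2α}` (`α = 3, 4`), `L A_2 = J_2` at the point `x`. -/
def ReducedSystem (b : Module.Basis (Fin N) ℝ 𝔤) (B : LinearMap.BilinForm ℝ 𝔤) (V : ℝ → ℝ)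
    (g : Fin 4 → Fin 4 → Pt → ℝ) (A : Fin 4 → Pt → Col N) (Φ : Pt → Col N) (x : Pt) : Prop :=
  (∀ α : Fin 2, reducedRicci g 1 (ang α) x = source b B V g A Φ 1 (ang α) x) ∧
  reducedYM b g A 1 x = current b A Φ 1 x

/-- The homogeneous linear first order system for `(Γ³, Γ⁴, Δ)` in the variable `x²`, at `x`. -/
def GaugeODE (b : Module.Basis (Fin N) ℝ 𝔤) (B : LinearMap.BilinForm ℝ 𝔤)
    (g : Fin 4 → Fin 4 → Pt → ℝ) (A : Fin 4 → Pt → Col N) (x : Pt) : Prop :=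
  (∀ α : Fin 2,
    ∑ β, g (ang α) (ang β) x * pd 1 (harmonic g (ang β)) x
      + ∑ β, (ginv g 0 1 x * pd 1 (g 0 1) x * g (ang α) (ang β) x
          + (1 / 2) * pd 1 (g (ang α) (ang β)) x
          + dot b B (A (ang β) x) (pd 1 (A (ang α)) x)) * harmonic g (ang β) x
      + dot b B (pd 1 (A (ang α)) x) (lorenz g A x) = 0) ∧
  (∑ β, (2 * pd 1 (harmonic g (ang β)) x) • A (ang β) x
      + (2 : ℝ) • pd 1 (lorenz g A) x
      + (2 * ginv g 0 1 x * pd 1 (g 0 1) x) • lorenz g A x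
      + ∑ β, (2 * harmonic g (ang β) x)
          • ((ginv g 0 1 x * pd 1 (g 0 1) x) • A (ang β) x + pd 1 (A (ang β)) x) = 0)

end LieAlg

end EYMH

end

open EYMH

/-! Indices in these comments run over 1,…,4 as in the statement, and S is G¹_{T₁}.

On S the conditions g_{22} = g_{2α} = 0 force g^{11} = g^{1α} = 0 and g^{12} = 1/g_{12}, and every
identity valid on S may be differentiated in the directions x², x³, x⁴. The harmonic reduction turns
R̃_{ij} into -½ g^{kl} g_{ij,kl} plus terms of first order. So at S the only second derivatives left
in R̃_{2j} and LA_2 are g_{2j,12} and A_{2,12}, and the only derivatives across S are those of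
g_{22}, g_{2α} and A_2.

Three relations dispose of these. The equation R̃_{22} = τ_{22}, combined with the equations for v
and g_{12}, is a homogeneous linear transport equation for g_{22,1} - 2g_{12,2} along x²; this
quantity vanishes on Γ, hence on S, and so does Γ¹ (`null_defect_eq_zero`). Then g_{αβ}Γ^β contains
transversal derivatives only through g^{12} g_{2α,1} (`sum_mul_harmonic_ang`), and Δ only through
g^{12} A_{2,1} and Γ^β (`lorenz_null`), so g_{2α,1} and A_{2,1} can be traded for Γ^α and Δ. The
outcome is R̃_{2α} - τ_{2α} = D_α - G_α (`einstein_identity`) and LA_2 - J_2 = D + G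
(`yang_mills_identity`), where the D's are the left sides of the data equations and the G's those of
the gauge system. Since the D's vanish, (i) follows.

For (ii), the invertibility of (g_{αβ}) allows the gauge system to be solved for the x²-derivatives,
with a right side linear in (Γ³, Γ⁴, Δ) and continuous on S. The x²-lines join each point of S to Γ
inside S, and Gronwall's inequality gives uniqueness of the zero solution. -/

open scoped ContDiff
open EYMH

/-! ### Calculus of coordinate derivatives. -/

section PartialDerivatives

variable {E F : Type*} [NormedAddCommGroup E] [NormedSpace ℝ E]
  [NormedAddCommGroup F] [NormedSpace ℝ F] {U : Set Pt} {x : Pt} {i j : Fin 4}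

theorem pd_add {f g : Pt → E} (hf : DifferentiableAt ℝ f x) (hg : DifferentiableAt ℝ g x) :
    pd i (fun y => f y + g y) x = pd i f x + pd i g x := by
  simp only [pd]; rw [fderiv_fun_add hf hg]; rfl

theorem pd_sub {f g : Pt → E} (hf : DifferentiableAt ℝ f x) (hg : DifferentiableAt ℝ g x) :
    pd i (fun y => f y - g y) x = pd i f x - pd i g x := by
  simp only [pd]; rw [fderiv_fun_sub hf hg]; rfl

theorem pd_neg {f : Pt → E} : pd i (fun y => -f y) x = -pd i f x := by
  simp only [pd]; rw [fderiv_fun_neg]; rfl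

theorem pd_smul {c : Pt → ℝ} {f : Pt → E} (hc : DifferentiableAt ℝ c x)
    (hf : DifferentiableAt ℝ f x) :
    pd i (fun y => c y • f y) x = pd i c x • f x + c x • pd i f x := by
  simp only [pd]; rw [fderiv_fun_smul hc hf]; simp [add_comm]

theorem pd_mul {c f : Pt → ℝ} (hc : DifferentiableAt ℝ c x) (hf : DifferentiableAt ℝ f x) :
    pd i (fun y => c y * f y) x = pd i c x * f x + c x * pd i f x :=
  pd_smul hc hf

theorem pd_const_mul {f : Pt → ℝ} (c : ℝ) (hf : DifferentiableAt ℝ f x) :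
    pd i (fun y => c * f y) x = c * pd i f x := by
  simp only [pd]; rw [fderiv_const_mul hf]; rfl

theorem pd_const (c : E) : pd i (fun _ => c) x = 0 := by
  simp [pd]

theorem pd_sum {ι : Type*} {s : Finset ι} {f : ι → Pt → E}
    (hf : ∀ k ∈ s, DifferentiableAt ℝ (f k) x) :
    pd i (fun y => ∑ k ∈ s, f k y) x = ∑ k ∈ s, pd i (f k) x := by
  simp only [pd]; rw [fderiv_fun_sum hf]; simp

theorem pd_exp {f : Pt → ℝ} (hf : DifferentiableAt ℝ f x) :
    pd i (fun y => Real.exp (f y)) x = Real.exp (f x) * pd i f x := by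
  simp only [pd]; rw [fderiv_exp hf]; rfl

theorem pd_congr {f g : Pt → E} (hU : IsOpen U) (h : Set.EqOn f g U) (hx : x ∈ U) :
    pd i f x = pd i g x := by
  simp only [pd]
  rw [Filter.EventuallyEq.fderiv_eq (Filter.eventuallyEq_of_mem (hU.mem_nhds hx) h)]

theorem contDiffOn_pd {f : Pt → E} (hU : IsOpen U) (hf : ContDiffOn ℝ ∞ f U) (i : Fin 4) :
    ContDiffOn ℝ ∞ (pd i f) U :=
  (hf.fderiv_of_isOpen hU (by simp)).clm_apply contDiffOn_const

theorem ContDiffOn.diffAt {f : Pt → E} (hU : IsOpen U) (hf : ContDiffOn ℝ ∞ f U) (hx : x ∈ U) :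
    DifferentiableAt ℝ f x :=
  ((hf.contDiffAt (hU.mem_nhds hx)).differentiableAt (by simp))

theorem pd_comm {f : Pt → E} (hU : IsOpen U) (hf : ContDiffOn ℝ ∞ f U) (hx : x ∈ U) :
    pd i (pd j f) x = pd j (pd i f) x := by
  have hd : DifferentiableAt ℝ (fderiv ℝ f) x :=
    (hf.fderiv_of_isOpen (m := ∞) hU (by simp)).diffAt hU hx
  have key : ∀ a b : Fin 4, pd a (pd b f) x
      = fderiv ℝ (fderiv ℝ f) x (Pi.single a 1) (Pi.single b 1) := by
    intro a b
    change fderiv ℝ (fun y => fderiv ℝ f y (Pi.single b 1)) x (Pi.single a 1) = _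
    rw [fderiv_clm_apply hd (by fun_prop)]
    simp
  rw [key, key]
  have := (hf.contDiffAt (hU.mem_nhds hx)).isSymmSndFDerivAt
    (by simp only [minSmoothness_of_isRCLikeNormedField]; exact ENat.LEInfty.out)
  exact this _ _

theorem hasDerivAt_line {f : Pt → E} {t : ℝ}
    (hf : DifferentiableAt ℝ f (Function.update x i t)) :
    HasDerivAt (fun s => f (Function.update x i s)) (pd i f (Function.update x i t)) t := by
  have h1 : HasDerivAt (fun s => Function.update x i s) (Pi.single i (1 : ℝ)) t :=
    hasDerivAt_update x i t
  exact hf.hasFDerivAt.comp_hasDerivAt t h1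

end PartialDerivatives

/-! ### Derivatives tangential to the hyperplane x¹ = 0. -/

section Tangential

variable {E : Type*} [NormedAddCommGroup E] [NormedSpace ℝ E] {U S : Set Pt}

/-- Near a point of the relative interior, a short piece of the coordinate line in a direction other
than x¹ stays in S, so f vanishes along it. The other points of S are limits of such points, and the
derivative is continuous. -/
theorem pd_eq_zero_of_eqOn_zero {f : Pt → E} (hU : IsOpen U) (hSU : S ⊆ U)
    (hS0 : ∀ x ∈ S, x 0 = 0) (hS : IsThreeDim S) (hf : ContDiffOn ℝ ∞ f U)
    (h0 : ∀ x ∈ S, f x = 0) {i : Fin 4} (hi : i ≠ 0) {x : Pt} (hx : x ∈ S) :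
    pd i f x = 0 := by
  have key : ∀ y ∈ {x | x ∈ S ∧ ∀ᶠ y in nhdsWithin x {y : Pt | y 0 = 0}, y ∈ S},
      pd i f y = 0 := by
    rintro y ⟨hy, hev⟩
    have h1 : HasDerivAt (fun s => f (Function.update y i s)) (pd i f y) (y i) := by
      have := hasDerivAt_line (x := y) (i := i) (t := y i) (f := f)
        (by simpa using hf.diffAt hU (hSU hy))
      simpa using this
    have hcont : Filter.Tendsto (fun s => Function.update y i s) (nhds (y i))
        (nhdsWithin y {y : Pt | y 0 = 0}) := by
      apply tendsto_nhdsWithin_of_tendsto_nhds_of_eventually_within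
      · have : Continuous fun s => Function.update y i s := by fun_prop
        simpa using this.tendsto (y i)
      · exact Filter.Eventually.of_forall fun s => by
          simp [Function.update_of_ne hi.symm, hS0 y hy]
    have h2 : (fun s => f (Function.update y i s)) =ᶠ[nhds (y i)] fun _ => 0 := by
      filter_upwards [hcont.eventually hev] with s hs using h0 _ hs
    have h3 := (hasDerivAt_const (y i) (0 : E)).congr_of_eventuallyEq h2
    exact h1.unique h3
  have hc : ContinuousWithinAt (pd i f) U x := (contDiffOn_pd hU hf i).continuousOn x (hSU hx)
  have hc' : ContinuousAt (pd i f) x := hc.continuousAt (hU.mem_nhds (hSU hx))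
  have hcl := hS hx
  have h4 := mem_closure_iff_nhdsWithin_neBot.1 hcl
  have h5 : Filter.Tendsto (pd i f)
      (nhdsWithin x {x | x ∈ S ∧ ∀ᶠ y in nhdsWithin x {y : Pt | y 0 = 0}, y ∈ S})
      (nhds (pd i f x)) := hc'.tendsto.mono_left nhdsWithin_le_nhds
  have h6 := h5.congr' (Filter.eventuallyEq_of_mem self_mem_nhdsWithin key)
  exact (tendsto_nhds_unique h6 tendsto_const_nhds)

theorem pd_eq_of_eqOn {f f' : Pt → E} (hU : IsOpen U) (hSU : S ⊆ U)
    (hS0 : ∀ x ∈ S, x 0 = 0) (hS : IsThreeDim S) (hf : ContDiffOn ℝ ∞ f U)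
    (hf' : ContDiffOn ℝ ∞ f' U) (h : ∀ x ∈ S, f x = f' x) {i : Fin 4} (hi : i ≠ 0)
    {x : Pt} (hx : x ∈ S) : pd i f x = pd i f' x := by
  have := pd_eq_zero_of_eqOn_zero hU hSU hS0 hS (hf.sub hf')
    (fun y hy => sub_eq_zero.2 (h y hy)) hi hx
  rw [pd_sub (hf.diffAt hU (hSU hx)) (hf'.diffAt hU (hSU hx))] at this
  exact sub_eq_zero.1 this

end Tangential

/-! ### Uniqueness for homogeneous linear equations. -/

section Gronwall

variable {E : Type*} [NormedAddCommGroup E] [NormedSpace ℝ E]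

theorem eq_zero_of_norm_deriv_le {a b K : ℝ} {y y' : ℝ → E}
    (hy : ∀ t ∈ Set.Icc a b, HasDerivAt y (y' t) t)
    (hK : ∀ t ∈ Set.Icc a b, ‖y' t‖ ≤ K * ‖y t‖) (h0 : y a = 0) {t : ℝ}
    (ht : t ∈ Set.Icc a b) : y t = 0 := by
  have := norm_le_gronwallBound_of_norm_deriv_right_le (f := y) (f' := y') (δ := 0) (K := K)
    (ε := 0) (a := a) (b := b) (fun s hs => (hy s hs).continuousAt.continuousWithinAt)
    (fun s hs => (hy s ⟨hs.1, hs.2.le⟩).hasDerivWithinAt) (by simp [h0])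
    (fun s hs => by simpa using hK s ⟨hs.1, hs.2.le⟩) t ht
  simpa [gronwallBound_ε0] using this

/-- A solution of a homogeneous linear equation `y' = T(t, y)` that vanishes at `a` vanishes. -/
theorem eq_zero_of_homogeneous_ode [FiniteDimensional ℝ E] {a b : ℝ} {y : ℝ → E}
    {T : ℝ → E → E} (hT : ContinuousOn (Function.uncurry T) (Set.Icc a b ×ˢ Set.univ))
    (hhom : ∀ t ∈ Set.Icc a b, ∀ (c : ℝ) (z : E), T t (c • z) = c • T t z)
    (hy : ∀ t ∈ Set.Icc a b, HasDerivAt y (T t (y t)) t) (h0 : y a = 0) {t : ℝ}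
    (ht : t ∈ Set.Icc a b) : y t = 0 := by
  -- Boundedness on the unit sphere and homogeneity give ‖T(t, z)‖ ≤ K‖z‖; additivity in z is not
  -- needed.
  have hcomp : IsCompact (Set.Icc a b ×ˢ Metric.sphere (0 : E) 1) :=
    isCompact_Icc.prod (isCompact_sphere 0 1)
  obtain ⟨K, hK⟩ := (hcomp.exists_bound_of_continuousOn
    (hT.mono (Set.prod_mono_right (Set.subset_univ _))))
  refine eq_zero_of_norm_deriv_le (K := K) hy (fun s hs => ?_) h0 ht
  by_cases hz : y s = 0
  · have : T s (y s) = 0 := by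
      have := hhom s hs 0 0
      simpa [hz] using this
    rw [this, hz]; simp
  · have hn : ‖y s‖ ≠ 0 := norm_ne_zero_iff.2 hz
    have h1 : T s (y s) = ‖y s‖ • T s (‖y s‖⁻¹ • y s) := by
      rw [← hhom s hs, smul_smul, mul_inv_cancel₀ hn, one_smul]
    have h2 := hK (s, ‖y s‖⁻¹ • y s) ⟨hs, by simp [norm_smul, hn]⟩
    rw [h1, norm_smul, norm_norm, mul_comm]
    exact mul_le_mul_of_nonneg_right h2 (norm_nonneg _)

end Gronwall

/-! ### Index algebra of the harmonic reduction of the Ricci tensor. -/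

section RicciAlgebra

open Matrix

variable {ι : Type*} [Fintype ι]

/-- `Γ_{m,ij}` in terms of the array `P k i j = g_{ij,k}`. -/
noncomputable def lowArr (P : ι → ι → ι → ℝ) (m i j : ι) : ℝ :=
  (1 / 2) * (P i m j + P j m i - P m i j)

/-- For `G` = g^{ab} and `P` = ∂g the left side is the lowered Γ_c; the symmetry of `G` merges two
of its three terms. -/
theorem sum_mul_lowArr_eq {G : Matrix ι ι ℝ} (hG : ∀ i j, G i j = G j i) {P : ι → ι → ι → ℝ}
    (hP : ∀ k i j, P k i j = P k j i) (c : ι) :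
    ∑ a, ∑ b, G a b * lowArr P c a b
      = ∑ a, ∑ b, G a b * P a b c - (1 / 2) * ∑ a, ∑ b, G a b * P c a b := by
  have h1 : ∑ a, ∑ b, G a b * P b c a = ∑ a, ∑ b, G a b * P a b c := by
    rw [Finset.sum_comm]
    exact Finset.sum_congr rfl fun a _ => Finset.sum_congr rfl fun b _ => by rw [hG, hP a]
  have h2 : ∑ a, ∑ b, G a b * P a c b = ∑ a, ∑ b, G a b * P a b c :=
    Finset.sum_congr rfl fun a _ => Finset.sum_congr rfl fun b _ => by rw [hP a]
  have h3 : ∀ a b, G a b * lowArr P c a b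
      = (1 / 2) * (G a b * P a c b) + (1 / 2) * (G a b * P b c a)
        - (1 / 2) * (G a b * P c a b) := fun a b => by rw [lowArr]; ring
  simp only [h3, Finset.sum_add_distrib, Finset.sum_sub_distrib, ← Finset.mul_sum, h1, h2]
  ring

/-- This is Γ^k_{kc} = ½ g^{ab} g_{ab,c}: the two other terms are antisymmetric under the
contraction. -/
theorem sum_mul_lowArr_trace {G : Matrix ι ι ℝ} (hG : ∀ i j, G i j = G j i) {P : ι → ι → ι → ℝ}
    (hP : ∀ k i j, P k i j = P k j i) (c : ι) :
    ∑ a, ∑ b, G a b * lowArr P b a c = (1 / 2) * ∑ a, ∑ b, G a b * P c a b := by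
  have h1 : ∑ a, ∑ b, G a b * P b a c = ∑ a, ∑ b, G a b * P a b c := by
    rw [Finset.sum_comm]
    exact Finset.sum_congr rfl fun a _ => Finset.sum_congr rfl fun b _ => by rw [hG]
  have h2 : ∀ a b, G a b * lowArr P b a c
      = (1 / 2) * (G a b * P a b c) + (1 / 2) * (G a b * P c a b)
        - (1 / 2) * (G a b * P b a c) := fun a b => by rw [lowArr, hP c b a]; ring
  simp only [h2, Finset.sum_add_distrib, Finset.sum_sub_distrib, ← Finset.mul_sum, h1]
  ring

/-- The identity for the quadratic terms of the reduced Ricci tensor, with `P`, `Q` standing for ∂_i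
g, ∂_j g. After expansion every term is a trace of two matrices separated by `G`; invariance of such
traces under cyclic shifts and transposition matches the two sides. -/
theorem trace_identity {G P Q X Y : Matrix ι ι ℝ} (hG : Gᵀ = G) (hP : Pᵀ = P) (hQ : Qᵀ = Q) :
    trace (G * Q * G * ((1 / 2 : ℝ) • (P + X - Xᵀ)))
      - trace (G * ((1 / 2 : ℝ) • (Q + Y - Yᵀ)) * (G * ((1 / 2 : ℝ) • (P + X - Xᵀ))))
      + (1 / 2) * trace (G * Q * G * ((1 / 2 : ℝ) • (X + Xᵀ - P)))
      + (1 / 2) * trace (G * P * G * ((1 / 2 : ℝ) • (Y + Yᵀ - Q)))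
    = trace (((1 / 2 : ℝ) • (P + X - Xᵀ))ᵀ * G * Y * G)
      + (1 / 2) * trace (Q * G * ((1 / 2 : ℝ) • (X + Xᵀ - P)) * G) := by
  have cyc : ∀ A B C D : Matrix ι ι ℝ, trace (A * B * C * D) = trace (C * D * A * B) := by
    intro A B C D
    rw [Matrix.mul_assoc (A * B), trace_mul_comm, ← Matrix.mul_assoc (C * D)]
  have tr : ∀ A B : Matrix ι ι ℝ, trace (G * A * G * B) = trace (G * Aᵀ * G * Bᵀ) := by
    intro A B
    rw [← trace_transpose (G * A * G * B)]
    simp only [transpose_mul, hG]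
    rw [trace_mul_comm]
    simp only [← Matrix.mul_assoc]
  have r1 : ∀ A B : Matrix ι ι ℝ, trace (A * G * B * G) = trace (G * A * G * B) := by
    intro A B
    rw [trace_mul_comm]
    simp only [Matrix.mul_assoc]
  simp only [Matrix.mul_add, Matrix.mul_sub, Matrix.add_mul, Matrix.sub_mul, Matrix.mul_smul,
    Matrix.smul_mul, trace_add, trace_sub, trace_smul, transpose_smul, transpose_add,
    transpose_sub, transpose_transpose, smul_eq_mul, r1, ← Matrix.mul_assoc, hP]
  have e1 := tr Q X
  have e2 := tr Y X
  have e3 := tr Y Xᵀ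
  have e4 := tr P Y
  have e5 := cyc G P G Y
  have e6 := cyc G P G Q
  have e7 := cyc G Pᵀ G Yᵀ
  have e8 := cyc G Y G X
  have e10 := cyc G Y G Xᵀ
  have e9 := cyc G Yᵀ G X
  rw [hQ] at e1
  rw [transpose_transpose] at e3
  rw [hP] at e4 e7
  linarith


/-- The reason for the reduction: the second derivatives in R_{ij} other than g^{kl} g_{ij,kl} are
exactly those contributed by the derivatives of the lowered Γ_i and Γ_j. -/
theorem sum_lowArr_second {G : Matrix ι ι ℝ} (hG : ∀ i j, G i j = G j i)
    {Q : ι → ι → ι → ι → ℝ} (hQ1 : ∀ k l i j, Q k l i j = Q l k i j)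
    (hQ2 : ∀ k l i j, Q k l i j = Q k l j i) (i j : ι) :
    ∑ k, ∑ m, G k m * lowArr (Q k) m i j - ∑ k, ∑ m, G k m * lowArr (Q j) m i k
      - (1 / 2) * (∑ a, ∑ b, G a b * lowArr (Q j) i a b + ∑ a, ∑ b, G a b * lowArr (Q i) j a b)
    = -(1 / 2) * ∑ k, ∑ l, G k l * Q k l i j := by
  have swap : ∀ f : ι → ι → ℝ, ∑ a, ∑ b, G a b * f a b = ∑ a, ∑ b, G a b * f b a := by
    intro f
    rw [Finset.sum_comm]
    exact Finset.sum_congr rfl fun a _ => Finset.sum_congr rfl fun b _ => by rw [hG]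
  have a1 : ∀ k m, G k m * lowArr (Q k) m i j = (1 / 2) * (G k m * Q i k j m)
      + (1 / 2) * (G k m * Q j k i m) - (1 / 2) * (G k m * Q k m i j) := fun k m => by
    rw [lowArr, hQ1 k i, hQ1 k j, hQ2 i, hQ2 j]; ring
  have a2 : ∀ k m, G k m * lowArr (Q j) m i k = (1 / 2) * (G k m * Q i j k m)
      + (1 / 2) * (G k m * Q j k i m) - (1 / 2) * (G k m * Q j m i k) := fun k m => by
    rw [lowArr, hQ1 j i, hQ2 i j m, hQ2 j k m]; ring
  have a3 : ∀ i j a b, G a b * lowArr (Q j) i a b = (1 / 2) * (G a b * Q j a i b)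
      + (1 / 2) * (G a b * Q j b i a) - (1 / 2) * (G a b * Q j i a b) := fun i j a b => by
    rw [lowArr]; ring
  simp only [a1, a2, a3, Finset.sum_add_distrib, Finset.sum_sub_distrib, ← Finset.mul_sum]
  rw [swap fun k m => Q j m i k, swap fun k m => Q i m j k]
  simp only [hQ1 j i]
  ring

/-- Index algebra separated from calculus: `G` is g^{ij}, `P` and `Q` are the first and second
derivatives of g, `C` is Γ^k_{ij}, `H` is Γ^k, and `dh l i` is the l-derivative of the lowered Γ_i.
The brackets with `dh` are then g_{ki}Γ^k_{,j} and g_{kj}Γ^k_{,i}. -/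
theorem reduced_ricci_contraction {G : Matrix ι ι ℝ} (hG : ∀ i j, G i j = G j i)
    {P : ι → ι → ι → ℝ} (hP : ∀ k i j, P k i j = P k j i)
    {Q : ι → ι → ι → ι → ℝ} (hQ1 : ∀ k l i j, Q k l i j = Q l k i j)
    (hQ2 : ∀ k l i j, Q k l i j = Q k l j i)
    {dG C : ι → ι → ι → ℝ} {dh : ι → ι → ℝ} {dC : ι → ι → ι → ι → ℝ} {H : ι → ℝ}
    (hdG : ∀ l a b, dG l a b = -∑ c, ∑ d, G a c * P l c d * G d b)
    (hC : ∀ k i j, C k i j = ∑ m, G k m * lowArr P m i j)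
    (hdC : ∀ l k i j, dC l k i j
      = ∑ m, (dG l k m * lowArr P m i j + G k m * lowArr (Q l) m i j))
    (hH : ∀ k, H k = ∑ a, ∑ b, G a b * C k a b)
    (hdh : ∀ l i, dh l i = ∑ a, ∑ b,
      (dG l a b * lowArr P i a b + G a b * lowArr (Q l) i a b)) (i j : ι) :
    ∑ k, dC k k i j - ∑ k, dC j k i k + ∑ k, ∑ l, C k k l * C l i j
      - ∑ k, ∑ l, C k j l * C l i k
      - (1 / 2) * ((dh j i - ∑ k, P j k i * H k) + (dh i j - ∑ k, P i k j * H k))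
    = -(1 / 2) * ∑ k, ∑ l, G k l * Q k l i j + (1 / 2) * ∑ k, H k * P k i j
      + ∑ c, ∑ a, ∑ b, ∑ d, lowArr P c a i * G a b * G c d * P b j d
      + (1 / 2) * ∑ c, ∑ a, ∑ b, ∑ d, P j c a * G a b * G c d * lowArr P i b d := by
  have hLs : ∀ m i j, lowArr P m i j = lowArr P m j i := fun m i j => by
    rw [lowArr, lowArr, hP m i j]; ring
  -- The (c, a) entries of `Pm i`, `W i`, `M i`, `Λ i` are g_{ca,i}, g_{ci,a}, Γ_{c,ai} and
  -- Γ_{i,ca}, so that double contractions become traces.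
  set Pm : ι → Matrix ι ι ℝ := fun k => Matrix.of (P k) with hPm
  set W : ι → Matrix ι ι ℝ := fun i => Matrix.of fun c a => P a c i with hW
  set M : ι → Matrix ι ι ℝ := fun i => (1 / 2 : ℝ) • (Pm i + W i - (W i)ᵀ) with hM
  set Λ : ι → Matrix ι ι ℝ := fun i => (1 / 2 : ℝ) • (W i + (W i)ᵀ - Pm i) with hΛ
  have hM' : ∀ c a i, lowArr P c a i = M i c a := fun c a i => by
    simp [hM, hPm, hW, lowArr, add_comm]
  have hΛ' : ∀ i k l, lowArr P i k l = Λ i k l := fun i k l => by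
    simp only [hΛ, hPm, hW, lowArr, Matrix.smul_apply, Matrix.sub_apply, Matrix.add_apply,
      Matrix.of_apply, Matrix.transpose_apply, smul_eq_mul, hP k l i, hP l k i]
    ring
  have hdG' : ∀ l a b, dG l a b = -(G * Pm l * G) a b := fun l a b => by
    rw [hdG, Matrix.mul_apply, Finset.sum_comm]
    simp [Matrix.mul_apply, Finset.sum_mul, hPm]
  set h : ι → ℝ := fun m => ∑ a, ∑ b, G a b * lowArr P m a b with hh
  have hH' : ∀ k, H k = ∑ m, G k m * h m := fun k => by
    simp only [hH, hC, hh, Finset.mul_sum]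
    rw [Finset.sum_comm_cycle]
    exact Finset.sum_congr rfl fun a _ => Finset.sum_congr rfl fun b _ =>
      Finset.sum_congr rfl fun m _ => by ring
  have s1 : ∑ k, dC k k i j = -∑ c, (∑ k, ∑ a, G k a * P k a c) * C c i j
      + ∑ k, ∑ m, G k m * lowArr (Q k) m i j := by
    simp only [hdC, Finset.sum_add_distrib, hdG, hC]
    congr 1
    simp only [neg_mul, Finset.sum_neg_distrib]
    congr 1
    have e : ∀ k m, (∑ c, ∑ d, G k c * P k c d * G d m) * lowArr P m i j
        = ∑ d, (∑ c, G k c * P k c d) * (G d m * lowArr P m i j) := fun k m => by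
      rw [Finset.sum_comm, Finset.sum_mul]
      refine Finset.sum_congr rfl fun d _ => ?_
      rw [← Finset.sum_mul, mul_assoc]
    have e' : ∀ k, ∑ m, ∑ d, (∑ c, G k c * P k c d) * (G d m * lowArr P m i j)
        = ∑ d, (∑ c, G k c * P k c d) * ∑ m, G d m * lowArr P m i j := fun k => by
      rw [Finset.sum_comm]
      exact Finset.sum_congr rfl fun d _ => by rw [Finset.mul_sum]
    simp only [e, e']
    rw [Finset.sum_comm]
    exact Finset.sum_congr rfl fun d _ => by rw [Finset.sum_mul]
  have s2 : ∑ k, dC j k i k = -trace (G * Pm j * G * M i)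
      + ∑ k, ∑ m, G k m * lowArr (Q j) m i k := by
    simp only [hdC, Finset.sum_add_distrib, trace, diag, Matrix.mul_apply (M := G * Pm j * G)]
    congr 1
    rw [← Finset.sum_neg_distrib]
    refine Finset.sum_congr rfl fun k _ => ?_
    rw [← Finset.sum_neg_distrib]
    exact Finset.sum_congr rfl fun m _ => by rw [hLs, hM', hdG']; ring
  have s3 : ∑ k, ∑ l, C k k l * C l i j
      = ∑ l, ((1 / 2) * ∑ a, ∑ b, G a b * P l a b) * C l i j := by
    rw [Finset.sum_comm]
    refine Finset.sum_congr rfl fun l _ => ?_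
    rw [← Finset.sum_mul, ← sum_mul_lowArr_trace hG hP]
    simp only [hC]
  have s4 : ∑ k, ∑ l, C k j l * C l i k = trace (G * M j * (G * M i)) := by
    have : ∀ k j l, C k j l = (G * M j) k l := fun k j l => by
      rw [hC, Matrix.mul_apply]
      exact Finset.sum_congr rfl fun m _ => by rw [hLs, hM']
    simp only [this, trace, diag, Matrix.mul_apply (M := G * M j)]
  -- Since g^{ka} g_{ac,k} = Γ_c + ½ g^{ab} g_{ab,c}, the trace Γ^k_{kl} cancels against half of the
  -- divergence of g^{-1}, and only the Γ^k remain.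
  have s13 : -∑ c, (∑ k, ∑ a, G k a * P k a c) * C c i j
      + ∑ l, ((1 / 2) * ∑ a, ∑ b, G a b * P l a b) * C l i j
      = -∑ k, H k * lowArr P k i j := by
    have e : ∀ l, (∑ k, ∑ a, G k a * P k a l)
        = h l + (1 / 2) * ∑ a, ∑ b, G a b * P l a b := fun l => by
      rw [hh]; simp only []; rw [sum_mul_lowArr_eq hG hP]; ring
    have e2 : ∑ l, h l * C l i j = ∑ k, H k * lowArr P k i j := by
      simp only [hC, hH', Finset.mul_sum, Finset.sum_mul]
      rw [Finset.sum_comm]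
      exact Finset.sum_congr rfl fun a _ => Finset.sum_congr rfl fun b _ => by rw [hG]; ring
    simp only [e, add_mul, Finset.sum_add_distrib, e2]
    ring
  have s5 : ∀ l i, dh l i = -trace (G * Pm l * G * Λ i)
      + ∑ a, ∑ b, G a b * lowArr (Q l) i a b := fun l i => by
    simp only [hdh, Finset.sum_add_distrib, trace, diag, Matrix.mul_apply (M := G * Pm l * G)]
    congr 1
    rw [← Finset.sum_neg_distrib]
    refine Finset.sum_congr rfl fun k _ => ?_
    rw [← Finset.sum_neg_distrib]
    exact Finset.sum_congr rfl fun m _ => by rw [hLs, hΛ', hdG']; ring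
  have s6 : ∑ k, H k * lowArr P k i j = (1 / 2) * ∑ k, P i k j * H k
      + (1 / 2) * ∑ k, P j k i * H k - (1 / 2) * ∑ k, H k * P k i j := by
    simp only [Finset.mul_sum, ← Finset.sum_add_distrib, ← Finset.sum_sub_distrib]
    exact Finset.sum_congr rfl fun m _ => by rw [lowArr]; ring
  have s7 : ∑ c, ∑ a, ∑ b, ∑ d, lowArr P c a i * G a b * G c d * P b j d
      = trace ((M i)ᵀ * G * W j * G) := by
    simp only [trace, diag, Matrix.mul_apply, Finset.sum_mul, Matrix.transpose_apply]
    rw [Finset.sum_comm]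
    refine Finset.sum_congr rfl fun a _ => ?_
    rw [Finset.sum_comm]
    refine Finset.sum_congr rfl fun b _ => ?_
    rw [Finset.sum_comm]
    refine Finset.sum_congr rfl fun d _ => Finset.sum_congr rfl fun c _ => ?_
    rw [hM', hG a b, hP b j d]; simp only [hW, Matrix.of_apply]; ring
  have s8 : ∑ c, ∑ a, ∑ b, ∑ d, P j c a * G a b * G c d * lowArr P i b d
      = trace (Pm j * G * Λ i * G) := by
    simp only [trace, diag, Matrix.mul_apply, Finset.sum_mul]
    rw [Finset.sum_comm]
    refine Finset.sum_congr rfl fun a _ => ?_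
    rw [Finset.sum_comm]
    refine Finset.sum_congr rfl fun b _ => ?_
    rw [Finset.sum_comm]
    refine Finset.sum_congr rfl fun d _ => Finset.sum_congr rfl fun c _ => ?_
    rw [hΛ', hG a b, hG c d, hP j c a, ← hΛ', hLs, hΛ']; simp only [hPm, Matrix.of_apply]; ring_nf
  have s9 := sum_lowArr_second hG hQ1 hQ2 i j
  have s10 := trace_identity (G := G) (P := Pm i) (Q := Pm j) (X := W i) (Y := W j)
    (by ext a b; simp [hG a b]) (by ext a b; simp [hPm, hP i a b])
    (by ext a b; simp [hPm, hP j a b])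
  change trace (G * Pm j * G * M i) - trace (G * M j * (G * M i))
    + (1 / 2) * trace (G * Pm j * G * Λ i) + (1 / 2) * trace (G * Pm i * G * Λ j)
    = trace ((M i)ᵀ * G * W j * G) + (1 / 2) * trace (Pm j * G * Λ i * G) at s10
  rw [s1, s2, s3, s4, s5, s5, s7, s8]
  linarith

end RicciAlgebra

/-! ### Bilinearity and smoothness of the bracket and the scalar product. -/

section Bilinear

variable {𝔤 : Type*} [LieRing 𝔤] [LieAlgebra ℝ 𝔤] {N : ℕ} (b : Module.Basis (Fin N) ℝ 𝔤)
  (B : LinearMap.BilinForm ℝ 𝔤)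

theorem brk_add_left (u v w : Col N) : brk b (u + v) w = brk b u w + brk b v w := by
  simp only [brk, map_add, add_lie]

theorem brk_add_right (u v w : Col N) : brk b u (v + w) = brk b u v + brk b u w := by
  simp only [brk, map_add, lie_add]

theorem brk_smul_left (c : ℝ) (u v : Col N) : brk b (c • u) v = c • brk b u v := by
  simp only [brk, map_smul, smul_lie]

theorem brk_smul_right (c : ℝ) (u v : Col N) : brk b u (c • v) = c • brk b u v := by
  simp only [brk, map_smul, lie_smul]

theorem brk_zero_left (v : Col N) : brk b 0 v = 0 := by
  simp only [brk, map_zero, zero_lie]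

theorem brk_zero_right (v : Col N) : brk b v 0 = 0 := by
  simp only [brk, map_zero, lie_zero]

theorem brk_neg_right (u v : Col N) : brk b u (-v) = -brk b u v := by
  simp only [brk, map_neg, lie_neg]

theorem brk_self (u : Col N) : brk b u u = 0 := by
  simp only [brk, lie_self, map_zero]

theorem brk_skew (u v : Col N) : brk b u v = -brk b v u := by
  simp only [brk]; rw [← lie_skew, map_neg]

theorem dot_add_left (u v w : Col N) : dot b B (u + v) w = dot b B u w + dot b B v w := by
  simp only [dot, map_add, LinearMap.add_apply]

theorem dot_add_right (u v w : Col N) : dot b B u (v + w) = dot b B u v + dot b B u w := by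
  simp only [dot, map_add]

theorem dot_sub_left (u v w : Col N) : dot b B (u - v) w = dot b B u w - dot b B v w := by
  simp only [dot, map_sub, LinearMap.sub_apply]

theorem dot_sub_right (u v w : Col N) : dot b B u (v - w) = dot b B u v - dot b B u w := by
  simp only [dot, map_sub]

theorem dot_neg_right (u v : Col N) : dot b B u (-v) = -dot b B u v := by
  simp only [dot, map_neg]

theorem dot_smul_left (c : ℝ) (u v : Col N) : dot b B (c • u) v = c * dot b B u v := by
  simp only [dot, map_smul, LinearMap.smul_apply, smul_eq_mul]

theorem dot_smul_right (c : ℝ) (u v : Col N) : dot b B u (c • v) = c * dot b B u v := by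
  simp only [dot, map_smul, smul_eq_mul]

theorem dot_zero_left (u : Col N) : dot b B 0 u = 0 := by
  simp only [dot, map_zero, LinearMap.zero_apply]

theorem dot_zero_right (u : Col N) : dot b B u 0 = 0 := by
  simp only [dot, map_zero]

theorem dot_comm (hB : B.IsSymm) (u v : Col N) : dot b B u v = dot b B v u := hB.eq _ _

theorem contDiff_brk : ContDiff ℝ ∞ fun p : Col N × Col N => brk b p.1 p.2 := by
  let f : Col N →ₗ[ℝ] Col N →ₗ[ℝ] Col N := LinearMap.mk₂ ℝ (brk b) (brk_add_left b)
    (brk_smul_left b) (brk_add_right b) (brk_smul_right b)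
  exact f.toContinuousBilinearMap.isBoundedBilinearMap.contDiff

theorem contDiff_dot : ContDiff ℝ ∞ fun p : Col N × Col N => dot b B p.1 p.2 := by
  let f : Col N →ₗ[ℝ] Col N →ₗ[ℝ] ℝ := LinearMap.mk₂ ℝ (dot b B) (dot_add_left b B)
    (dot_smul_left b B) (dot_add_right b B) (dot_smul_right b B)
  exact f.toContinuousBilinearMap.isBoundedBilinearMap.contDiff

theorem contDiffOn_brk {U : Set Pt} {u v : Pt → Col N} (hu : ContDiffOn ℝ ∞ u U)
    (hv : ContDiffOn ℝ ∞ v U) : ContDiffOn ℝ ∞ (fun x => brk b (u x) (v x)) U :=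
  ContDiff.comp_contDiffOn (g := fun p : Col N × Col N => brk b p.1 p.2)
    (f := fun x => (u x, v x)) (contDiff_brk b) (hu.prodMk hv)

end Bilinear

/-! ### Smoothness of the inverse of a matrix of functions. -/

section InverseMatrix

variable {n : ℕ} {U : Set Pt}

theorem contDiffOn_det {m : Fin n → Fin n → Pt → ℝ} (hm : ∀ i j, ContDiffOn ℝ ∞ (m i j) U) :
    ContDiffOn ℝ ∞ (fun x => (Matrix.of fun i j => m i j x).det) U := by
  simp only [Matrix.det_apply', Matrix.of_apply]
  exact ContDiffOn.sum fun σ _ => contDiffOn_const.mul (contDiffOn_prod fun i _ => hm _ _)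

theorem contDiffOn_inv_apply {m : Fin n → Fin n → Pt → ℝ}
    (hm : ∀ i j, ContDiffOn ℝ ∞ (m i j) U)
    (hdet : ∀ x ∈ U, (Matrix.of fun i j => m i j x).det ≠ 0) (i j : Fin n) :
    ContDiffOn ℝ ∞ (fun x => (Matrix.of fun i j => m i j x)⁻¹ i j) U := by
  simp only [Matrix.inv_def, Ring.inverse_eq_inv', Matrix.smul_apply, smul_eq_mul,
    Matrix.adjugate_apply]
  refine ((contDiffOn_det hm).inv hdet).mul ?_
  -- An entry of the adjugate is the determinant of the matrix with one row replaced by a constant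
  -- basis vector, again a matrix of smooth functions.
  have : ∀ x, (Matrix.of fun i j => m i j x).updateRow j (Pi.single i 1)
      = Matrix.of fun k l => (if k = j then fun _ => (Pi.single i 1 : Fin n → ℝ) l else m k l) x := by
    intro x
    ext k l
    by_cases hk : k = j
    · subst hk; simp
    · simp [hk]
  simp only [this]
  refine contDiffOn_det (m := fun k l =>
    if k = j then fun _ => (Pi.single i 1 : Fin n → ℝ) l else m k l) fun k l => ?_
  by_cases hk : k = j
  · simp only [hk, if_true]; exact contDiffOn_const
  · simp only [hk, if_false]; exact hm k l

end InverseMatrix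

/-! ### The reduced Ricci tensor of a general metric. -/

/-- `g` is a smooth non-degenerate symmetric tensor field on the open set `U`. -/
structure IsMetricOn (U : Set Pt) (g : Fin 4 → Fin 4 → Pt → ℝ) : Prop where
  isOpen : IsOpen U
  smooth : ∀ i j, ContDiffOn ℝ ∞ (g i j) U
  symm : ∀ i j, g i j = g j i
  det_ne : ∀ x ∈ U, (gMat g x).det ≠ 0

namespace IsMetricOn

variable {U : Set Pt} {g : Fin 4 → Fin 4 → Pt → ℝ} {x : Pt}

theorem contDiffOn_ginv (hg : IsMetricOn U g) (i j : Fin 4) : ContDiffOn ℝ ∞ (ginv g i j) U :=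
  contDiffOn_inv_apply hg.smooth hg.det_ne i j

theorem contDiffOn_christoffel (hg : IsMetricOn U g) (k i j : Fin 4) :
    ContDiffOn ℝ ∞ (christoffel g k i j) U :=
  contDiffOn_const.mul (ContDiffOn.sum fun m _ => (hg.contDiffOn_ginv k m).mul
    (((contDiffOn_pd hg.isOpen (hg.smooth m j) i).add
      (contDiffOn_pd hg.isOpen (hg.smooth m i) j)).sub
      (contDiffOn_pd hg.isOpen (hg.smooth i j) m)))

theorem contDiffOn_harmonic (hg : IsMetricOn U g) (k : Fin 4) :
    ContDiffOn ℝ ∞ (harmonic g k) U :=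
  ContDiffOn.sum fun i _ => ContDiffOn.sum fun j _ =>
    (hg.contDiffOn_ginv i j).mul (hg.contDiffOn_christoffel k i j)

theorem ginv_symm (hg : IsMetricOn U g) (i j : Fin 4) : ginv g i j = ginv g j i := by
  funext x
  have h : (gMat g x).transpose = gMat g x := by
    ext a b; simp [gMat, hg.symm a b]
  have h2 : ((gMat g x)⁻¹).transpose = (gMat g x)⁻¹ := by
    rw [Matrix.transpose_nonsing_inv, h]
  simp only [ginv]
  conv_lhs => rw [← h2]
  rfl

theorem sum_ginv_mul (hg : IsMetricOn U g) (hx : x ∈ U) (i j : Fin 4) :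
    ∑ k, ginv g i k x * g k j x = if i = j then 1 else 0 := by
  have h := Matrix.nonsing_inv_mul (gMat g x) (hg.det_ne x hx).isUnit
  have h2 := congrFun (congrFun h i) j
  rw [Matrix.mul_apply, Matrix.one_apply] at h2
  exact h2

theorem sum_mul_ginv (hg : IsMetricOn U g) (hx : x ∈ U) (i j : Fin 4) :
    ∑ k, g i k x * ginv g k j x = if i = j then 1 else 0 := by
  have h := Matrix.mul_nonsing_inv (gMat g x) (hg.det_ne x hx).isUnit
  have h2 := congrFun (congrFun h i) j
  rw [Matrix.mul_apply, Matrix.one_apply] at h2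
  exact h2

theorem diff (hg : IsMetricOn U g) (hx : x ∈ U) (i j : Fin 4) : DifferentiableAt ℝ (g i j) x :=
  (hg.smooth i j).diffAt hg.isOpen hx

theorem diff_pd (hg : IsMetricOn U g) (hx : x ∈ U) (k i j : Fin 4) :
    DifferentiableAt ℝ (pd k (g i j)) x :=
  (contDiffOn_pd hg.isOpen (hg.smooth i j) k).diffAt hg.isOpen hx

theorem diff_ginv (hg : IsMetricOn U g) (hx : x ∈ U) (i j : Fin 4) :
    DifferentiableAt ℝ (ginv g i j) x :=
  (hg.contDiffOn_ginv i j).diffAt hg.isOpen hx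

theorem diff_harmonic (hg : IsMetricOn U g) (hx : x ∈ U) (k : Fin 4) :
    DifferentiableAt ℝ (harmonic g k) x :=
  (hg.contDiffOn_harmonic k).diffAt hg.isOpen hx

theorem pd_ginv (hg : IsMetricOn U g) (hx : x ∈ U) (l a e : Fin 4) :
    pd l (ginv g a e) x = -∑ c, ∑ d, ginv g a c x * pd l (g c d) x * ginv g d e x := by
  have h1 : ∀ d, ∑ c, pd l (ginv g a c) x * g c d x
      = -∑ c, ginv g a c x * pd l (g c d) x := fun d => by
    have h := pd_congr (i := l) hg.isOpen
      (f := fun y => ∑ k, ginv g a k y * g k d y) (g := fun _ => if a = d then (1 : ℝ) else 0)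
      (fun y hy => hg.sum_ginv_mul hy a d) hx
    have d1 := hg.diff_ginv hx
    have d2 := hg.diff hx
    rw [pd_const, pd_sum fun k _ => by fun_prop] at h
    have h3 : ∀ k, pd l (fun y => ginv g a k y * g k d y) x
        = pd l (ginv g a k) x * g k d x + ginv g a k x * pd l (g k d) x := fun k =>
      pd_mul (d1 a k) (d2 k d)
    simp only [h3, Finset.sum_add_distrib] at h
    linarith
  have h2 : pd l (ginv g a e) x = ∑ d, (∑ c, pd l (ginv g a c) x * g c d x) * ginv g d e x := by
    simp only [Finset.sum_mul]
    rw [Finset.sum_comm]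
    simp only [mul_assoc, ← Finset.mul_sum, hg.sum_mul_ginv hx]
    simp
  rw [h2, Finset.sum_comm, ← Finset.sum_neg_distrib]
  refine Finset.sum_congr rfl fun d _ => ?_
  rw [h1, neg_mul, Finset.sum_mul]

theorem christoffel_eq (g : Fin 4 → Fin 4 → Pt → ℝ) (k i j : Fin 4) (x : Pt) :
    christoffel g k i j x
      = ∑ m, ginv g k m x * lowArr (fun l a c => pd l (g a c) x) m i j := by
  simp only [christoffel, lowArr, Finset.mul_sum]
  exact Finset.sum_congr rfl fun m _ => by ring

theorem pd_lowArr (hg : IsMetricOn U g) (hx : x ∈ U) (l m i j : Fin 4) :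
    pd l (fun y => lowArr (fun k a c => pd k (g a c) y) m i j) x
      = lowArr (fun k a c => pd l (pd k (g a c)) x) m i j := by
  have d := hg.diff_pd hx
  simp only [lowArr]
  rw [pd_const_mul _ (by fun_prop), pd_sub (by fun_prop) (by fun_prop),
    pd_add (by fun_prop) (by fun_prop)]

theorem diff_lowArr (hg : IsMetricOn U g) (hx : x ∈ U) (m i j : Fin 4) :
    DifferentiableAt ℝ (fun y => lowArr (fun k a c => pd k (g a c) y) m i j) x := by
  have d := hg.diff_pd hx
  simp only [lowArr]
  fun_prop

theorem pd_christoffel (hg : IsMetricOn U g) (hx : x ∈ U) (l k i j : Fin 4) :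
    pd l (christoffel g k i j) x
      = ∑ m, (pd l (ginv g k m) x * lowArr (fun l a c => pd l (g a c) x) m i j
        + ginv g k m x * lowArr (fun k a c => pd l (pd k (g a c)) x) m i j) := by
  have d1 := hg.diff_ginv hx
  have d2 := hg.diff_lowArr hx
  have h : christoffel g k i j
      = fun y => ∑ m, ginv g k m y * lowArr (fun l a c => pd l (g a c) y) m i j :=
    funext fun y => christoffel_eq g k i j y
  rw [h, pd_sum fun m _ => (d1 k m).fun_mul (d2 m i j)]
  exact Finset.sum_congr rfl fun m _ => by rw [pd_mul (d1 k m) (d2 m i j), hg.pd_lowArr hx]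

/-- Lowering the index of `Γ^k`. -/
theorem sum_mul_harmonic (hg : IsMetricOn U g) (hx : x ∈ U) (i : Fin 4) :
    ∑ k, g k i x * harmonic g k x
      = ∑ a, ∑ c, ginv g a c x * lowArr (fun l a c => pd l (g a c) x) i a c := by
  simp only [EYMH.harmonic, christoffel_eq, Finset.mul_sum]
  rw [Finset.sum_comm]
  refine Finset.sum_congr rfl fun a _ => ?_
  rw [Finset.sum_comm]
  refine Finset.sum_congr rfl fun c _ => ?_
  rw [Finset.sum_comm]
  have : ∀ m k, g k i x * (ginv g a c x * (ginv g k m x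
      * lowArr (fun l a c => pd l (g a c) x) m a c))
      = (g i k x * ginv g k m x) * (ginv g a c x
        * lowArr (fun l a c => pd l (g a c) x) m a c) := fun m k => by
    rw [hg.symm k i]; ring
  simp only [this, ← Finset.sum_mul, hg.sum_mul_ginv hx]
  simp

/-- Product rule for the lowered Γ_i = g_{ki}Γ^k, put in the form that `reduced_ricci_contraction`
expects of `dh`. -/
theorem sum_mul_pd_harmonic (hg : IsMetricOn U g) (hx : x ∈ U) (j i : Fin 4) :
    ∑ k, g k i x * pd j (harmonic g k) x
      = ∑ a, ∑ c, (pd j (ginv g a c) x * lowArr (fun l a c => pd l (g a c) x) i a c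
          + ginv g a c x * lowArr (fun k a c => pd j (pd k (g a c)) x) i a c)
        - ∑ k, pd j (g k i) x * harmonic g k x := by
  have h := pd_congr (i := j) hg.isOpen (f := fun y => ∑ k, g k i y * harmonic g k y)
    (fun y hy => hg.sum_mul_harmonic hy i) hx
  have d1 := hg.diff_ginv hx
  have d2 := hg.diff_lowArr hx
  have d3 := hg.diff hx
  have d4 := hg.diff_harmonic hx
  rw [pd_sum fun k _ => (d3 k i).fun_mul (d4 k),
    pd_sum fun a _ => DifferentiableAt.fun_sum fun c _ => (d1 a c).fun_mul (d2 i a c)] at h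
  have h1 : ∀ a, pd j (fun y => ∑ c, ginv g a c y * lowArr (fun l a c => pd l (g a c) y) i a c) x
      = ∑ c, (pd j (ginv g a c) x * lowArr (fun l a c => pd l (g a c) x) i a c
          + ginv g a c x * lowArr (fun k a c => pd j (pd k (g a c)) x) i a c) := fun a => by
    rw [pd_sum fun c _ => (d1 a c).fun_mul (d2 i a c)]
    exact Finset.sum_congr rfl fun c _ => by rw [pd_mul (d1 a c) (d2 i a c), hg.pd_lowArr hx]
  have h2 : ∀ k, pd j (fun y => g k i y * harmonic g k y) x
      = pd j (g k i) x * harmonic g k x + g k i x * pd j (harmonic g k) x := fun k =>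
    pd_mul (d3 k i) (d4 k)
  simp only [h1, h2] at h
  rw [← h, Finset.sum_add_distrib]
  ring

/-- The reduced Ricci tensor is the wave operator on the metric plus quadratic terms in the first
derivatives. -/
theorem reducedRicci_eq (hg : IsMetricOn U g) (hx : x ∈ U) (i j : Fin 4) :
    reducedRicci g i j x
      = -(1 / 2) * ∑ k, ∑ l, ginv g k l x * pd k (pd l (g i j)) x
        + (1 / 2) * ∑ k, harmonic g k x * pd k (g i j) x
        + ∑ c, ∑ a, ∑ e, ∑ d, lowArr (fun l a c => pd l (g a c) x) c a i
            * ginv g a e x * ginv g c d x * pd e (g j d) x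
        + (1 / 2) * ∑ c, ∑ a, ∑ e, ∑ d, pd j (g c a) x * ginv g a e x * ginv g c d x
            * lowArr (fun l a c => pd l (g a c) x) i e d := by
  have h := reduced_ricci_contraction (G := fun a c => ginv g a c x)
    (P := fun l a c => pd l (g a c) x) (Q := fun k l a c => pd k (pd l (g a c)) x)
    (fun a c => by rw [hg.ginv_symm]) (fun k a c => by rw [hg.symm])
    (fun k l a c => pd_comm hg.isOpen (hg.smooth a c) hx) (fun k l a c => by rw [hg.symm])
    (fun l a c => hg.pd_ginv hx l a c) (fun k i j => christoffel_eq g k i j x)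
    (fun l k i j => hg.pd_christoffel hx l k i j) (fun k => rfl) (fun l i => rfl) i j
  change _ = -(1 / 2) * _ + (1 / 2) * ∑ k, harmonic g k x * pd k (g i j) x + _ + _ at h
  rw [← h, reducedRicci, ricci, Finset.sum_add_distrib, hg.sum_mul_pd_harmonic hx,
    hg.sum_mul_pd_harmonic hx]
  rfl

end IsMetricOn

/-! ### The gauge function Δ and the reduced Yang-Mills operator. -/

namespace IsMetricOn

variable {U : Set Pt} {g : Fin 4 → Fin 4 → Pt → ℝ} {x : Pt}

theorem harmonic_eq (g : Fin 4 → Fin 4 → Pt → ℝ) (k : Fin 4) (x : Pt) :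
    harmonic g k x = ∑ m, ginv g k m x
      * ∑ a, ∑ c, ginv g a c x * lowArr (fun l a c => pd l (g a c) x) m a c := by
  simp only [EYMH.harmonic, christoffel_eq, Finset.mul_sum]
  rw [Finset.sum_comm_cycle]
  exact Finset.sum_congr rfl fun a _ => Finset.sum_congr rfl fun b _ =>
    Finset.sum_congr rfl fun m _ => by ring

/-- The contracted form `g^{ia}_{,i} + Γ^i_{im} g^{ma} = -Γ^a` of metric compatibility. -/
theorem sum_pd_ginv_add (hg : IsMetricOn U g) (hx : x ∈ U) (a : Fin 4) :
    ∑ i, pd i (ginv g i a) x + ∑ i, ∑ m, christoffel g i i m x * ginv g m a x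
      = -harmonic g a x := by
  have hGs : ∀ i j, ginv g i j x = ginv g j i x := fun i j => by rw [hg.ginv_symm]
  have hPs : ∀ k i j, pd k (g i j) x = pd k (g j i) x := fun k i j => by rw [hg.symm]
  have h1 : ∑ i, pd i (ginv g i a) x
      = -∑ m, ginv g a m x * ∑ i, ∑ c, ginv g i c x * pd i (g c m) x := by
    simp only [hg.pd_ginv hx, Finset.sum_neg_distrib, Finset.mul_sum]
    congr 1
    rw [Finset.sum_comm_cycle]
    exact Finset.sum_congr rfl fun i _ => Finset.sum_congr rfl fun c _ =>
      Finset.sum_congr rfl fun m _ => by rw [hGs a]; ring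
  have h2 : ∑ i, ∑ m, christoffel g i i m x * ginv g m a x
      = ∑ m, ginv g a m x * ((1 / 2) * ∑ i, ∑ c, ginv g i c x * pd m (g i c) x) := by
    rw [Finset.sum_comm]
    refine Finset.sum_congr rfl fun m _ => ?_
    rw [← Finset.sum_mul, hGs m a, mul_comm]
    congr 1
    rw [← sum_mul_lowArr_trace (G := fun i j => ginv g i j x)
      (P := fun l a c => pd l (g a c) x) hGs hPs m]
    simp only [christoffel_eq]
  rw [h1, h2, harmonic_eq]
  simp only [sum_mul_lowArr_eq (G := fun i j => ginv g i j x)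
      (P := fun l a c => pd l (g a c) x) hGs hPs, mul_sub, Finset.sum_sub_distrib]
  ring

variable {N : ℕ} {A : Fin 4 → Pt → Col N}

/-- By `sum_pd_ginv_add` the derivatives of g^{ij} and the trace Γ^i_{im} combine to -Γ^j. -/
theorem lorenz_eq (hg : IsMetricOn U g) (hA : ∀ i, ContDiffOn ℝ ∞ (A i) U) (hx : x ∈ U) :
    lorenz g A x = ∑ i, ∑ j, ginv g i j x • pd i (A j) x - ∑ j, harmonic g j x • A j x := by
  have d1 := hg.diff_ginv hx
  have d2 : ∀ i, DifferentiableAt ℝ (A i) x := fun i => (hA i).diffAt hg.isOpen hx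
  have h1 : ∀ i, pd i (potUp g A i) x
      = ∑ j, (pd i (ginv g i j) x • A j x + ginv g i j x • pd i (A j) x) := fun i => by
    have : potUp g A i = fun y => ∑ j, ginv g i j y • A j y := rfl
    rw [this, pd_sum fun j _ => (d1 i j).fun_smul (d2 j)]
    exact Finset.sum_congr rfl fun j _ => pd_smul (d1 i j) (d2 j)
  have h2 : ∑ i, ∑ j, pd i (ginv g i j) x • A j x
      + ∑ i, ∑ m, christoffel g i i m x • potUp g A m x = -∑ j, harmonic g j x • A j x := by
    have e1 : ∑ i, ∑ m, christoffel g i i m x • potUp g A m x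
        = ∑ j, (∑ i, ∑ m, christoffel g i i m x * ginv g m j x) • A j x := by
      simp only [potUp, Finset.smul_sum, Finset.sum_smul, smul_smul]
      rw [Finset.sum_comm_cycle]
    rw [e1, Finset.sum_comm]
    simp only [← Finset.sum_smul, ← Finset.sum_add_distrib, ← add_smul]
    rw [← Finset.sum_neg_distrib]
    exact Finset.sum_congr rfl fun j _ => by
      rw [Finset.sum_add_distrib, hg.sum_pd_ginv_add hx, neg_smul]
  simp only [lorenz, h1, Finset.sum_add_distrib]
  rw [sub_eq_add_neg, ← h2]
  abel

theorem contDiffOn_lorenz (hg : IsMetricOn U g) (hA : ∀ i, ContDiffOn ℝ ∞ (A i) U) :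
    ContDiffOn ℝ ∞ (lorenz g A) U := by
  have : ContDiffOn ℝ ∞ (fun x => ∑ i, ∑ j, ginv g i j x • pd i (A j) x
      - ∑ j, harmonic g j x • A j x) U :=
    (ContDiffOn.sum fun i _ => ContDiffOn.sum fun j _ =>
      (hg.contDiffOn_ginv i j).smul (contDiffOn_pd hg.isOpen (hA j) i)).sub
      (ContDiffOn.sum fun j _ => (hg.contDiffOn_harmonic j).smul (hA j))
  exact this.congr fun y hy => hg.lorenz_eq hA hy

/-- The terms that L adds to Δ_{,p} are (Γ^l A_l)_{,p}; they cancel the Γ-part of Δ, so no second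
derivative of g remains. -/
theorem pd_lorenz_add (hg : IsMetricOn U g) (hA : ∀ i, ContDiffOn ℝ ∞ (A i) U) (hx : x ∈ U)
    (p : Fin 4) :
    pd p (lorenz g A) x
      + ∑ l, (pd p (harmonic g l) x • A l x + harmonic g l x • pd p (A l) x)
    = ∑ i, ∑ j, (pd p (ginv g i j) x • pd i (A j) x + ginv g i j x • pd p (pd i (A j)) x) := by
  have d1 := hg.diff_ginv hx
  have d2 : ∀ i, DifferentiableAt ℝ (A i) x := fun i => (hA i).diffAt hg.isOpen hx
  have d3 := hg.diff_harmonic hx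
  have d4 : ∀ i j, DifferentiableAt ℝ (pd i (A j)) x := fun i j =>
    (contDiffOn_pd hg.isOpen (hA j) i).diffAt hg.isOpen hx
  have h := pd_congr (i := p) hg.isOpen (fun y hy => hg.lorenz_eq hA hy) hx
  rw [h, pd_sub (DifferentiableAt.fun_sum fun i _ => DifferentiableAt.fun_sum fun j _ =>
      (d1 i j).fun_smul (d4 i j)) (DifferentiableAt.fun_sum fun j _ => (d3 j).fun_smul (d2 j)),
    pd_sum fun i _ => DifferentiableAt.fun_sum fun j _ => (d1 i j).fun_smul (d4 i j),
    pd_sum fun j _ => (d3 j).fun_smul (d2 j)]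
  have e1 : ∀ j, pd p (fun y => harmonic g j y • A j y) x
      = pd p (harmonic g j) x • A j x + harmonic g j x • pd p (A j) x := fun j =>
    pd_smul (d3 j) (d2 j)
  have e2 : ∀ i, pd p (fun y => ∑ j, ginv g i j y • pd i (A j) y) x
      = ∑ j, (pd p (ginv g i j) x • pd i (A j) x + ginv g i j x • pd p (pd i (A j)) x) :=
    fun i => by
      rw [pd_sum fun j _ => (d1 i j).fun_smul (d4 i j)]
      exact Finset.sum_congr rfl fun j _ => pd_smul (d1 i j) (d4 i j)
  simp only [e1, e2]
  abel

section Curvature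

variable {𝔤 : Type*} [LieRing 𝔤] [LieAlgebra ℝ 𝔤] (b : Module.Basis (Fin N) ℝ 𝔤)

theorem contDiffOn_curv (hg : IsMetricOn U g) (hA : ∀ i, ContDiffOn ℝ ∞ (A i) U)
    (i j : Fin 4) : ContDiffOn ℝ ∞ (curv b A i j) U :=
  ((contDiffOn_pd hg.isOpen (hA j) i).sub (contDiffOn_pd hg.isOpen (hA i) j)).add
    (contDiffOn_brk b (hA i) (hA j))

theorem curv_skew (i j : Fin 4) (x : Pt) : curv b A i j x = -curv b A j i x := by
  simp only [curv]
  rw [brk_skew]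
  abel

theorem curvUp_skew (i j : Fin 4) (x : Pt) : curvUp b g A i j x = -curvUp b g A j i x := by
  simp only [curvUp, ← Finset.sum_neg_distrib]
  rw [Finset.sum_comm]
  exact Finset.sum_congr rfl fun a _ => Finset.sum_congr rfl fun c _ => by
    rw [curv_skew b c a, smul_neg, mul_comm]

theorem sum_christoffel_smul_curvUp (hg : IsMetricOn U g) (j : Fin 4) (x : Pt) :
    ∑ i, ∑ m, christoffel g j i m x • curvUp b g A i m x = 0 := by
  have hΓ : ∀ i m, christoffel g j i m x = christoffel g j m i x := fun i m => by
    simp only [christoffel, hg.symm i m]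
    congr 1
    exact Finset.sum_congr rfl fun k _ => by ring
  have h : ∑ i, ∑ m, christoffel g j i m x • curvUp b g A i m x
      = -∑ i, ∑ m, christoffel g j i m x • curvUp b g A i m x := by
    conv_lhs => rw [Finset.sum_comm]
    simp only [← Finset.sum_neg_distrib]
    exact Finset.sum_congr rfl fun i _ => Finset.sum_congr rfl fun m _ => by
      rw [curvUp_skew b m i, hΓ m i, smul_neg]
  exact self_eq_neg.1 h

theorem sum_smul_curvUp (hg : IsMetricOn U g) (hx : x ∈ U) (i p : Fin 4) :
    ∑ j, g j p x • curvUp b g A i j x = ∑ a, ginv g i a x • curv b A a p x := by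
  simp only [curvUp, Finset.smul_sum, smul_smul]
  rw [Finset.sum_comm]
  refine Finset.sum_congr rfl fun a _ => ?_
  rw [Finset.sum_comm]
  have : ∀ c j, g j p x * (ginv g i a x * ginv g j c x)
      = ginv g i a x * (g p j x * ginv g j c x) := fun c j => by rw [hg.symm j p]; ring
  simp only [this, ← Finset.sum_smul, ← Finset.mul_sum, hg.sum_mul_ginv hx]
  simp

theorem contDiffOn_curvUp (hg : IsMetricOn U g) (hA : ∀ i, ContDiffOn ℝ ∞ (A i) U)
    (i j : Fin 4) : ContDiffOn ℝ ∞ (curvUp b g A i j) U :=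
  ContDiffOn.sum fun a _ => ContDiffOn.sum fun c _ =>
    ((hg.contDiffOn_ginv i a).mul (hg.contDiffOn_ginv j c)).smul (hg.contDiffOn_curv b hA a c)

/-- The index is lowered under the derivative by `sum_smul_curvUp`, at the price of the term with
g_{jp,i}. Of the connection terms, one vanishes by antisymmetry of F^{im} and the other joins the
divergence of g^{-1} to give -Γ^a F_{ap}. -/
theorem sum_smul_divCurv (hg : IsMetricOn U g) (hA : ∀ i, ContDiffOn ℝ ∞ (A i) U) (hx : x ∈ U)
    (p : Fin 4) :
    ∑ j, g j p x • divCurv b g A j x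
      = ∑ i, ∑ a, ginv g i a x • pd i (curv b A a p) x
        - ∑ a, harmonic g a x • curv b A a p x
        - ∑ i, ∑ j, pd i (g j p) x • curvUp b g A i j x
        + ∑ i, brk b (A i x) (∑ a, ginv g i a x • curv b A a p x) := by
  have d1 := hg.diff_ginv hx
  have d2 : ∀ i j, DifferentiableAt ℝ (curv b A i j) x := fun i j =>
    (hg.contDiffOn_curv b hA i j).diffAt hg.isOpen hx
  have d3 : ∀ i j, DifferentiableAt ℝ (curvUp b g A i j) x := fun i j =>
    (hg.contDiffOn_curvUp b hA i j).diffAt hg.isOpen hx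
  have d4 := hg.diff hx
  have e1 : ∀ i, ∑ j, g j p x • pd i (curvUp b g A i j) x
      = ∑ a, (pd i (ginv g i a) x • curv b A a p x + ginv g i a x • pd i (curv b A a p) x)
        - ∑ j, pd i (g j p) x • curvUp b g A i j x := fun i => by
    have h := pd_congr (i := i) hg.isOpen
      (f := fun y => ∑ j, g j p y • curvUp b g A i j y)
      (fun y hy => hg.sum_smul_curvUp b hy i p) hx
    rw [pd_sum fun j _ => (d4 j p).fun_smul (d3 i j),
      pd_sum fun a _ => (d1 i a).fun_smul (d2 a p)] at h
    have h1 : ∀ j, pd i (fun y => g j p y • curvUp b g A i j y) x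
        = pd i (g j p) x • curvUp b g A i j x + g j p x • pd i (curvUp b g A i j) x := fun j =>
      pd_smul (d4 j p) (d3 i j)
    have h2 : ∀ a, pd i (fun y => ginv g i a y • curv b A a p y) x
        = pd i (ginv g i a) x • curv b A a p x + ginv g i a x • pd i (curv b A a p) x :=
      fun a => pd_smul (d1 i a) (d2 a p)
    simp only [h1, h2] at h
    rw [← h, Finset.sum_add_distrib]
    abel
  have e2 : ∑ j, g j p x • ∑ i, ∑ m, christoffel g i i m x • curvUp b g A m j x
      = ∑ a, (∑ i, ∑ m, christoffel g i i m x * ginv g m a x) • curv b A a p x := by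
    have : ∀ i m, ∑ j, g j p x • christoffel g i i m x • curvUp b g A m j x
        = christoffel g i i m x • ∑ a, ginv g m a x • curv b A a p x := fun i m => by
      rw [← hg.sum_smul_curvUp b hx, Finset.smul_sum]
      exact Finset.sum_congr rfl fun j _ => smul_comm _ _ _
    simp only [Finset.smul_sum (s := Finset.univ)]
    rw [← Finset.sum_comm_cycle]
    simp only [this]
    simp only [Finset.smul_sum, Finset.sum_smul, smul_smul]
    rw [Finset.sum_comm_cycle]
  have e3 : ∑ j, g j p x • ∑ i, brk b (A i x) (curvUp b g A i j x)
      = ∑ i, brk b (A i x) (∑ a, ginv g i a x • curv b A a p x) := by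
    simp only [Finset.smul_sum]
    rw [Finset.sum_comm]
    refine Finset.sum_congr rfl fun i _ => ?_
    rw [← hg.sum_smul_curvUp b hx]
    simp only [← brk_smul_right]
    exact (map_sum (AddMonoidHom.mk' (brk b (A i x)) (brk_add_right b (A i x))) _ _).symm
  simp only [divCurv, Finset.sum_add_distrib, hg.sum_christoffel_smul_curvUp b, add_zero,
    smul_add]
  rw [e2, e3]
  have e4 : ∑ j, g j p x • ∑ i, pd i (curvUp b g A i j) x
      = ∑ i, ∑ j, g j p x • pd i (curvUp b g A i j) x := by
    simp only [Finset.smul_sum]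
    exact Finset.sum_comm
  have e5 : ∑ i, ∑ a, pd i (ginv g i a) x • curv b A a p x
      + ∑ a, (∑ i, ∑ m, christoffel g i i m x * ginv g m a x) • curv b A a p x
      = -∑ a, harmonic g a x • curv b A a p x := by
    rw [Finset.sum_comm]
    simp only [← Finset.sum_smul, ← Finset.sum_add_distrib, ← add_smul]
    rw [← Finset.sum_neg_distrib]
    exact Finset.sum_congr rfl fun j _ => by
      rw [Finset.sum_add_distrib, hg.sum_pd_ginv_add hx, neg_smul]
  rw [e4]
  simp only [e1, Finset.sum_sub_distrib, Finset.sum_add_distrib]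
  rw [sub_eq_add_neg _ (∑ a, harmonic g a x • curv b A a p x), ← e5]
  abel

/-- The reduced Yang-Mills operator. -/
theorem reducedYM_eq (hg : IsMetricOn U g) (hA : ∀ i, ContDiffOn ℝ ∞ (A i) U) (hx : x ∈ U)
    (p : Fin 4) :
    reducedYM b g A p x
      = ∑ i, ∑ a, ginv g i a x • pd i (curv b A a p) x
        - ∑ a, harmonic g a x • curv b A a p x
        - ∑ i, ∑ j, pd i (g j p) x • curvUp b g A i j x
        + ∑ i, brk b (A i x) (∑ a, ginv g i a x • curv b A a p x)
        + ∑ i, ∑ j, (pd p (ginv g i j) x • pd i (A j) x + ginv g i j x • pd p (pd i (A j)) x) := by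
  rw [reducedYM, hg.sum_smul_divCurv b hA hx, hg.pd_lorenz_add hA hx]

end Curvature

end IsMetricOn

/-! ### The metric and its reduced Ricci tensor on a null surface. -/

theorem ang_zero : ang 0 = 2 := rfl

theorem ang_one : ang 1 = 3 := rfl

theorem ang_ne_zero (α : Fin 2) : ang α ≠ 0 := by fin_cases α <;> decide

/-- `S` is a three-dimensional piece of the hyperplane `x¹ = 0` that is a null surface of the
metric `g`, with `∂₂` as null generator. -/
structure IsNullSurface (U S : Set Pt) (g : Fin 4 → Fin 4 → Pt → ℝ) : Prop
    extends IsMetricOn U g where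
  subset : S ⊆ U
  coord : ∀ x ∈ S, x 0 = 0
  threeDim : IsThreeDim S
  null : ∀ j, j ≠ 0 → ∀ x ∈ S, g 1 j x = 0

namespace IsNullSurface

variable {U S : Set Pt} {g : Fin 4 → Fin 4 → Pt → ℝ} {x : Pt}
  {E : Type*} [NormedAddCommGroup E] [NormedSpace ℝ E]

theorem pd_eq (hS : IsNullSurface U S g) {f f' : Pt → E} (hf : ContDiffOn ℝ ∞ f U)
    (hf' : ContDiffOn ℝ ∞ f' U) (h : ∀ x ∈ S, f x = f' x) {i : Fin 4} (hi : i ≠ 0)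
    (hx : x ∈ S) : pd i f x = pd i f' x :=
  pd_eq_of_eqOn hS.isOpen hS.subset hS.coord hS.threeDim hf hf' h hi hx

theorem pd_eq_zero (hS : IsNullSurface U S g) {f : Pt → E} (hf : ContDiffOn ℝ ∞ f U)
    (h : ∀ x ∈ S, f x = 0) {i : Fin 4} (hi : i ≠ 0) (hx : x ∈ S) : pd i f x = 0 :=
  pd_eq_zero_of_eqOn_zero hS.isOpen hS.subset hS.coord hS.threeDim hf h hi hx

theorem pd_null (hS : IsNullSurface U S g) (hx : x ∈ S) {i j : Fin 4} (hi : i ≠ 0) (hj : j ≠ 0) :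
    pd i (g 1 j) x = 0 :=
  hS.pd_eq_zero (hS.smooth 1 j) (hS.null j hj) hi hx

theorem pd_pd_null (hS : IsNullSurface U S g) (hx : x ∈ S) {i j k : Fin 4} (hi : i ≠ 0)
    (hk : k ≠ 0) (hj : j ≠ 0) : pd i (pd k (g 1 j)) x = 0 :=
  hS.pd_eq_zero (contDiffOn_pd hS.isOpen (hS.smooth 1 j) k)
    (fun _ hy => hS.pd_null hy hk hj) hi hx

/-- In the column (g_{k2}) only g_{12} survives on S. Reading g^{-1}g = 1 in that column gives both
this relation and `ginv_zero`. -/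
theorem ginv_mul_g (hS : IsNullSurface U S g) (hx : x ∈ S) : ginv g 0 1 x * g 0 1 x = 1 := by
  have h := hS.sum_ginv_mul (hS.subset hx) 1 1
  have h1 := hS.null 1 (by decide) x hx
  have h2 := hS.null 2 (by decide) x hx
  have h3 := hS.null 3 (by decide) x hx
  simpa [Fin.sum_univ_four, hS.symm 2 1, hS.symm 3 1, h1, h2, h3, hS.ginv_symm 1 0] using h

theorem g_ne_zero (hS : IsNullSurface U S g) (hx : x ∈ S) : g 0 1 x ≠ 0 :=
  right_ne_zero_of_mul_eq_one (hS.ginv_mul_g hx)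

theorem ginv_zero (hS : IsNullSurface U S g) (hx : x ∈ S) {i : Fin 4} (hi : i ≠ 1) :
    ginv g 0 i x = 0 := by
  have h := hS.sum_ginv_mul (hS.subset hx) i 1
  have h1 := hS.null 1 (by decide) x hx
  have h2 := hS.null 2 (by decide) x hx
  have h3 := hS.null 3 (by decide) x hx
  rw [if_neg hi] at h
  simpa [Fin.sum_univ_four, hS.symm 2 1, hS.symm 3 1, h1, h2, h3, hS.ginv_symm i 0,
    hS.g_ne_zero hx] using h

/-- In g^{αk} g_{kβ} the term k = 1 drops because g^{α1} = 0 and the term k = 2 because g_{2β} = 0,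
so the angular blocks are inverse to each other. -/
theorem sum_ginv_ang_mul (hS : IsNullSurface U S g) (hx : x ∈ S) (α β : Fin 2) :
    ∑ l, ginv g (ang α) (ang l) x * g (ang l) (ang β) x = if α = β then 1 else 0 := by
  have h := hS.sum_ginv_mul (hS.subset hx) (ang α) (ang β)
  have h1 : ginv g (ang α) 0 x = 0 := by
    rw [hS.ginv_symm]; exact hS.ginv_zero hx (by fin_cases α <;> decide)
  rw [Fin.sum_univ_four, h1, hS.null _ (ang_ne_zero β) x hx] at h
  have h2 : (ang α = ang β) ↔ α = β := by clear h h1; revert α β; decide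
  simp only [h2] at h
  rw [Fin.sum_univ_two, ang_zero, ang_one, ← h]
  ring

theorem sum_mul_ginv_ang (hS : IsNullSurface U S g) (hx : x ∈ S) (α β : Fin 2) :
    ∑ l, g (ang α) (ang l) x * ginv g (ang l) (ang β) x = if α = β then 1 else 0 := by
  have h := hS.sum_ginv_ang_mul hx β α
  simp only [eq_comm (a := α), ← h]
  exact Finset.sum_congr rfl fun l _ => by rw [hS.symm, hS.ginv_symm, mul_comm]

theorem ginv_one_ang (hS : IsNullSurface U S g) (hx : x ∈ S) (α : Fin 2) :
    ginv g 1 (ang α) x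
      = -ginv g 0 1 x * ∑ l, ginv g (ang α) (ang l) x * g 0 (ang l) x := by
  have h : ∀ β, ginv g 0 1 x * g 0 (ang β) x
      = -∑ l, ginv g 1 (ang l) x * g (ang l) (ang β) x := fun β => by
    have h := hS.sum_ginv_mul (hS.subset hx) 1 (ang β)
    rw [Fin.sum_univ_four, hS.null _ (ang_ne_zero β) x hx,
      if_neg (by fin_cases β <;> decide), hS.ginv_symm 1 0] at h
    rw [Fin.sum_univ_two, ang_zero, ang_one]
    linarith
  have h2 : ∑ β, (∑ l, ginv g 1 (ang l) x * g (ang l) (ang β) x) * ginv g (ang β) (ang α) x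
      = ginv g 1 (ang α) x := by
    simp only [Finset.sum_mul, mul_assoc]
    rw [Finset.sum_comm]
    simp only [← Finset.mul_sum, hS.sum_mul_ginv_ang hx]
    simp
  rw [← h2, neg_mul, Finset.mul_sum, ← Finset.sum_neg_distrib]
  refine Finset.sum_congr rfl fun β _ => ?_
  rw [hS.ginv_symm (ang β) (ang α)]
  linear_combination ginv g (ang α) (ang β) x * h β

/-- The reduced Ricci tensor contracted with the null generator of `S`. -/
theorem reducedRicci_null (hS : IsNullSurface U S g) (hx : x ∈ S) {j : Fin 4} (hj : j ≠ 0) :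
    reducedRicci g 1 j x
      = -ginv g 0 1 x * pd 1 (pd 0 (g 1 j)) x + (1 / 2) * harmonic g 0 x * pd 0 (g 1 j) x
        + ginv g 0 1 x ^ 2 * ((pd 1 (g 0 1) x - (1 / 2) * pd 0 (g 1 1) x) * pd 0 (g 1 j) x
          + (1 / 2) * pd 0 (g 1 1) x * (pd 1 (g 0 j) x + pd j (g 0 1) x))
        + (1 / 2) * ginv g 0 1 x * pd 0 (g 1 1) x
          * ∑ δ, ginv g 1 (ang δ) x * pd 1 (g (ang δ) j) x
        + (1 / 2) * ginv g 0 1 x * ∑ β, ∑ δ,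
          (pd 0 (g 1 (ang β)) x + pd 1 (g 0 (ang β)) x - pd (ang β) (g 0 1) x)
            * ginv g (ang β) (ang δ) x * pd 1 (g (ang δ) j) x
        + (1 / 2) * ∑ β, ∑ γ, ∑ ε, pd 1 (g (ang β) (ang γ)) x * ginv g (ang β) (ang ε) x
          * (ginv g 1 (ang γ) x * pd 1 (g (ang ε) j) x
            + ∑ δ, ginv g (ang γ) (ang δ) x * pd (ang δ) (g (ang ε) j) x)
        - (1 / 4) * ∑ β, ∑ γ, ∑ μ, ∑ ν, pd j (g (ang β) (ang γ)) x * ginv g (ang β) (ang μ) x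
          * ginv g (ang γ) (ang ν) x * pd 1 (g (ang μ) (ang ν)) x := by
  have G0 : ginv g 0 0 x = 0 := hS.ginv_zero hx (by decide)
  have G2 : ginv g 0 2 x = 0 := hS.ginv_zero hx (by decide)
  have G3 : ginv g 0 3 x = 0 := hS.ginv_zero hx (by decide)
  have n0 : (1 : Fin 4) ≠ 0 ∧ (2 : Fin 4) ≠ 0 ∧ (3 : Fin 4) ≠ 0 := by decide
  obtain ⟨n1, n2, n3⟩ := n0
  have z : ∀ i k, i ≠ 0 → k ≠ 0 → pd i (g 1 k) x = 0 := fun i k hi hk => hS.pd_null hx hi hk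
  have zz : ∀ i k, i ≠ 0 → k ≠ 0 → pd i (pd k (g 1 j)) x = 0 := fun i k hi hk =>
    hS.pd_pd_null hx hi hk hj
  have c : pd 0 (pd 1 (g 1 j)) x = pd 1 (pd 0 (g 1 j)) x :=
    pd_comm hS.isOpen (hS.smooth 1 j) (hS.subset hx)
  rw [hS.reducedRicci_eq (hS.subset hx)]
  simp only [Fin.sum_univ_four, Fin.sum_univ_two, ang_zero, ang_one, lowArr, hS.symm 1 0,
    hS.symm 2 0, hS.symm 3 0, hS.symm 2 1, hS.symm 3 1, hS.symm 3 2, hS.ginv_symm 1 0,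
    hS.ginv_symm 2 0, hS.ginv_symm 3 0, hS.ginv_symm 2 1, hS.ginv_symm 3 1, hS.ginv_symm 3 2,
    G0, G2, G3, hS.symm j, z _ _ n1 hj, z _ _ n2 hj, z _ _ n3 hj, z _ _ hj n1, z _ _ hj n2,
    z _ _ hj n3, z _ _ n1 n1, z _ _ n1 n2, z _ _ n1 n3, z _ _ n2 n1, z _ _ n2 n2, z _ _ n2 n3,
    z _ _ n3 n1, z _ _ n3 n2, z _ _ n3 n3, zz _ _ n1 n1, zz _ _ n1 n2, zz _ _ n1 n3, zz _ _ n2 n1,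
    zz _ _ n2 n2, zz _ _ n2 n3, zz _ _ n3 n1, zz _ _ n3 n2, zz _ _ n3 n3, c,
    mul_zero, zero_mul, add_zero, zero_add, sub_zero, zero_sub, sub_self]
  ring

end IsNullSurface

/-! ### Linear equations along the x²-lines. -/

section Ruled

variable {E : Type*} [NormedAddCommGroup E] [NormedSpace ℝ E] [FiniteDimensional ℝ E]
  {U S : Set Pt}

/-- A solution on a ruled set of a homogeneous linear equation along the rulings vanishes if it
vanishes at the starting points of the rulings. -/
theorem eq_zero_of_isRuled (hU : IsOpen U) (hSU : S ⊆ U) (hS : IsRuled S)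
    (hpos : ∀ x ∈ S, 0 ≤ x 1) {f : Pt → E} (hf : ContDiffOn ℝ ∞ f U) {T : Pt → E → E}
    (hT : ContinuousOn (Function.uncurry T) (S ×ˢ Set.univ))
    (hhom : ∀ x ∈ S, ∀ (c : ℝ) (z : E), T x (c • z) = c • T x z)
    (hode : ∀ x ∈ S, pd 1 f x = T x (f x)) (h0 : ∀ x ∈ S, x 1 = 0 → f x = 0)
    {x : Pt} (hx : x ∈ S) : f x = 0 := by
  have hmem : ∀ t ∈ Set.Icc 0 (x 1), Function.update x 1 t ∈ S := fun t ht =>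
    hS x hx t ht.1 ht.2
  have key := eq_zero_of_homogeneous_ode (a := 0) (b := x 1)
    (y := fun t => f (Function.update x 1 t)) (T := fun t => T (Function.update x 1 t))
    (by
      have hmap : ContinuousOn (fun p : ℝ × E => (Function.update x 1 p.1, p.2))
          (Set.Icc 0 (x 1) ×ˢ Set.univ) := by fun_prop
      exact hT.comp hmap fun p hp => ⟨hmem p.1 hp.1, trivial⟩)
    (fun t ht c z => hhom _ (hmem t ht) c z)
    (fun t ht => by
      have := hasDerivAt_line (i := 1) (hf.diffAt hU (hSU (hmem t ht)))
      rwa [hode _ (hmem t ht)] at this)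
    (h0 _ (hmem 0 ⟨le_rfl, hpos x hx⟩) (by simp)) (t := x 1) ⟨hpos x hx, le_rfl⟩
  simpa using key

end Ruled

/-! ### Γ¹ and the conformal splitting of the angular metric. -/

/-- The Yang-Mills and Higgs fields near the null surface `S`, in the gauge `A_2 = 0` on `S`. -/
structure IsNullData {N : ℕ} (U S : Set Pt) (g : Fin 4 → Fin 4 → Pt → ℝ)
    (A : Fin 4 → Pt → Col N) (Φ : Pt → Col N) : Prop extends IsNullSurface U S g where
  smooth_pot : ∀ i, ContDiffOn ℝ ∞ (A i) U
  smooth_higgs : ContDiffOn ℝ ∞ Φ U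
  gauge : ∀ x ∈ S, A 1 x = 0

namespace IsNullSurface

variable {U S : Set Pt} {g : Fin 4 → Fin 4 → Pt → ℝ} {x : Pt}

/-- Since g^{1k} = 0 for k ≠ 2, Γ¹ is g^{12} times the lowered Γ_2, whose only transversal
derivative is g_{22,1}. -/
theorem harmonic_zero_eq (hS : IsNullSurface U S g) (hx : x ∈ S) :
    harmonic g 0 x = ginv g 0 1 x * (ginv g 0 1 x * pd 0 (g 1 1) x
      - (1 / 2) * ∑ β, ∑ γ, ginv g (ang β) (ang γ) x * pd 1 (g (ang β) (ang γ)) x) := by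
  have G0 : ginv g 0 0 x = 0 := hS.ginv_zero hx (by decide)
  have G2 : ginv g 0 2 x = 0 := hS.ginv_zero hx (by decide)
  have G3 : ginv g 0 3 x = 0 := hS.ginv_zero hx (by decide)
  have z : ∀ i k, i ≠ 0 → k ≠ 0 → pd i (g 1 k) x = 0 := fun i k hi hk => hS.pd_null hx hi hk
  rw [IsMetricOn.harmonic_eq]
  simp only [Fin.sum_univ_four, Fin.sum_univ_two, ang_zero, ang_one, lowArr, hS.symm 1 0,
    hS.symm 2 0, hS.symm 3 0, hS.symm 2 1, hS.symm 3 1, hS.symm 3 2, hS.ginv_symm 1 0,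
    hS.ginv_symm 2 0, hS.ginv_symm 3 0, hS.ginv_symm 2 1, hS.ginv_symm 3 1, hS.ginv_symm 3 2,
    G0, G2, G3, z 1 1 (by decide) (by decide), z 1 2 (by decide) (by decide),
    z 1 3 (by decide) (by decide), z 2 1 (by decide) (by decide), z 2 2 (by decide) (by decide),
    z 2 3 (by decide) (by decide), z 3 1 (by decide) (by decide), z 3 2 (by decide) (by decide),
    z 3 3 (by decide) (by decide)]
  ring

section Conformal

variable {h : Fin 2 → Fin 2 → Pt → ℝ} {v : Pt → ℝ}

theorem inv_conformal (hdet : (Matrix.of fun i j => h i j x).det = 1) (α β : Fin 2) :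
    (Matrix.of fun i j => h i j x)⁻¹ α β
      = (!![h 1 1 x, -h 0 1 x; -h 1 0 x, h 0 0 x] : Matrix (Fin 2) (Fin 2) ℝ) α β := by
  rw [Matrix.inv_def, hdet, Matrix.adjugate_fin_two]
  simp

theorem ginv_conformal (hS : IsNullSurface U S g) (hx : x ∈ S)
    (hdet : (Matrix.of fun i j => h i j x).det = 1)
    (hgh : ∀ α β, g (ang α) (ang β) x = Real.exp (v x) * h α β x) (α β : Fin 2) :
    ginv g (ang α) (ang β) x
      = Real.exp (-v x) * (Matrix.of fun i j => h i j x)⁻¹ α β := by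
  have hd : h 0 0 x * h 1 1 x - h 0 1 x * h 1 0 x = 1 := by
    rw [Matrix.det_fin_two] at hdet; exact hdet
  have he : Real.exp (v x) * Real.exp (-v x) = 1 := by rw [← Real.exp_add]; simp
  have r : ∀ α, ∀ β, _ := hS.sum_ginv_ang_mul hx
  simp only [Fin.sum_univ_two, hgh] at r
  -- These are two linear equations for a row of the inverse angular block; Cramer's rule with det h
  -- = 1 solves them.
  have r0 := r α 0
  have r1 := r α 1
  rw [inv_conformal hdet]
  fin_cases α <;> fin_cases β <;> simp at r0 r1 ⊢
  · linear_combination Real.exp (-v x) * (h 1 1 x * r0 - h 1 0 x * r1)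
      - ginv g (ang 0) (ang 0) x * (Real.exp (v x) * Real.exp (-v x) * hd + he)
  · linear_combination Real.exp (-v x) * (h 0 0 x * r1 - h 0 1 x * r0)
      - ginv g (ang 0) (ang 1) x * (Real.exp (v x) * Real.exp (-v x) * hd + he)
  · linear_combination Real.exp (-v x) * (h 1 1 x * r0 - h 1 0 x * r1)
      - ginv g (ang 1) (ang 0) x * (Real.exp (v x) * Real.exp (-v x) * hd + he)
  · linear_combination Real.exp (-v x) * (h 0 0 x * r1 - h 0 1 x * r0)
      - ginv g (ang 1) (ang 1) x * (Real.exp (v x) * Real.exp (-v x) * hd + he)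

end Conformal

end IsNullSurface

/-- On `S` the angular part of `g` is `e^v h` with `det h = 1`. -/
structure IsConformalSplit (U S : Set Pt) (g : Fin 4 → Fin 4 → Pt → ℝ)
    (h : Fin 2 → Fin 2 → Pt → ℝ) (v : Pt → ℝ) : Prop where
  smooth_h : ∀ α β, ContDiffOn ℝ ∞ (h α β) U
  smooth_v : ContDiffOn ℝ ∞ v U
  det_ne : ∀ x ∈ U, (Matrix.of fun α β => h α β x).det ≠ 0
  det_eq : ∀ x ∈ S, (Matrix.of fun α β => h α β x).det = 1
  eq_exp_mul : ∀ x ∈ S, ∀ α β, g (ang α) (ang β) x = Real.exp (v x) * h α β x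

namespace IsConformalSplit

variable {U S : Set Pt} {g : Fin 4 → Fin 4 → Pt → ℝ} {h : Fin 2 → Fin 2 → Pt → ℝ} {v : Pt → ℝ}
  {x : Pt}

theorem pd_eq (hc : IsConformalSplit U S g h v) (hS : IsNullSurface U S g) (hx : x ∈ S)
    (α β : Fin 2) :
    pd 1 (g (ang α) (ang β)) x
      = Real.exp (v x) * (pd 1 v x * h α β x + pd 1 (h α β) x) := by
  have d1 := (hc.smooth_h α β).diffAt hS.isOpen (hS.subset hx)
  have d2 := hc.smooth_v.diffAt hS.isOpen (hS.subset hx)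
  rw [hS.pd_eq (hS.smooth _ _) (f' := fun y => Real.exp (v y) * h α β y)
    (hc.smooth_v.exp.mul (hc.smooth_h α β)) (fun y hy => hc.eq_exp_mul y hy α β) (by decide) hx,
    pd_mul d2.exp d1, pd_exp d2]
  ring

theorem ginv_eq (hc : IsConformalSplit U S g h v) (hS : IsNullSurface U S g) (hx : x ∈ S)
    (α β : Fin 2) :
    ginv g (ang α) (ang β) x
      = Real.exp (-v x) * (Matrix.of fun i j => h i j x)⁻¹ α β :=
  hS.ginv_conformal hx (hc.det_eq x hx) (hc.eq_exp_mul x hx) α β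

theorem det_fin_two_eq (hc : IsConformalSplit U S g h v) (hx : x ∈ S) :
    h 0 0 x * h 1 1 x - h 0 1 x * h 1 0 x = 1 := by
  rw [← hc.det_eq x hx, Matrix.det_fin_two]; rfl

theorem pd_det_eq (hc : IsConformalSplit U S g h v) (hS : IsNullSurface U S g) (hx : x ∈ S) :
    pd 1 (h 0 0) x * h 1 1 x + h 0 0 x * pd 1 (h 1 1) x
      - (pd 1 (h 0 1) x * h 1 0 x + h 0 1 x * pd 1 (h 1 0) x) = 0 := by
  have d1 := fun α β => (hc.smooth_h α β).diffAt hS.isOpen (hS.subset hx)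
  have e := hS.pd_eq (f := fun y => h 0 0 y * h 1 1 y - h 0 1 y * h 1 0 y)
    (f' := fun _ => (1 : ℝ))
    (((hc.smooth_h 0 0).mul (hc.smooth_h 1 1)).sub ((hc.smooth_h 0 1).mul (hc.smooth_h 1 0)))
    contDiffOn_const (fun y hy => hc.det_fin_two_eq hy) (i := 1) (by decide) hx
  rwa [pd_const, pd_sub ((d1 0 0).fun_mul (d1 1 1)) ((d1 0 1).fun_mul (d1 1 0)),
    pd_mul (d1 0 0) (d1 1 1), pd_mul (d1 0 1) (d1 1 0)] at e

theorem symm (hc : IsConformalSplit U S g h v) (hS : IsNullSurface U S g) (hx : x ∈ S)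
    (α β : Fin 2) : h α β x = h β α x :=
  mul_left_cancel₀ (Real.exp_ne_zero _) ((hc.eq_exp_mul x hx α β).symm.trans
    ((congrFun (hS.symm _ _) x).trans (hc.eq_exp_mul x hx β α)))

/-- The angular part of g^{-1}g_{,2} is v_{,2} times the identity plus h^{-1}h_{,2}, and the latter
is trace-free because det h = 1 on S. -/
theorem trace_pd (hc : IsConformalSplit U S g h v) (hS : IsNullSurface U S g) (hx : x ∈ S) :
    ∑ β, ∑ γ, ginv g (ang β) (ang γ) x * pd 1 (g (ang β) (ang γ)) x = 2 * pd 1 v x := by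
  have hd := hc.det_fin_two_eq hx
  have hd' := hc.pd_det_eq hS hx
  have he : Real.exp (v x) * Real.exp (-v x) = 1 := by rw [← Real.exp_add]; simp
  have hs := hc.symm hS hx
  simp only [hc.ginv_eq hS hx, hc.pd_eq hS hx, Fin.sum_univ_two,
    IsNullSurface.inv_conformal (hc.det_eq x hx)]
  simp
  rw [hs 1 0] at *
  linear_combination (pd 1 v x * 2 * (h 0 0 x * h 1 1 x - h 0 1 x * h 0 1 x)) * he
    + 2 * pd 1 v x * hd + Real.exp (v x) * Real.exp (-v x) * hd'

/-- Where det h = 1 the inverse is the adjugate. This is known only on S, which suffices for an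
x²-derivative. -/
theorem pd_inv_eq (hc : IsConformalSplit U S g h v) (hS : IsNullSurface U S g) (hx : x ∈ S)
    (α β : Fin 2) :
    pd 1 (fun y => (Matrix.of fun i j => h i j y)⁻¹ α β) x
      = (!![pd 1 (h 1 1) x, -pd 1 (h 0 1) x; -pd 1 (h 1 0) x, pd 1 (h 0 0) x] :
          Matrix (Fin 2) (Fin 2) ℝ) α β := by
  have hi := contDiffOn_inv_apply hc.smooth_h hc.det_ne α β
  have e := fun y (hy : y ∈ S) => IsNullSurface.inv_conformal (hc.det_eq y hy) α β
  fin_cases α <;> fin_cases β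
  · exact hS.pd_eq hi (hc.smooth_h 1 1) e (by decide) hx
  · exact (hS.pd_eq hi (hc.smooth_h 0 1).neg e (by decide) hx).trans pd_neg
  · exact (hS.pd_eq hi (hc.smooth_h 1 0).neg e (by decide) hx).trans pd_neg
  · exact hS.pd_eq hi (hc.smooth_h 0 0) e (by decide) hx

theorem sum_pd_mul_pd (hc : IsConformalSplit U S g h v) (hS : IsNullSurface U S g) (hx : x ∈ S) :
    ∑ β, ∑ γ, ∑ μ, ∑ ν, pd 1 (g (ang β) (ang γ)) x * ginv g (ang β) (ang μ) x
        * ginv g (ang γ) (ang ν) x * pd 1 (g (ang μ) (ang ν)) x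
      = 2 * pd 1 v x ^ 2 - ∑ α, ∑ β, pd 1 (h α β) x
          * pd 1 (fun y => (Matrix.of fun i j => h i j y)⁻¹ α β) x := by
  have hd := hc.det_fin_two_eq hx
  have hd' := hc.pd_det_eq hS hx
  have he : Real.exp (v x) * Real.exp (-v x) = 1 := by rw [← Real.exp_add]; simp
  have hs := hc.symm hS hx 1 0
  have hs' : pd 1 (h 1 0) x = pd 1 (h 0 1) x :=
    hS.pd_eq (hc.smooth_h 1 0) (hc.smooth_h 0 1) (fun y hy => hc.symm hS hy 1 0) (by decide) hx
  rw [hs] at hd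
  rw [hs, hs'] at hd'
  simp only [hc.ginv_eq hS hx, hc.pd_eq hS hx, hc.pd_inv_eq hS hx, Fin.sum_univ_two,
    IsNullSurface.inv_conformal (hc.det_eq x hx), Matrix.of_apply, Matrix.cons_val', Matrix.cons_val_zero,
    Matrix.cons_val_one, Matrix.cons_val_fin_one, hs, hs']
  -- The identity tr X² = (tr X)² - 2 det X for X = adj(h) h_{,2}, kept with det h and tr X explicit
  -- so that `hd` and `hd'` can be inserted.
  trans (Real.exp (v x) * Real.exp (-v x)) ^ 2
    * (2 * pd 1 v x ^ 2 * (h 0 0 x * h 1 1 x - h 0 1 x * h 0 1 x) ^ 2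
      + 2 * pd 1 v x * (h 0 0 x * h 1 1 x - h 0 1 x * h 0 1 x)
        * (pd 1 (h 0 0) x * h 1 1 x + h 0 0 x * pd 1 (h 1 1) x
          - (pd 1 (h 0 1) x * h 0 1 x + h 0 1 x * pd 1 (h 0 1) x))
      + (pd 1 (h 0 0) x * h 1 1 x + h 0 0 x * pd 1 (h 1 1) x
          - (pd 1 (h 0 1) x * h 0 1 x + h 0 1 x * pd 1 (h 0 1) x)) ^ 2
      - 2 * (h 0 0 x * h 1 1 x - h 0 1 x * h 0 1 x)
        * (pd 1 (h 0 0) x * pd 1 (h 1 1) x - pd 1 (h 0 1) x ^ 2))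
  · ring
  · rw [he, hd, hd']; ring

end IsConformalSplit

/-! ### The source terms on S and the propagation of Γ¹ = 0. -/

namespace IsNullData

variable {𝔤 : Type*} [LieRing 𝔤] [LieAlgebra ℝ 𝔤] {N : ℕ} (b : Module.Basis (Fin N) ℝ 𝔤)
  (B : LinearMap.BilinForm ℝ 𝔤) (V : ℝ → ℝ)
  {U S : Set Pt} {g : Fin 4 → Fin 4 → Pt → ℝ} {A : Fin 4 → Pt → Col N} {Φ : Pt → Col N} {x : Pt}

theorem pd_pot (hD : IsNullData U S g A Φ) (hx : x ∈ S) {i : Fin 4} (hi : i ≠ 0) :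
    pd i (A 1) x = 0 :=
  hD.pd_eq_zero (hD.smooth_pot 1) hD.gauge hi hx

theorem curv_one_zero (hD : IsNullData U S g A Φ) (hx : x ∈ S) :
    curv b A 1 0 x = pd 1 (A 0) x - pd 0 (A 1) x := by
  simp only [curv, hD.gauge x hx, brk_zero_left, add_zero]

theorem curv_one (hD : IsNullData U S g A Φ) (hx : x ∈ S) {i : Fin 4} (hi : i ≠ 0) :
    curv b A 1 i x = pd 1 (A i) x := by
  simp only [curv, hD.gauge x hx, brk_zero_left, add_zero, hD.pd_pot hx hi, sub_zero]

/-- The terms of τ_{2j} carrying the factor g_{2j}, the potential among them, vanish on S; F_{22} =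
0 and g^{11} = g^{1α} = 0 thin out the contraction of F_{2k} with F_j{}^k. -/
theorem source_null (hD : IsNullData U S g A Φ) (hx : x ∈ S) {j : Fin 4} (hj : j ≠ 0) :
    source b B V g A Φ 1 j x
      = ginv g 0 1 x * dot b B (pd 1 (A 0) x - pd 0 (A 1) x) (curv b A j 1 x)
        + ∑ β, ginv g 1 (ang β) x * dot b B (pd 1 (A (ang β)) x) (curv b A j 1 x)
        + ∑ β, ∑ γ, ginv g (ang β) (ang γ) x
            * dot b B (pd 1 (A (ang β)) x) (curv b A j (ang γ) x)
        + dot b B (pd 1 Φ x) (covHiggs b A Φ j x) := by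
  have G0 : ginv g 0 0 x = 0 := hD.ginv_zero hx (by decide)
  have G2 : ginv g 0 2 x = 0 := hD.ginv_zero hx (by decide)
  have G3 : ginv g 0 3 x = 0 := hD.ginv_zero hx (by decide)
  have h1 : covHiggs b A Φ 1 x = pd 1 Φ x := by
    simp only [covHiggs, hD.gauge x hx, brk_zero_left, add_zero]
  rw [source, hD.null j hj x hx, h1]
  simp only [curvMix, Fin.sum_univ_four, Fin.sum_univ_two, ang_zero, ang_one,
    hD.curv_one_zero b hx, hD.curv_one b hx (show (1 : Fin 4) ≠ 0 by decide),
    hD.curv_one b hx (show (2 : Fin 4) ≠ 0 by decide),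
    hD.curv_one b hx (show (3 : Fin 4) ≠ 0 by decide), hD.pd_pot hx (show (1 : Fin 4) ≠ 0 by decide),
    hD.ginv_symm 1 0, hD.ginv_symm 2 0, hD.ginv_symm 3 0, hD.ginv_symm 2 1, hD.ginv_symm 3 1,
    G0, G2, G3, dot_add_right, dot_smul_right, dot_zero_left]
  ring

theorem source_null_null (hD : IsNullData U S g A Φ) (hx : x ∈ S) :
    source b B V g A Φ 1 1 x
      = ∑ β, ∑ γ, ginv g (ang β) (ang γ) x
          * dot b B (pd 1 (A (ang β)) x) (pd 1 (A (ang γ)) x)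
        + dot b B (pd 1 Φ x) (pd 1 Φ x) := by
  have h1 : covHiggs b A Φ 1 x = pd 1 Φ x := by
    simp only [covHiggs, hD.gauge x hx, brk_zero_left, add_zero]
  have h2 : curv b A 1 1 x = 0 := by
    rw [hD.curv_one b hx (by decide), hD.pd_pot hx (by decide)]
  rw [hD.source_null b B V hx (by decide), h1, h2]
  simp only [dot_zero_right, hD.curv_one b hx (ang_ne_zero _), mul_zero, Finset.sum_const_zero,
    zero_add]

/-- The equation `R̃_{22} = τ_{22}` propagates `Γ¹ = 0` along the null generators. -/
theorem pd_null_defect {h : Fin 2 → Fin 2 → Pt → ℝ} {v : Pt → ℝ} (hD : IsNullData U S g A Φ)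
    (hc : IsConformalSplit U S g h v) (hv : ∀ x ∈ S, ConformalODE b B h v A Φ x)
    (hw : ∀ x ∈ S, pd 1 (g 0 1) x = (1 / 2) * g 0 1 x * pd 1 v x)
    (hred : ∀ x ∈ S, reducedRicci g 1 1 x = source b B V g A Φ 1 1 x) (hx : x ∈ S) :
    pd 1 (fun y => pd 0 (g 1 1) y - 2 * pd 1 (g 0 1) y) x
      = ginv g 0 1 x * pd 1 (g 0 1) x * (pd 0 (g 1 1) x - 2 * pd 1 (g 0 1) x) := by
  have hxU := hD.subset hx
  have hS := hD.toIsNullSurface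
  have d1 := hD.diff_pd hxU 0 1 1
  have d2 := hD.diff_pd hxU 1 0 1
  have d3 := hD.diff hxU 0 1
  have d4 := (contDiffOn_pd hD.isOpen hc.smooth_v 1).diffAt hD.isOpen hxU
  rw [pd_sub d1 (by fun_prop), pd_const_mul _ d2]
  have hw' := hD.pd_eq (i := 1) (contDiffOn_pd hD.isOpen (hD.smooth 0 1) 1)
    (f' := fun y => (1 / 2) * g 0 1 y * pd 1 v y)
    ((contDiffOn_const.mul (hD.smooth 0 1)).mul (contDiffOn_pd hD.isOpen hc.smooth_v 1))
    hw (by decide) hx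
  rw [pd_mul (by fun_prop) d4, pd_const_mul _ d3] at hw'
  have hw0 := hw x hx
  have hr := hred x hx
  have hu := hD.ginv_mul_g hx
  have hv0 := hv x hx
  have z : ∀ δ, pd 1 (g (ang δ) 1) x = 0 := fun δ => by
    rw [hD.symm]; exact hD.pd_null hx (by decide) (ang_ne_zero δ)
  have z2 : ∀ δ ε, pd (ang δ) (g (ang ε) 1) x = 0 := fun δ ε => by
    rw [hD.symm]; exact hD.pd_null hx (ang_ne_zero δ) (ang_ne_zero ε)
  rw [hD.reducedRicci_null hx (by decide), hD.source_null_null b B V hx, hS.harmonic_zero_eq hx,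
    hc.trace_pd hS hx, hc.sum_pd_mul_pd hS hx] at hr
  simp only [z, z2, mul_zero, Finset.sum_const_zero, add_zero] at hr
  rw [ConformalODE] at hv0
  have e : ∑ β, ∑ γ, ginv g (ang β) (ang γ) x
          * dot b B (pd 1 (A (ang β)) x) (pd 1 (A (ang γ)) x)
      = Real.exp (-v x) * ∑ α, ∑ β, (Matrix.of fun i j => h i j x)⁻¹ α β
          * dot b B (pd 1 (A (ang α)) x) (pd 1 (A (ang β)) x) := by
    simp only [hc.ginv_eq hS hx, Finset.mul_sum, mul_assoc]
  rw [e] at hr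
  have k1 : pd 1 v x = 2 * ginv g 0 1 x * pd 1 (g 0 1) x := by
    linear_combination (-2 * ginv g 0 1 x) * hw0 - pd 1 v x * hu
  -- R̃_{22} = τ_{22} combined with the equation for v. The square of g_{22,1} coming from
  -- Γ¹g_{22,1} cancels the one in the quadratic terms, so the result is linear in g_{22,1}.
  have k2 : -ginv g 0 1 x * pd 1 (pd 0 (g 1 1)) x
      + ginv g 0 1 x ^ 2 * pd 0 (g 1 1) x * pd 1 (g 0 1) x + pd 1 (pd 1 v) x = 0 := by
    linear_combination hr + (1 / 2) * hv0
      + (1 / 2) * ginv g 0 1 x * pd 0 (g 1 1) x * k1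
  -- `hw'` converts v_{,22} into g_{12,22}, which makes the equation homogeneous in g_{22,1} -
  -- 2g_{12,2}.
  linear_combination (-g 0 1 x) * k2
    - (pd 1 (pd 0 (g 1 1)) x - ginv g 0 1 x * pd 0 (g 1 1) x * pd 1 (g 0 1) x) * hu
    - 2 * hw' - pd 1 (g 0 1) x * k1

/-- On `S`, `g_{22,1} = 2 g_{12,2}` and `Γ¹ = 0`. -/
theorem null_defect_eq_zero {h : Fin 2 → Fin 2 → Pt → ℝ} {v : Pt → ℝ}
    (hD : IsNullData U S g A Φ) (hc : IsConformalSplit U S g h v)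
    (hv : ∀ x ∈ S, ConformalODE b B h v A Φ x)
    (hw : ∀ x ∈ S, pd 1 (g 0 1) x = (1 / 2) * g 0 1 x * pd 1 v x)
    (hred : ∀ x ∈ S, reducedRicci g 1 1 x = source b B V g A Φ 1 1 x) (hr : IsRuled S)
    (hpos : ∀ x ∈ S, 0 ≤ x 1) (h0 : ∀ x ∈ S, x 1 = 0 → pd 0 (g 1 1) x = 2 * pd 1 (g 0 1) x)
    (hx : x ∈ S) : pd 0 (g 1 1) x = 2 * pd 1 (g 0 1) x := by
  have hU := hD.isOpen
  have s1 := contDiffOn_pd hU (hD.smooth 0 1) 1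
  have hT : ContinuousOn (fun y => ginv g 0 1 y * pd 1 (g 0 1) y) S :=
    (((hD.contDiffOn_ginv 0 1).mul s1).continuousOn).mono hD.subset
  refine sub_eq_zero.1 (eq_zero_of_isRuled (f := fun y => pd 0 (g 1 1) y - 2 * pd 1 (g 0 1) y)
    (T := fun y z => ginv g 0 1 y * pd 1 (g 0 1) y * z)
    hU hD.subset hr hpos ((contDiffOn_pd hU (hD.smooth 1 1) 0).sub (contDiffOn_const.mul s1))
    ((hT.comp continuousOn_fst fun p hp => hp.1).mul continuousOn_snd)
    (fun y _ c z => ?_) (fun y hy => hD.pd_null_defect b B V hc hv hw hred hy)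
    (fun y hy hy0 => sub_eq_zero.2 (h0 y hy hy0)) hx)
  simp only [smul_eq_mul]
  ring

end IsNullData

/-! ### Tangential derivatives of the inverse metric. -/

namespace IsNullSurface

variable {U S : Set Pt} {g : Fin 4 → Fin 4 → Pt → ℝ} {x : Pt}

theorem pd_ginv_zero_one (hS : IsNullSurface U S g) (hx : x ∈ S) {k : Fin 4} (hk : k ≠ 0) :
    pd k (ginv g 0 1) x = -ginv g 0 1 x ^ 2 * pd k (g 0 1) x := by
  have d1 := hS.diff_ginv (hS.subset hx) 0 1
  have d2 := hS.diff (hS.subset hx) 0 1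
  have h := hS.pd_eq (f' := fun _ => (1 : ℝ)) ((hS.contDiffOn_ginv 0 1).mul (hS.smooth 0 1))
    contDiffOn_const (fun y hy => hS.ginv_mul_g hy) hk hx
  have e := hS.ginv_mul_g hx
  rw [pd_const, pd_mul d1 d2] at h
  linear_combination ginv g 0 1 x * h - pd k (ginv g 0 1) x * e

/-- In the derivative of g^{-1} the index 1 drops by g^{1α} = 0 and the index 2 because g_{22} and
g_{2α} vanish along S, so the angular block does not couple to the rest. -/
theorem pd_ginv_ang (hS : IsNullSurface U S g) (hx : x ∈ S) {k : Fin 4} (hk : k ≠ 0)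
    (α β : Fin 2) :
    pd k (ginv g (ang α) (ang β)) x = -∑ μ, ∑ ν, ginv g (ang α) (ang μ) x
      * pd k (g (ang μ) (ang ν)) x * ginv g (ang ν) (ang β) x := by
  have n : ∀ α : Fin 2, ang α ≠ 1 := by decide
  have G1 : ginv g 0 (ang β) x = 0 := hS.ginv_zero hx (n β)
  have G2 : ginv g (ang α) 0 x = 0 := by rw [hS.ginv_symm]; exact hS.ginv_zero hx (n α)
  have z : ∀ i k, i ≠ 0 → k ≠ 0 → pd i (g 1 k) x = 0 := fun i k hi hk => hS.pd_null hx hi hk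
  rw [hS.pd_ginv (hS.subset hx)]
  simp only [Fin.sum_univ_four, Fin.sum_univ_two, ang_zero, ang_one, G1, G2, hS.symm 2 1,
    hS.symm 3 1, z k 1 hk (by decide), z k 2 hk (by decide), z k 3 hk (by decide)]
  ring

theorem sum_mul_pd_ginv_ang (hS : IsNullSurface U S g) (hx : x ∈ S) (α l : Fin 2) :
    ∑ β, g (ang α) (ang β) x * pd 1 (ginv g (ang β) (ang l)) x
      = -∑ β, pd 1 (g (ang α) (ang β)) x * ginv g (ang β) (ang l) x := by
  have d1 := hS.diff_ginv (hS.subset hx)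
  have d2 := hS.diff (hS.subset hx)
  have h := hS.pd_eq (i := 1) (f' := fun _ => if α = l then (1 : ℝ) else 0)
    (ContDiffOn.sum fun β _ => (hS.smooth (ang α) (ang β)).mul
      (hS.contDiffOn_ginv (ang β) (ang l)))
    contDiffOn_const (fun y hy => hS.sum_mul_ginv_ang hy α l) (by decide) hx
  rw [pd_const, pd_sum fun β _ => (d2 _ _).fun_mul (d1 _ _)] at h
  have e : ∀ β, pd 1 (fun y => g (ang α) (ang β) y * ginv g (ang β) (ang l) y) x = _ :=
    fun β => pd_mul (d2 _ _) (d1 _ _)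
  simp only [e, Finset.sum_add_distrib] at h
  linarith

theorem sum_mul_pd_pd_ginv_ang (hS : IsNullSurface U S g) (hx : x ∈ S) (α l : Fin 2) :
    ∑ β, g (ang α) (ang β) x * pd 1 (pd 1 (ginv g (ang β) (ang l))) x
      = -∑ β, (2 * pd 1 (g (ang α) (ang β)) x * pd 1 (ginv g (ang β) (ang l)) x
          + pd 1 (pd 1 (g (ang α) (ang β))) x * ginv g (ang β) (ang l) x) := by
  have hU := hS.isOpen
  have s1 := fun i j => contDiffOn_pd hU (hS.smooth i j) 1
  have s2 := fun i j => contDiffOn_pd hU (hS.contDiffOn_ginv i j) 1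
  have d1 := hS.diff_ginv (hS.subset hx)
  have d2 := hS.diff (hS.subset hx)
  have d3 := fun i j => (s1 i j).diffAt hU (hS.subset hx)
  have d4 := fun i j => (s2 i j).diffAt hU (hS.subset hx)
  have h := hS.pd_eq (i := 1)
    (ContDiffOn.sum fun β _ => (hS.smooth (ang α) (ang β)).mul (s2 (ang β) (ang l)))
    (ContDiffOn.sum fun β _ => (s1 (ang α) (ang β)).mul (hS.contDiffOn_ginv (ang β) (ang l))).neg
    (fun y hy => hS.sum_mul_pd_ginv_ang hy α l) (by decide) hx
  rw [pd_neg, pd_sum fun β _ => (d2 _ _).fun_mul (d4 _ _),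
    pd_sum fun β _ => (d3 _ _).fun_mul (d1 _ _)] at h
  have e : ∀ β, pd 1 (fun y => g (ang α) (ang β) y * pd 1 (ginv g (ang β) (ang l)) y) x = _ :=
    fun β => pd_mul (d2 _ _) (d4 _ _)
  have e2 : ∀ β, pd 1 (fun y => pd 1 (g (ang α) (ang β)) y * ginv g (ang β) (ang l) y) x = _ :=
    fun β => pd_mul (d3 _ _) (d1 _ _)
  simp only [e, e2, Finset.sum_add_distrib] at h
  simp only [mul_assoc, Finset.sum_add_distrib, ← Finset.mul_sum]
  linarith

theorem pd_ginv_one_ang (hS : IsNullSurface U S g) (hx : x ∈ S) (α : Fin 2) :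
    pd 1 (ginv g 1 (ang α)) x
      = ginv g 0 1 x ^ 2 * pd 1 (g 0 1) x * ∑ l, ginv g (ang α) (ang l) x * g 0 (ang l) x
        - ginv g 0 1 x * ∑ l, (pd 1 (ginv g (ang α) (ang l)) x * g 0 (ang l) x
          + ginv g (ang α) (ang l) x * pd 1 (g 0 (ang l)) x) := by
  have d1 := hS.diff_ginv (hS.subset hx)
  have d2 := hS.diff (hS.subset hx)
  have sm : ContDiffOn ℝ ∞ (fun y => ∑ l, ginv g (ang α) (ang l) y * g 0 (ang l) y) U :=
    ContDiffOn.sum fun l _ => (hS.contDiffOn_ginv _ _).mul (hS.smooth _ _)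
  rw [hS.pd_eq (hS.contDiffOn_ginv 1 (ang α)) ((hS.contDiffOn_ginv 0 1).neg.mul sm)
    (fun y hy => hS.ginv_one_ang hy α) (by decide) hx,
    pd_mul (d1 0 1).fun_neg (sm.diffAt hS.isOpen (hS.subset hx)), pd_neg,
    hS.pd_ginv_zero_one hx (by decide), pd_sum fun l _ => (d1 _ _).fun_mul (d2 _ _)]
  have e : ∀ l, pd 1 (fun y => ginv g (ang α) (ang l) y * g 0 (ang l) y) x = _ :=
    fun l => pd_mul (d1 _ _) (d2 _ _)
  simp only [e]
  ring

end IsNullSurface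

/-! ### Γ^α and Δ in terms of the transversal derivatives g_{2α,1} and A_{2,1}. -/

/-- The data on `S` after the propagation of `Γ¹ = 0`. -/
structure IsAdaptedData {N : ℕ} (U S : Set Pt) (g : Fin 4 → Fin 4 → Pt → ℝ)
    (A : Fin 4 → Pt → Col N) (Φ : Pt → Col N) : Prop extends IsNullData U S g A Φ where
  defect : ∀ x ∈ S, pd 0 (g 1 1) x = 2 * pd 1 (g 0 1) x
  trace : ∀ x ∈ S, ∑ β, ∑ γ, ginv g (ang β) (ang γ) x * pd 1 (g (ang β) (ang γ)) x
    = 4 * ginv g 0 1 x * pd 1 (g 0 1) x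

namespace IsAdaptedData

variable {N : ℕ} {U S : Set Pt} {g : Fin 4 → Fin 4 → Pt → ℝ} {A : Fin 4 → Pt → Col N}
  {Φ : Pt → Col N} {x : Pt}

theorem harmonic_zero (hD : IsAdaptedData U S g A Φ) (hx : x ∈ S) : harmonic g 0 x = 0 := by
  rw [hD.harmonic_zero_eq hx, hD.trace x hx, hD.defect x hx]
  ring

/-- The covariant components `g_{αβ} Γ^β` on `S`. -/
theorem sum_mul_harmonic_ang (hD : IsAdaptedData U S g A Φ) (hx : x ∈ S) (α : Fin 2) :
    ∑ β, g (ang α) (ang β) x * harmonic g (ang β) x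
      = ginv g 0 1 x * (pd 0 (g 1 (ang α)) x + pd 1 (g 0 (ang α)) x - pd (ang α) (g 0 1) x)
        + ∑ β, ginv g 1 (ang β) x * pd 1 (g (ang α) (ang β)) x
        + ∑ β, ∑ l, ginv g (ang β) (ang l) x
          * (pd (ang l) (g (ang α) (ang β)) x - (1 / 2) * pd (ang α) (g (ang β) (ang l)) x) := by
  have h := hD.sum_mul_harmonic (hD.subset hx) (ang α)
  have G0 : ginv g 0 0 x = 0 := hD.ginv_zero hx (by decide)
  have G2 : ginv g 0 2 x = 0 := hD.ginv_zero hx (by decide)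
  have G3 : ginv g 0 3 x = 0 := hD.ginv_zero hx (by decide)
  have z : ∀ i k, i ≠ 0 → k ≠ 0 → pd i (g 1 k) x = 0 := fun i k hi hk => hD.pd_null hx hi hk
  have nα := ang_ne_zero α
  simp only [Fin.sum_univ_four, lowArr, hD.symm 1 0,
    hD.symm 2 0, hD.symm 3 0, hD.symm 2 1, hD.symm 3 1, hD.symm 3 2, hD.ginv_symm 1 0,
    hD.ginv_symm 2 0, hD.ginv_symm 3 0, hD.ginv_symm 2 1, hD.ginv_symm 3 1, hD.ginv_symm 3 2,
    hD.symm (ang α) 0, hD.symm (ang α) 1, hD.symm 2 (ang α), hD.symm 3 (ang α),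
    G0, G2, G3, z 1 (ang α) (by decide) nα, z 2 (ang α) (by decide) nα,
    z 3 (ang α) (by decide) nα, z (ang α) 1 nα (by decide), z (ang α) 2 nα (by decide),
    z (ang α) 3 nα (by decide), hD.null _ nα x hx, hD.harmonic_zero hx] at h
  simp only [Fin.sum_univ_two, ang_zero, ang_one, hD.symm 3 2, hD.ginv_symm 3 2]
  linear_combination h

/-- The gauge function `Δ` on `S`. -/
theorem lorenz_null (hD : IsAdaptedData U S g A Φ) (hx : x ∈ S) :
    lorenz g A x = ginv g 0 1 x • (pd 1 (A 0) x + pd 0 (A 1) x)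
      + ∑ β, ginv g 1 (ang β) x • pd 1 (A (ang β)) x + angDiv g A x
      - ∑ β, harmonic g (ang β) x • A (ang β) x := by
  have G0 : ginv g 0 0 x = 0 := hD.ginv_zero hx (by decide)
  have G2 : ginv g 0 2 x = 0 := hD.ginv_zero hx (by decide)
  have G3 : ginv g 0 3 x = 0 := hD.ginv_zero hx (by decide)
  rw [hD.lorenz_eq hD.smooth_pot (hD.subset hx), angDiv]
  simp only [Fin.sum_univ_four, Fin.sum_univ_two, ang_zero, ang_one, hD.ginv_symm 1 0,
    hD.ginv_symm 2 0, hD.ginv_symm 3 0, hD.ginv_symm 2 1, hD.ginv_symm 3 1, hD.ginv_symm 3 2,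
    G0, G2, G3, hD.harmonic_zero hx, hD.gauge x hx, hD.pd_pot hx (show (1 : Fin 4) ≠ 0 by decide),
    hD.pd_pot hx (show (2 : Fin 4) ≠ 0 by decide), hD.pd_pot hx (show (3 : Fin 4) ≠ 0 by decide)]
  module

end IsAdaptedData

namespace IsAdaptedData

variable {N : ℕ} {U S : Set Pt} {g : Fin 4 → Fin 4 → Pt → ℝ} {A : Fin 4 → Pt → Col N}
  {Φ : Pt → Col N} {x : Pt}

/-- This relation trades g_{2α,12}, the second derivative in R̃_{2α}, for Γ^β_{,2} and g_{1α,22},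
the principal term of the data equation for g_{1α}. -/
theorem pd_sum_mul_harmonic_ang (hD : IsAdaptedData U S g A Φ) (hx : x ∈ S) (α : Fin 2) :
    ∑ β, (pd 1 (g (ang α) (ang β)) x * harmonic g (ang β) x
        + g (ang α) (ang β) x * pd 1 (harmonic g (ang β)) x)
      = -ginv g 0 1 x ^ 2 * pd 1 (g 0 1) x
          * (pd 0 (g 1 (ang α)) x + pd 1 (g 0 (ang α)) x - pd (ang α) (g 0 1) x)
        + ginv g 0 1 x * (pd 1 (pd 0 (g 1 (ang α))) x + pd 1 (pd 1 (g 0 (ang α))) x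
          - pd 1 (pd (ang α) (g 0 1)) x)
        + ∑ β, (pd 1 (ginv g 1 (ang β)) x * pd 1 (g (ang α) (ang β)) x
          + ginv g 1 (ang β) x * pd 1 (pd 1 (g (ang α) (ang β))) x)
        + ∑ β, ∑ l, (pd 1 (ginv g (ang β) (ang l)) x
          * (pd (ang l) (g (ang α) (ang β)) x - (1 / 2) * pd (ang α) (g (ang β) (ang l)) x)
          + ginv g (ang β) (ang l) x * (pd 1 (pd (ang l) (g (ang α) (ang β))) x
            - (1 / 2) * pd 1 (pd (ang α) (g (ang β) (ang l))) x)) := by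
  have hU := hD.isOpen
  have hxU := hD.subset hx
  have s1 := hD.smooth
  have s2 := hD.contDiffOn_ginv
  have s3 := hD.contDiffOn_harmonic
  have s4 := fun i j k => contDiffOn_pd hU (hD.smooth i j) k
  have d1 := hD.diff hxU
  have d2 := hD.diff_ginv hxU
  have d3 := hD.diff_harmonic hxU
  have d4 := hD.diff_pd hxU
  have h := hD.pd_eq (i := 1)
    (f := fun y => ∑ β, g (ang α) (ang β) y * harmonic g (ang β) y)
    (f' := fun y =>
      ginv g 0 1 y * (pd 0 (g 1 (ang α)) y + pd 1 (g 0 (ang α)) y - pd (ang α) (g 0 1) y)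
        + ∑ β, ginv g 1 (ang β) y * pd 1 (g (ang α) (ang β)) y
        + ∑ β, ∑ l, ginv g (ang β) (ang l) y
          * (pd (ang l) (g (ang α) (ang β)) y - (1 / 2) * pd (ang α) (g (ang β) (ang l)) y))
    (by fun_prop) (by fun_prop) (fun y hy => hD.sum_mul_harmonic_ang hy α) (by decide) hx
  simp (disch := fun_prop) only [Fin.sum_univ_two, pd_add, pd_sub, pd_mul, pd_const,
    hD.pd_ginv_zero_one hx (show (1 : Fin 4) ≠ 0 by decide)] at h
  simp only [Fin.sum_univ_two]
  linear_combination h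

/-- The counterpart for the potential: A_{2,12} is traded for Δ_{,2} and A_{1,22}. -/
theorem pd_lorenz_null (hD : IsAdaptedData U S g A Φ) (hx : x ∈ S) :
    pd 1 (lorenz g A) x
      = (-ginv g 0 1 x ^ 2 * pd 1 (g 0 1) x) • (pd 1 (A 0) x + pd 0 (A 1) x)
      + ginv g 0 1 x • (pd 1 (pd 1 (A 0)) x + pd 1 (pd 0 (A 1)) x)
      + ∑ β, (pd 1 (ginv g 1 (ang β)) x • pd 1 (A (ang β)) x
        + ginv g 1 (ang β) x • pd 1 (pd 1 (A (ang β))) x) + pd 1 (angDiv g A) x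
      - ∑ β, (pd 1 (harmonic g (ang β)) x • A (ang β) x
        + harmonic g (ang β) x • pd 1 (A (ang β)) x) := by
  have hU := hD.isOpen
  have hxU := hD.subset hx
  have s2 := hD.contDiffOn_ginv
  have s3 := hD.contDiffOn_harmonic
  have s4 := hD.smooth_pot
  have s5 := fun i k => contDiffOn_pd hU (hD.smooth_pot i) k
  have s6 : ContDiffOn ℝ ∞ (angDiv g A) U :=
    ContDiffOn.sum fun α _ => ContDiffOn.sum fun β _ => (s2 _ _).smul (s5 _ _)
  have d2 := hD.diff_ginv hxU
  have d3 := hD.diff_harmonic hxU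
  have d4 := fun i => (s4 i).diffAt hU hxU
  have d5 := fun i k => (s5 i k).diffAt hU hxU
  have d6 := s6.diffAt hU hxU
  have h := hD.pd_eq (i := 1) (hD.contDiffOn_lorenz hD.smooth_pot)
    (f' := fun y => ginv g 0 1 y • (pd 1 (A 0) y + pd 0 (A 1) y)
      + ∑ β, ginv g 1 (ang β) y • pd 1 (A (ang β)) y + angDiv g A y
      - ∑ β, harmonic g (ang β) y • A (ang β) y)
    (by fun_prop) (fun y hy => hD.lorenz_null hy) (by decide) hx
  rw [h]
  simp (disch := fun_prop) only [Fin.sum_univ_two, pd_add, pd_sub, pd_smul,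
    hD.pd_ginv_zero_one hx (show (1 : Fin 4) ≠ 0 by decide)]

/-- Needed in `einstein_identity` to match the remaining terms g^{βγ} g_{βγ,2α} with g_{12,2α}. -/
theorem pd_trace (hD : IsAdaptedData U S g A Φ) (hx : x ∈ S) (α : Fin 2) :
    ∑ β, ∑ γ, (pd (ang α) (ginv g (ang β) (ang γ)) x * pd 1 (g (ang β) (ang γ)) x
        + ginv g (ang β) (ang γ) x * pd (ang α) (pd 1 (g (ang β) (ang γ))) x)
      = 4 * (-ginv g 0 1 x ^ 2 * pd (ang α) (g 0 1) x * pd 1 (g 0 1) x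
        + ginv g 0 1 x * pd (ang α) (pd 1 (g 0 1)) x) := by
  have hU := hD.isOpen
  have hxU := hD.subset hx
  have s2 := hD.contDiffOn_ginv
  have s4 := fun i j k => contDiffOn_pd hU (hD.smooth i j) k
  have d2 := hD.diff_ginv hxU
  have d4 := hD.diff_pd hxU
  have h := hD.pd_eq (i := ang α)
    (f := fun y => ∑ β, ∑ γ, ginv g (ang β) (ang γ) y * pd 1 (g (ang β) (ang γ)) y)
    (f' := fun y => 4 * ginv g 0 1 y * pd 1 (g 0 1) y)
    (by fun_prop) (by fun_prop) (fun y hy => hD.trace y hy) (ang_ne_zero α) hx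
  simp (disch := fun_prop) only [Fin.sum_univ_two, pd_add, pd_mul, pd_const,
    hD.pd_ginv_zero_one hx (ang_ne_zero α)] at h
  simp only [Fin.sum_univ_two]
  linear_combination h

end IsAdaptedData

/-! ### Expanded coefficients of the data equations. -/

namespace IsNullSurface

variable {U S : Set Pt} {g : Fin 4 → Fin 4 → Pt → ℝ} {x : Pt}

theorem contDiffOn_coefS (hS : IsNullSurface U S g) (l : Fin 2) :
    ContDiffOn ℝ ∞ (coefS g l) U := by
  have s1 := hS.contDiffOn_ginv
  have s2 := fun i j k => contDiffOn_pd hS.isOpen (hS.smooth i j) k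
  have : coefS g l = fun x => -2 * ginv g 0 1 x * pd (ang l) (g 0 1) x
    + ∑ μ, ∑ θ, ginv g (ang μ) (ang θ) x
        * (2 * pd (ang θ) (g (ang l) (ang μ)) x - pd (ang l) (g (ang μ) (ang θ)) x) := rfl
  rw [this]
  fun_prop

theorem pd_coefS (hS : IsNullSurface U S g) (hx : x ∈ S) (l : Fin 2) :
    pd 1 (coefS g l) x = 2 * ginv g 0 1 x ^ 2 * pd 1 (g 0 1) x * pd (ang l) (g 0 1) x
      - 2 * ginv g 0 1 x * pd 1 (pd (ang l) (g 0 1)) x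
      + ∑ μ, ∑ θ, (pd 1 (ginv g (ang μ) (ang θ)) x
          * (2 * pd (ang θ) (g (ang l) (ang μ)) x - pd (ang l) (g (ang μ) (ang θ)) x)
        + ginv g (ang μ) (ang θ) x * (2 * pd 1 (pd (ang θ) (g (ang l) (ang μ))) x
          - pd 1 (pd (ang l) (g (ang μ) (ang θ))) x)) := by
  have hxU := hS.subset hx
  have d2 := hS.diff_ginv hxU
  have d4 := hS.diff_pd hxU
  have : coefS g l = fun x => -2 * ginv g 0 1 x * pd (ang l) (g 0 1) x
    + ∑ μ, ∑ θ, ginv g (ang μ) (ang θ) x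
        * (2 * pd (ang θ) (g (ang l) (ang μ)) x - pd (ang l) (g (ang μ) (ang θ)) x) := rfl
  rw [this]
  simp (disch := fun_prop) only [Fin.sum_univ_two, pd_add, pd_sub, pd_mul, pd_const,
    hS.pd_ginv_zero_one hx (show (1 : Fin 4) ≠ 0 by decide)]
  ring

theorem coefC_eq (hS : IsNullSurface U S g) (hx : x ∈ S) (α : Fin 2) :
    coefC g α x
      = (1 / 2) * ginv g 0 1 x * pd 1 (g 0 1) x * coefS g α x
        + (1 / 2) * ∑ l, ∑ β, (pd (ang l) (ginv g (ang l) (ang β)) x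
            * pd 1 (g (ang α) (ang β)) x
          + ginv g (ang l) (ang β) x * pd 1 (pd (ang l) (g (ang α) (ang β))) x)
        + (5 / 2) * ginv g 0 1 x ^ 2 * pd 1 (g 0 1) x * pd (ang α) (g 0 1) x
        - (3 / 2) * ginv g 0 1 x * pd 1 (pd (ang α) (g 0 1)) x
        + (1 / 4) * ∑ β, ∑ l, pd 1 (ginv g (ang β) (ang l)) x
          * pd (ang α) (g (ang β) (ang l)) x
        + (1 / 4) * ∑ β, ∑ l, pd 1 (g (ang α) (ang β)) x * ginv g (ang β) (ang l) x
          * ∑ μ, ∑ θ, ginv g (ang μ) (ang θ) x * pd (ang l) (g (ang μ) (ang θ)) x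
        + (1 / 4) * pd 1 (coefS g α) x := by
  have hxU := hS.subset hx
  have d2 := hS.diff_ginv hxU
  have d4 := hS.diff_pd hxU
  have d5 := fun l => (hS.contDiffOn_coefS l).diffAt hS.isOpen hxU
  have c : ∀ i j k l, pd i (pd j (g k l)) x = pd j (pd i (g k l)) x := fun i j k l =>
    pd_comm hS.isOpen (hS.smooth k l) hxU
  have e1 : ∀ l, pd (ang l) (fun y => ∑ β, ginv g (ang l) (ang β) y
      * pd 1 (g (ang α) (ang β)) y) x
      = ∑ β, (pd (ang l) (ginv g (ang l) (ang β)) x * pd 1 (g (ang α) (ang β)) x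
        + ginv g (ang l) (ang β) x * pd 1 (pd (ang l) (g (ang α) (ang β))) x) := fun l => by
    rw [pd_sum fun β _ => (d2 _ _).fun_mul (d4 _ _ _)]
    exact Finset.sum_congr rfl fun β _ => by rw [pd_mul (d2 _ _) (d4 _ _ _), c (ang l) 1]
  have e2 : pd (ang α) (fun y => ginv g 0 1 y * pd 1 (g 0 1) y) x
      = -ginv g 0 1 x ^ 2 * pd (ang α) (g 0 1) x * pd 1 (g 0 1) x
        + ginv g 0 1 x * pd 1 (pd (ang α) (g 0 1)) x := by
    rw [pd_mul (d2 _ _) (d4 _ _ _), hS.pd_ginv_zero_one hx (ang_ne_zero α), c (ang α) 1]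
  -- Contracting with g_{αβ} leaves S_{α,2} and a correction that cancels the summand ¼ g_{αβ,2}
  -- g^{βλ} S_λ of c_α.
  have e3 : ∑ β, g (ang α) (ang β) x
        * pd 1 (fun y => ∑ l, ginv g (ang β) (ang l) y * coefS g l y) x
      = pd 1 (coefS g α) x - ∑ β, ∑ l, pd 1 (g (ang α) (ang β)) x * ginv g (ang β) (ang l) x
        * coefS g l x := by
    have h1 : ∀ β, pd 1 (fun y => ∑ l, ginv g (ang β) (ang l) y * coefS g l y) x
        = ∑ l, (pd 1 (ginv g (ang β) (ang l)) x * coefS g l x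
          + ginv g (ang β) (ang l) x * pd 1 (coefS g l) x) := fun β => by
      rw [pd_sum fun l _ => (d2 _ _).fun_mul (d5 _)]
      exact Finset.sum_congr rfl fun l _ => pd_mul (d2 _ _) (d5 _)
    have k1 := hS.sum_mul_pd_ginv_ang hx α
    have k2 := hS.sum_mul_ginv_ang hx α
    have h2 : ∑ l, (if α = l then (1 : ℝ) else 0) * pd 1 (coefS g l) x
        = pd 1 (coefS g α) x := by simp
    rw [← h2]
    simp only [← k2, h1]
    have k10 := k1 0
    have k11 := k1 1
    simp only [Fin.sum_univ_two] at k10 k11 ⊢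
    linear_combination coefS g 0 x * k10 + coefS g 1 x * k11
  rw [coefC]
  simp only [e1, e2]
  rw [e3, c (ang α) 1]
  ring

/-- Differentiating g_{αβ}g^{βλ} = δ_α^λ once and twice removes the undifferentiated g_{αβ}. The
result has the shape in which g_{1λ} enters R̃_{2α} and Γ^α, namely through g^{2α} and its
x²-derivative. -/
theorem coefChi_eq {𝔤 : Type*} [LieRing 𝔤] [LieAlgebra ℝ 𝔤] {N : ℕ}
    (b : Module.Basis (Fin N) ℝ 𝔤) (B : LinearMap.BilinForm ℝ 𝔤) (A : Fin 4 → Pt → Col N)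
    (hS : IsNullSurface U S g) (hx : x ∈ S) (α l : Fin 2) :
    coefChi b B g A α l x
      = -ginv g 0 1 x * ∑ β, (ginv g 0 1 x * pd 1 (g 0 1) x * pd 1 (g (ang α) (ang β)) x
            * ginv g (ang β) (ang l) x
          + pd 1 (g (ang α) (ang β)) x * pd 1 (ginv g (ang β) (ang l)) x
          + pd 1 (pd 1 (g (ang α) (ang β))) x * ginv g (ang β) (ang l) x)
        - 2 * ∑ ν, ginv g (ang ν) (ang l) x * ginv g 0 1 x
          * dot b B (pd 1 (A (ang α)) x) (pd 1 (A (ang ν)) x) := by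
  have k1 := hS.sum_mul_pd_ginv_ang hx α l
  have k2 := hS.sum_mul_pd_pd_ginv_ang hx α l
  rw [coefChi]
  simp only [Fin.sum_univ_two] at k1 k2 ⊢
  linear_combination ginv g 0 1 x ^ 2 * pd 1 (g 0 1) x * k1 + (1 / 2) * ginv g 0 1 x * k2

end IsNullSurface

/-! ### The reduced equations as data equations combined with the gauge system. -/

namespace IsAdaptedData

variable {𝔤 : Type*} [LieRing 𝔤] [LieAlgebra ℝ 𝔤] {N : ℕ} (b : Module.Basis (Fin N) ℝ 𝔤)
  (B : LinearMap.BilinForm ℝ 𝔤) (V : ℝ → ℝ)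
  {U S : Set Pt} {g : Fin 4 → Fin 4 → Pt → ℝ} {A : Fin 4 → Pt → Col N} {Φ : Pt → Col N} {x : Pt}

theorem harmonic_ang (hD : IsAdaptedData U S g A Φ) (hx : x ∈ S) (δ : Fin 2) :
    harmonic g (ang δ) x = ∑ α, ginv g (ang δ) (ang α) x
      * (ginv g 0 1 x * (pd 0 (g 1 (ang α)) x + pd 1 (g 0 (ang α)) x - pd (ang α) (g 0 1) x)
        + ∑ β, ginv g 1 (ang β) x * pd 1 (g (ang α) (ang β)) x
        + ∑ β, ∑ l, ginv g (ang β) (ang l) x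
          * (pd (ang l) (g (ang α) (ang β)) x - (1 / 2) * pd (ang α) (g (ang β) (ang l)) x)) := by
  simp only [← hD.sum_mul_harmonic_ang hx, Finset.mul_sum (s := Finset.univ), ← mul_assoc]
  rw [Finset.sum_comm]
  simp only [← Finset.sum_mul, hD.sum_ginv_ang_mul hx]
  simp

theorem dot_pd_lorenz (hD : IsAdaptedData U S g A Φ) (hx : x ∈ S) (u : Col N) :
    dot b B u (lorenz g A x)
      = ginv g 0 1 x * (dot b B u (pd 1 (A 0) x) + dot b B u (pd 0 (A 1) x))
      + ∑ β, ginv g 1 (ang β) x * dot b B u (pd 1 (A (ang β)) x)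
      + ∑ α, ∑ β, ginv g (ang α) (ang β) x * dot b B u (pd (ang β) (A (ang α)) x)
      - ∑ β, harmonic g (ang β) x * dot b B u (A (ang β) x) := by
  rw [hD.lorenz_null hx, angDiv]
  simp only [Fin.sum_univ_two, dot_add_right, dot_sub_right, dot_smul_right]

/-- The term -g^{12} g_{2α,12} of R̃_{2α} is that of -g_{αβ}Γ^β_{,2}, whence the minus sign before
the gauge system. Exchanging all transversal derivatives for Γ^β and Δ leaves the data equation. -/
theorem einstein_identity (hB : B.IsSymm) (hD : IsAdaptedData U S g A Φ) (hx : x ∈ S)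
    (α : Fin 2) :
    reducedRicci g 1 (ang α) x - source b B V g A Φ 1 (ang α) x
      = (ginv g 0 1 x * pd 1 (pd 1 (g 0 (ang α))) x
        + ginv g 0 1 x ^ 2 * pd 1 (g 0 1) x * pd 1 (g 0 (ang α)) x
        - ∑ β, ∑ l, ginv g 0 1 x * ginv g (ang β) (ang l) x * pd 1 (g (ang α) (ang β)) x
            * pd 1 (g 0 (ang l)) x
        + 2 * ginv g 0 1 x * dot b B (pd 1 (A (ang α)) x) (pd 1 (A 0) x)
        + ∑ l, coefChi b B g A α l x * g 0 (ang l) x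
        + coefF b B g A Φ α x)
      - (∑ β, g (ang α) (ang β) x * pd 1 (harmonic g (ang β)) x
        + ∑ β, (ginv g 0 1 x * pd 1 (g 0 1) x * g (ang α) (ang β) x
            + (1 / 2) * pd 1 (g (ang α) (ang β)) x
            + dot b B (A (ang β) x) (pd 1 (A (ang α)) x)) * harmonic g (ang β) x
        + dot b B (pd 1 (A (ang α)) x) (lorenz g A x)) := by
  have nα := ang_ne_zero α
  have r1 := hD.sum_mul_harmonic_ang hx α
  have r1' := hD.pd_sum_mul_harmonic_ang hx α
  have r0 := hD.harmonic_ang hx 0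
  have r3 := hD.harmonic_ang hx 1
  have r2 := hD.dot_pd_lorenz b B hx (pd 1 (A (ang α)) x)
  have tr' := hD.pd_trace hx α
  have hc : pd (ang α) (pd 1 (g 0 1)) x = pd 1 (pd (ang α) (g 0 1)) x :=
    pd_comm hD.isOpen (hD.smooth _ _) (hD.subset hx)
  have hc2 : ∀ β γ, pd (ang α) (pd 1 (g (ang β) (ang γ))) x
      = pd 1 (pd (ang α) (g (ang β) (ang γ))) x := fun β γ =>
    pd_comm hD.isOpen (hD.smooth _ _) (hD.subset hx)
  have sy : ∀ i j, g i j = g j i := hD.symm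
  have gy : ∀ i j, ginv g i j = ginv g j i := hD.ginv_symm
  have F1 : curv b A (ang α) 1 x = -pd 1 (A (ang α)) x := by
    rw [IsMetricOn.curv_skew, hD.curv_one b hx nα]
  have F2 : ∀ γ, dot b B (pd 1 (A γ) x) (curv b A (ang α) (ang 0) x)
      = dot b B (pd 1 (A γ) x) (pd (ang α) (A 2) x) - dot b B (pd 1 (A γ) x) (pd 2 (A (ang α)) x)
        - dot b B (pd 1 (A γ) x) (brk b (A 2 x) (A (ang α) x)) := fun γ => by
    rw [curv, brk_skew, dot_add_right, dot_sub_right, dot_neg_right]; rfl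
  have F3 : ∀ γ, dot b B (pd 1 (A γ) x) (curv b A (ang α) (ang 1) x)
      = dot b B (pd 1 (A γ) x) (pd (ang α) (A 3) x) - dot b B (pd 1 (A γ) x) (pd 3 (A (ang α)) x)
        - dot b B (pd 1 (A γ) x) (brk b (A 3 x) (A (ang α) x)) := fun γ => by
    rw [curv, brk_skew, dot_add_right, dot_sub_right, dot_neg_right]; rfl
  have dc : ∀ u v, dot b B u v = dot b B v u := dot_comm b B hB
  rw [hD.reducedRicci_null hx nα, hD.source_null b B V hx nα, hD.harmonic_zero hx,
    hD.defect x hx, coefF, hD.coefC_eq hx, hD.pd_coefS hx, coefS, angDiv, covHiggs, F1]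
  simp only [hD.coefChi_eq b B A hx]
  -- With g^{2α} and the derivatives of g^{-1} expanded, all terms are polynomial in g^{12}, the
  -- angular inverse and derivatives of the fields.
  simp only [hc, hc2, hD.pd_ginv_one_ang hx, hD.ginv_one_ang hx] at r1 r1' r0 r3 r2 tr' ⊢
  simp only [hD.pd_ginv_ang hx (ang_ne_zero _), hD.pd_ginv_ang hx (show (1 : Fin 4) ≠ 0 by decide)]
    at r1 r1' r0 r3 r2 tr' ⊢
  simp only [Fin.sum_univ_two, F2, F3] at r1 r1' r0 r3 r2 tr' ⊢
  simp only [ang_zero, ang_one, sy 3 2, gy 3 2, sy 2 (ang α), sy 3 (ang α), dot_add_left,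
    dot_sub_left, dot_add_right, dot_neg_right, dot_smul_left,
    dc (A _ x), dc (brk b _ _), dc (pd 2 _ x), dc (pd 3 _ x), dc (pd (ang α) _ x),
    dc (pd 1 (A 2) x) (pd 1 (A (ang α)) x), dc (pd 1 (A 3) x) (pd 1 (A (ang α)) x),
    dc (pd 1 (A 0) x), dc (pd 0 (A 1) x)] at r1 r1' r0 r3 r2 tr' ⊢
  -- `r1'` and `r1` remove g_{2α,12} and its lower order companion, `r0` and `r3` the products of
  -- g_{2β,1} with g_{αδ,2}, `r2` the derivative A_{2,1}, and `tr'` the trace terms.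
  linear_combination r1' + ginv g 0 1 x * pd 1 (g 0 1) x * r1
    - (1 / 2) * pd 1 (g (ang α) 2) x * r0 - (1 / 2) * pd 1 (g (ang α) 3) x * r3
    + r2 - (1 / 4) * tr'

theorem pd_angDiv (hD : IsAdaptedData U S g A Φ) (hx : x ∈ S) :
    pd 1 (angDiv g A) x = ∑ α, ∑ β, (pd 1 (ginv g (ang α) (ang β)) x • pd (ang β) (A (ang α)) x
      + ginv g (ang α) (ang β) x • pd 1 (pd (ang β) (A (ang α))) x) := by
  have hxU := hD.subset hx
  have d2 := hD.diff_ginv hxU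
  have d5 := fun i k => (contDiffOn_pd hD.isOpen (hD.smooth_pot i) k).diffAt hD.isOpen hxU
  have : angDiv g A = fun x => ∑ α, ∑ β, ginv g (ang α) (ang β) x • pd (ang β) (A (ang α)) x :=
    rfl
  rw [this]
  simp (disch := fun_prop) only [Fin.sum_univ_two, pd_add, pd_smul]

theorem coefA_eq (hD : IsAdaptedData U S g A Φ) (hx : x ∈ S) (l : Fin 2) :
    coefA g A l x = ∑ α, ((2 * ginv g 0 1 x ^ 2 * pd 1 (g 0 1) x * ginv g (ang α) (ang l) x
        + 2 * ginv g 0 1 x * pd 1 (ginv g (ang α) (ang l)) x) • pd 1 (A (ang α)) x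
      + (2 * ginv g 0 1 x * ginv g (ang α) (ang l) x) • pd 1 (pd 1 (A (ang α))) x) := by
  have hxU := hD.subset hx
  have d2 := hD.diff_ginv hxU
  have d5 := fun i k => (contDiffOn_pd hD.isOpen (hD.smooth_pot i) k).diffAt hD.isOpen hxU
  rw [coefA]
  simp (disch := fun_prop) only [Fin.sum_univ_two, pd_add, pd_smul, pd_mul, pd_const,
    hD.pd_ginv_zero_one hx (show (1 : Fin 4) ≠ 0 by decide)]
  module

/-- The reduced Yang-Mills operator contracted with the null generator of `S`. -/
theorem reducedYM_null (hD : IsAdaptedData U S g A Φ) (hx : x ∈ S) :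
    reducedYM b g A 1 x
      = (2 * ginv g 0 1 x) • pd 1 (pd 0 (A 1)) x
        - (2 * ginv g 0 1 x ^ 2 * pd 1 (g 0 1) x) • pd 1 (A 0) x
        + ∑ β, (pd 1 (ginv g 1 (ang β)) x - ginv g 0 1 x * pd 1 (g 0 1) x * ginv g 1 (ang β) x
          - ∑ α, ginv g 0 1 x * (pd 0 (g 1 (ang α)) x - pd (ang α) (g 0 1) x)
            * ginv g (ang α) (ang β) x + harmonic g (ang β) x) • pd 1 (A (ang β)) x
        + ∑ α, ∑ β, (pd 1 (ginv g (ang α) (ang β)) x • pd (ang β) (A (ang α)) x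
          - ginv g (ang α) (ang β) x • brk b (A (ang β) x) (pd 1 (A (ang α)) x)) := by
  have hU := hD.isOpen
  have hxU := hD.subset hx
  have G0 : ginv g 0 0 x = 0 := hD.ginv_zero hx (by decide)
  have G2 : ginv g 0 2 x = 0 := hD.ginv_zero hx (by decide)
  have G3 : ginv g 0 3 x = 0 := hD.ginv_zero hx (by decide)
  have n1 : (1 : Fin 4) ≠ 0 := by decide
  have n2 : (2 : Fin 4) ≠ 0 := by decide
  have n3 : (3 : Fin 4) ≠ 0 := by decide
  have dG : ∀ i, i ≠ 1 → pd 1 (ginv g 0 i) x = 0 := fun i hi =>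
    hD.pd_eq_zero (hD.contDiffOn_ginv 0 i) (fun y hy => hD.ginv_zero hy hi) n1 hx
  have s1 := fun i k => contDiffOn_pd hU (hD.smooth_pot i) k
  have sF := hD.contDiffOn_curv b hD.smooth_pot
  have z : ∀ i k, i ≠ 0 → k ≠ 0 → pd i (g 1 k) x = 0 := fun i k hi hk => hD.pd_null hx hi hk
  have zA : ∀ i, i ≠ 0 → pd i (A 1) x = 0 := fun i hi => hD.pd_pot hx hi
  have zzA : ∀ i, i ≠ 0 → pd 1 (pd i (A 1)) x = 0 := fun i hi =>
    hD.pd_eq_zero (s1 1 i) (fun y hy => hD.pd_pot hy hi) n1 hx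
  have c : ∀ i j, pd i (pd 1 (A j)) x = pd 1 (pd i (A j)) x := fun i j =>
    pd_comm hU (hD.smooth_pot j) hxU
  have F11 : curv b A 1 1 = fun _ => 0 := funext fun y => by
    simp only [curv, brk_self, sub_self, add_zero]
  have F0 : ∀ y ∈ S, curv b A 0 1 y = pd 0 (A 1) y - pd 1 (A 0) y := fun y hy => by
    rw [IsMetricOn.curv_skew, hD.curv_one_zero b hy, neg_sub]
  have F : ∀ i, i ≠ 0 → ∀ y ∈ S, curv b A i 1 y = -pd 1 (A i) y := fun i hi y hy => by
    rw [IsMetricOn.curv_skew, hD.curv_one b hy hi]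
  have dF0 : pd 1 (curv b A 0 1) x = pd 1 (pd 0 (A 1)) x - pd 1 (pd 1 (A 0)) x := by
    rw [hD.pd_eq (sF 0 1) ((s1 1 0).sub (s1 0 1)) F0 n1 hx,
      pd_sub ((s1 1 0).diffAt hU hxU) ((s1 0 1).diffAt hU hxU)]
  have dF : ∀ i k, i ≠ 0 → k ≠ 0 → pd k (curv b A i 1) x = -pd 1 (pd k (A i)) x :=
    fun i k hi hk => by
      rw [hD.pd_eq (sF i 1) (s1 i 1).neg (F i hi) hk hx, pd_neg, c]
  -- As g_{2j,i} = 0 for i, j ≠ 1, every F^{ij} that occurs has an index 1. By antisymmetry only the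
  -- F^{i1} matter, and g^{1c} = 0 for c ≠ 2 expresses them through F_{a2}.
  have U0 : curvUp b g A 0 0 x = 0 := by
    have := IsMetricOn.curvUp_skew (g := g) b (A := A) 0 0 x
    exact self_eq_neg.1 this
  have Us : ∀ i, curvUp b g A 0 i x = -curvUp b g A i 0 x := fun i =>
    IsMetricOn.curvUp_skew b 0 i x
  have hU0 : ∀ i, curvUp b g A i 0 x = ginv g 0 1 x • ∑ a, ginv g i a x • curv b A a 1 x :=
    fun i => by
      rw [curvUp]
      simp only [Fin.sum_univ_four, G0, G2, G3, mul_zero, zero_smul, zero_add, add_zero]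
      module
  rw [hD.reducedYM_eq b hD.smooth_pot hxU]
  simp only [Fin.sum_univ_four, hD.symm 2 1, hD.symm 3 1, z _ _ n1 n1, z _ _ n1 n2,
    z _ _ n1 n3, z _ _ n2 n1, z _ _ n2 n2, z _ _ n2 n3, z _ _ n3 n1, z _ _ n3 n2, z _ _ n3 n3]
  simp only [U0, Us 1, Us 2, Us 3, hU0 1, hU0 2, hU0 3]
  simp only [Fin.sum_univ_four, Fin.sum_univ_two, ang_zero, ang_one, hD.ginv_symm 1 0,
    hD.ginv_symm 2 0, hD.ginv_symm 3 0, hD.ginv_symm 2 1, hD.ginv_symm 3 1, hD.ginv_symm 3 2,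
    G0, G2, G3, dG 0 (by decide), dG 2 (by decide), dG 3 (by decide), dF0, dF _ _ n2 n1,
    dF _ _ n2 n2, dF _ _ n2 n3, dF _ _ n3 n1, dF _ _ n3 n2, dF _ _ n3 n3, F11, pd_const,
    F0 x hx, F 2 n2 x hx, F 3 n3 x hx, zA _ n1, zA _ n2, zA _ n3, zzA _ n1, zzA _ n2, zzA _ n3,
    hD.gauge x hx, brk_zero_left, hD.harmonic_zero hx, hD.defect x hx, brk_zero_right,
    brk_add_right, brk_smul_right, brk_neg_right, smul_zero, zero_smul, add_zero, zero_add,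
    hD.pd_ginv_zero_one hx n1]
  module

/-- In LA_2 the derivative A_{1,22} cancels between curvature and gauge terms while A_{2,12} has the
coefficient 2g^{12}. Replacing the latter by 2Δ_{,2} produces the gauge system and restores -2g^{12}
A_{1,22}, the principal term of the data equation. -/
theorem yang_mills_identity (hD : IsAdaptedData U S g A Φ) (hx : x ∈ S) :
    reducedYM b g A 1 x - current b A Φ 1 x
      = (-(2 * ginv g 0 1 x) • pd 1 (pd 1 (A 0)) x
        - (2 * ginv g 0 1 x ^ 2 * pd 1 (g 0 1) x) • pd 1 (A 0) x
        + ∑ α, ∑ l, (2 * ginv g 0 1 x * ginv g (ang α) (ang l) x * pd 1 (g 0 (ang l)) x)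
            • pd 1 (A (ang α)) x
        + ∑ l, g 0 (ang l) x • coefA g A l x
        + coefB b g A Φ x)
      + (∑ β, (2 * pd 1 (harmonic g (ang β)) x) • A (ang β) x
        + (2 : ℝ) • pd 1 (lorenz g A) x
        + (2 * ginv g 0 1 x * pd 1 (g 0 1) x) • lorenz g A x
        + ∑ β, (2 * harmonic g (ang β) x)
            • ((ginv g 0 1 x * pd 1 (g 0 1) x) • A (ang β) x + pd 1 (A (ang β)) x)) := by
  have r1 := hD.lorenz_null hx
  have r1' := hD.pd_lorenz_null hx
  have r0 := hD.harmonic_ang hx 0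
  have r3 := hD.harmonic_ang hx 1
  have sy : ∀ i j, g i j = g j i := hD.symm
  have gy : ∀ i j, ginv g i j = ginv g j i := hD.ginv_symm
  have hJ : current b A Φ 1 x = brk b (Φ x) (pd 1 Φ x) := by
    simp only [current, covHiggs, hD.gauge x hx, brk_zero_left, add_zero]
  rw [hD.reducedYM_null b hx, hJ, coefB, hD.pd_angDiv hx]
  rw [hD.pd_angDiv hx] at r1'
  simp only [hD.coefA_eq hx, angDiv, hD.pd_ginv_one_ang hx, hD.ginv_one_ang hx] at r1 r1' r0 r3 ⊢
  simp only [hD.pd_ginv_ang hx (ang_ne_zero _), hD.pd_ginv_ang hx (show (1 : Fin 4) ≠ 0 by decide)]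
    at r1 r1' r0 r3 ⊢
  simp only [Fin.sum_univ_two] at r1 r1' r0 r3 ⊢
  simp only [ang_zero, ang_one, sy 3 2, gy 3 2] at r1 r1' r0 r3 ⊢
  linear_combination (norm := module) (-2 : ℝ) • r1' - (2 * ginv g 0 1 x * pd 1 (g 0 1) x) • r1
    + r0 • pd 1 (A 2) x + r3 • pd 1 (A 3) x

end IsAdaptedData

/-! ### Common neighbourhoods of S. -/

section Neighbourhoods

variable {E : Type*} [NormedAddCommGroup E] [NormedSpace ℝ E] {S : Set Pt}

theorem SmoothNear.exists_isOpen {ι : Type*} [Finite ι] {f : ι → Pt → E}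
    (hf : ∀ i, SmoothNear S (f i)) :
    ∃ U, IsOpen U ∧ S ⊆ U ∧ ∀ i, ContDiffOn ℝ ∞ (f i) U := by
  choose U hU hSU hfU using hf
  exact ⟨⋂ i, U i, isOpen_iInter_of_finite hU, Set.subset_iInter hSU,
    fun i => (hfU i).mono (Set.iInter_subset U i)⟩

theorem SmoothNear.exists_isOpen_det_ne {n : ℕ} {m : Fin n → Fin n → Pt → ℝ}
    (hm : ∀ i j, SmoothNear S (m i j))
    (hdet : ∀ x ∈ S, (Matrix.of fun i j => m i j x).det ≠ 0) :
    ∃ U, IsOpen U ∧ S ⊆ U ∧ (∀ i j, ContDiffOn ℝ ∞ (m i j) U) ∧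
      ∀ x ∈ U, (Matrix.of fun i j => m i j x).det ≠ 0 := by
  obtain ⟨U, hU, hSU, hmU⟩ := SmoothNear.exists_isOpen
    (f := fun p : Fin n × Fin n => m p.1 p.2) fun p => hm p.1 p.2
  have hc := (contDiffOn_det fun i j => hmU (i, j)).continuousOn
  exact ⟨_, hc.isOpen_inter_preimage hU isOpen_ne (t := {y | y ≠ 0}),
    fun x hx => ⟨hSU hx, hdet x hx⟩, fun i j => (hmU (i, j)).mono Set.inter_subset_left,
    fun x hx => hx.2⟩

theorem det_ne_zero_of_isLorentz {M : Matrix (Fin 4) (Fin 4) ℝ} (hM : IsLorentz M) : M.det ≠ 0 := by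
  obtain ⟨P, -, hP⟩ := hM
  intro h
  have := congrArg Matrix.det hP
  rw [Matrix.det_mul, Matrix.det_mul, h, Matrix.det_diagonal] at this
  simp [Fin.prod_univ_four] at this

end Neighbourhoods

/-! ### The gauge system as an ordinary differential equation. -/

section Components

variable {E : Type*} [NormedAddCommGroup E] [NormedSpace ℝ E] {x : Pt} {i : Fin 4}

theorem pd_pi_prod {ι : Type*} [Fintype ι] {f : ι → Pt → ℝ} {g : Pt → E}
    (hf : ∀ k, DifferentiableAt ℝ (f k) x) (hg : DifferentiableAt ℝ g x) :
    pd i (fun y => ((fun k => f k y : ι → ℝ), g y)) x = (fun k => pd i (f k) x, pd i g x) := by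
  have h := (hasFDerivAt_pi.2 fun k => (hf k).hasFDerivAt).prodMk hg.hasFDerivAt
  simp only [pd]
  rw [h.fderiv]
  rfl

end Components

section GaugeField

variable {𝔤 : Type*} [LieRing 𝔤] [LieAlgebra ℝ 𝔤] {N : ℕ} (b : Module.Basis (Fin N) ℝ 𝔤)
  (B : LinearMap.BilinForm ℝ 𝔤) (g : Fin 4 → Fin 4 → Pt → ℝ) (A : Fin 4 → Pt → Col N)

/-- The `x²`-derivative of `Γ^δ` that solves the gauge system. -/
noncomputable def harmonicRate (x : Pt) (z : (Fin 2 → ℝ) × Col N) (δ : Fin 2) : ℝ :=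
  -∑ α, ginv g (ang δ) (ang α) x * (∑ β, (ginv g 0 1 x * pd 1 (g 0 1) x * g (ang α) (ang β) x
      + (1 / 2) * pd 1 (g (ang α) (ang β)) x
      + dot b B (A (ang β) x) (pd 1 (A (ang α)) x)) * z.1 β + dot b B (pd 1 (A (ang α)) x) z.2)

/-- The gauge system solved for the `x²`-derivatives of `(Γ³, Γ⁴, Δ)`. -/
noncomputable def gaugeRate (x : Pt) (z : (Fin 2 → ℝ) × Col N) : (Fin 2 → ℝ) × Col N :=
  (harmonicRate b B g A x z,
    -∑ β, harmonicRate b B g A x z β • A (ang β) x - (ginv g 0 1 x * pd 1 (g 0 1) x) • z.2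
      - ∑ β, z.1 β • ((ginv g 0 1 x * pd 1 (g 0 1) x) • A (ang β) x + pd 1 (A (ang β)) x))

variable {g A}

theorem harmonicRate_smul (x : Pt) (c : ℝ) (z : (Fin 2 → ℝ) × Col N) (δ : Fin 2) :
    harmonicRate b B g A x (c • z) δ = c * harmonicRate b B g A x z δ := by
  simp only [harmonicRate, Fin.sum_univ_two, Prod.smul_fst, Prod.smul_snd, Pi.smul_apply,
    smul_eq_mul, dot_smul_right]
  ring

theorem gaugeRate_smul (x : Pt) (c : ℝ) (z : (Fin 2 → ℝ) × Col N) :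
    gaugeRate b B g A x (c • z) = c • gaugeRate b B g A x z := by
  refine Prod.ext (funext fun δ => harmonicRate_smul b B x c z δ) ?_
  simp only [gaugeRate, harmonicRate_smul, Fin.sum_univ_two, Prod.smul_fst, Prod.smul_snd,
    Pi.smul_apply, smul_eq_mul]
  module

variable {U S : Set Pt} {Φ : Pt → Col N} {x : Pt}

theorem continuousOn_comp_fst {F G : Type*} [NormedAddCommGroup F] [NormedSpace ℝ F]
    [TopologicalSpace G] (hSU : S ⊆ U) {f : Pt → F} (hf : ContDiffOn ℝ ∞ f U) :
    ContinuousOn (fun p : Pt × G => f p.1) (S ×ˢ Set.univ) :=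
  (hf.continuousOn.mono hSU).comp continuousOn_fst fun _ hp => hp.1

theorem continuousOn_dot {X : Type*} [TopologicalSpace X] {s : Set X} {u w : X → Col N}
    (hu : ContinuousOn u s) (hw : ContinuousOn w s) :
    ContinuousOn (fun p => dot b B (u p) (w p)) s :=
  Continuous.comp_continuousOn (g := fun p : Col N × Col N => dot b B p.1 p.2)
    (f := fun p => (u p, w p)) (contDiff_dot b B).continuous (hu.prodMk hw)

theorem continuousOn_harmonicRate (hD : IsNullData U S g A Φ) (δ : Fin 2) :
    ContinuousOn (fun p : Pt × ((Fin 2 → ℝ) × Col N) => harmonicRate b B g A p.1 p.2 δ)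
      (S ×ˢ Set.univ) := by
  have c1 := fun i j => continuousOn_comp_fst (G := (Fin 2 → ℝ) × Col N) hD.subset
    (hD.contDiffOn_ginv i j)
  have c2 := fun i j => continuousOn_comp_fst (G := (Fin 2 → ℝ) × Col N) hD.subset
    (hD.smooth i j)
  have c3 := fun i j => continuousOn_comp_fst (G := (Fin 2 → ℝ) × Col N) hD.subset
    (contDiffOn_pd hD.isOpen (hD.smooth i j) 1)
  have c4 := fun i => continuousOn_comp_fst (G := (Fin 2 → ℝ) × Col N) hD.subset
    (hD.smooth_pot i)
  have c5 := fun i => continuousOn_comp_fst (G := (Fin 2 → ℝ) × Col N) hD.subset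
    (contDiffOn_pd hD.isOpen (hD.smooth_pot i) 1)
  have c6 := fun α β => continuousOn_dot b B (c4 (ang β)) (c5 (ang α))
  have c7 := fun α => continuousOn_dot b B (c5 (ang α)) (w := fun p => p.2.2) (by fun_prop)
  have cz : ∀ β, ContinuousOn (fun p : Pt × ((Fin 2 → ℝ) × Col N) => p.2.1 β) (S ×ˢ Set.univ) :=
    fun β => by fun_prop
  exact (continuousOn_finsetSum _ fun α _ => (c1 _ _).mul ((continuousOn_finsetSum _ fun β _ =>
    (((((c1 0 1).mul (c3 0 1)).mul (c2 _ _)).add (continuousOn_const.mul (c3 _ _))).add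
      (c6 α β)).mul (cz β)).add (c7 α))).neg

theorem continuousOn_gaugeRate (hD : IsNullData U S g A Φ) :
    ContinuousOn (Function.uncurry (gaugeRate b B g A)) (S ×ˢ Set.univ) := by
  have c1 := fun i j => continuousOn_comp_fst (G := (Fin 2 → ℝ) × Col N) hD.subset
    (hD.contDiffOn_ginv i j)
  have c3 := fun i j => continuousOn_comp_fst (G := (Fin 2 → ℝ) × Col N) hD.subset
    (contDiffOn_pd hD.isOpen (hD.smooth i j) 1)
  have c4 := fun i => continuousOn_comp_fst (G := (Fin 2 → ℝ) × Col N) hD.subset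
    (hD.smooth_pot i)
  have c5 := fun i => continuousOn_comp_fst (G := (Fin 2 → ℝ) × Col N) hD.subset
    (contDiffOn_pd hD.isOpen (hD.smooth_pot i) 1)
  have r := continuousOn_harmonicRate b B hD
  have cz : ∀ β, ContinuousOn (fun p : Pt × ((Fin 2 → ℝ) × Col N) => p.2.1 β) (S ×ˢ Set.univ) :=
    fun β => by fun_prop
  have cw := (c1 0 1).mul (c3 0 1)
  exact (continuousOn_pi.2 r).prodMk
    ((((continuousOn_finsetSum _ fun β _ => (r β).smul (c4 _)).neg).sub
      (cw.smul continuous_snd.snd.continuousOn)).sub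
      (continuousOn_finsetSum _ fun β _ => (cz β).smul ((cw.smul (c4 _)).add (c5 _))))

/-- Contracting the first two equations with g^{δα} isolates Γ^δ_{,2}; these values are then
inserted in the third equation. -/
theorem pd_eq_gaugeRate (hD : IsNullData U S g A Φ) (hx : x ∈ S) (h : GaugeODE b B g A x) :
    pd 1 (fun y => ((fun β => harmonic g (ang β) y : Fin 2 → ℝ), lorenz g A y)) x
      = gaugeRate b B g A x (fun β => harmonic g (ang β) x, lorenz g A x) := by
  have hxU := hD.subset hx
  rw [pd_pi_prod (f := fun β => harmonic g (ang β)) (fun β => hD.diff_harmonic hxU _)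
    ((hD.contDiffOn_lorenz hD.smooth_pot).diffAt hD.isOpen hxU)]
  have hr : ∀ δ, pd 1 (harmonic g (ang δ)) x
      = harmonicRate b B g A x (fun β => harmonic g (ang β) x, lorenz g A x) δ := fun δ => by
    have e : pd 1 (harmonic g (ang δ)) x = ∑ α, ginv g (ang δ) (ang α) x
        * ∑ β, g (ang α) (ang β) x * pd 1 (harmonic g (ang β)) x := by
      simp only [Finset.mul_sum, ← mul_assoc]
      rw [Finset.sum_comm]
      simp only [← Finset.sum_mul, hD.sum_ginv_ang_mul hx]
      simp
    rw [e, harmonicRate, ← Finset.sum_neg_distrib]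
    refine Finset.sum_congr rfl fun α _ => ?_
    linear_combination ginv g (ang δ) (ang α) x * h.1 α
  refine Prod.ext (funext hr) ?_
  simp only [gaugeRate, ← hr]
  have h2 := h.2
  simp only [Fin.sum_univ_two] at h2 ⊢
  linear_combination (norm := module) (1 / 2 : ℝ) • h2

theorem reducedSystem_iff_gaugeODE (hB : B.IsSymm) (V : ℝ → ℝ) (hD : IsAdaptedData U S g A Φ)
    (hx : x ∈ S) (h : DataODE b B g A Φ x) :
    ReducedSystem b B V g A Φ x ↔ GaugeODE b B g A x := by
  refine and_congr (forall_congr' fun α => ?_) ?_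
  · rw [← sub_eq_zero, hD.einstein_identity b B V hB hx, h.1 α, zero_sub, neg_eq_zero]
  · rw [← sub_eq_zero, hD.yang_mills_identity b hx, h.2, zero_add]

end GaugeField

/-! ### Assembly of the proposition. -/

theorem proposition3p9
    {𝔤 : Type*} [LieRing 𝔤] [LieAlgebra ℝ 𝔤] {N : ℕ} (b : Module.Basis (Fin N) ℝ 𝔤)
    (B : LinearMap.BilinForm ℝ 𝔤) (hBsymm : B.IsSymm) (hBnondeg : B.Nondegenerate)
    (hBinv : ∀ f k l : 𝔤, B f ⁅k, l⁆ = B ⁅f, k⁆ l)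
    (V : ℝ → ℝ) (hV : ContDiff ℝ (⊤ : ℕ∞) V)
    -- the domain and the initial surface `G¹_{T₁}`
    (L : Set Pt) (hL : IsCharDomain L) (T₁ : ℝ) (hT₁ : 0 < T₁) (hT₁' : T₁ ≤ T0 L)
    (hdim : IsThreeDim (surfT L 0 T₁)) (hruled : IsRuled (surfT L 0 T₁))
    -- the metric, the Yang-Mills potential and the Higgs field
    (g : Fin 4 → Fin 4 → Pt → ℝ) (A : Fin 4 → Pt → Col N) (Φ : Pt → Col N)
    (hg : ∀ i j, SmoothNear (surfT L 0 T₁) (g i j))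
    (hA : ∀ i, SmoothNear (surfT L 0 T₁) (A i))
    (hΦ : SmoothNear (surfT L 0 T₁) Φ)
    (hgsymm : ∀ i j x, g i j x = g j i x)
    (hgLor : ∀ x ∈ surfT L 0 T₁, IsLorentz (gMat g x))
    -- the conditions on the free data on `G¹_{T₁}`
    (hg22 : ∀ x ∈ surfT L 0 T₁, g 1 1 x = 0)
    (hg2α : ∀ x ∈ surfT L 0 T₁, ∀ α, g 1 (ang α) x = 0)
    (hA2 : ∀ x ∈ surfT L 0 T₁, A 1 x = 0)
    -- construction of `g_{αβ} = e^v h_{αβ}` and of `g_{12}`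
    (h : Fin 2 → Fin 2 → Pt → ℝ) (v : Pt → ℝ)
    (hh : ∀ α β, SmoothNear (surfT L 0 T₁) (h α β)) (hv : SmoothNear (surfT L 0 T₁) v)
    (hhdet : ∀ x ∈ surfT L 0 T₁, (Matrix.of fun α β => h α β x).det = 1)
    (hgαβ : ∀ x ∈ surfT L 0 T₁, ∀ α β, g (ang α) (ang β) x = Real.exp (v x) * h α β x)
    (hvODE : ∀ x ∈ surfT L 0 T₁, ConformalODE b B h v A Φ x)
    (hg12ODE : ∀ x ∈ surfT L 0 T₁, pd 1 (g 0 1) x = (1 / 2) * g 0 1 x * pd 1 v x)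
    -- the reduced equation `R̃_{22} = τ_{22}` and the corner condition `g_{22,1} = 2 g_{12,2}`
    (hred22 : ∀ x ∈ surfT L 0 T₁, reducedRicci g 1 1 x = source b B V g A Φ 1 1 x)
    (hcorner : ∀ x ∈ corner L T₁, pd 0 (g 1 1) x = 2 * pd 1 (g 0 1) x)
    -- construction of `(g_{13}, g_{14}, A_1)`
    (hdata : ∀ x ∈ surfT L 0 T₁, DataODE b B g A Φ x) :
    (∀ x ∈ surfT L 0 T₁, (ReducedSystem b B V g A Φ x ↔ GaugeODE b B g A x)) ∧
    ((∀ x ∈ surfT L 0 T₁, ReducedSystem b B V g A Φ x) →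
      (∀ x ∈ corner L T₁,
        harmonic g 2 x = 0 ∧ harmonic g 3 x = 0 ∧ lorenz g A x = 0) →
      ∀ x ∈ surfT L 0 T₁,
        harmonic g 2 x = 0 ∧ harmonic g 3 x = 0 ∧ lorenz g A x = 0) := by
  set S := surfT L 0 T₁ with hS
  -- On S one has τ = x²; hence x² ≥ 0 there, and the points with x² = 0 are those of Γ.
  have hpos : ∀ x ∈ S, 0 ≤ x 1 := fun x hx => by
    have h0 : x 0 = 0 := hx.1.2
    have h1 := hx.2.1
    rwa [timeFn, h0, zero_add] at h1
  have hmem : ∀ x ∈ S, x 1 = 0 → x ∈ corner L T₁ := fun x hx hx1 => ⟨hx, ⟨hx.1.1, hx1⟩, hx.2⟩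
  obtain ⟨U₁, hU₁, hSU₁, hgU₁, hdet₁⟩ := SmoothNear.exists_isOpen_det_ne hg
    fun x hx => det_ne_zero_of_isLorentz (hgLor x hx)
  obtain ⟨U₂, hU₂, hSU₂, hhU₂, hdet₂⟩ := SmoothNear.exists_isOpen_det_ne hh
    fun x hx => by rw [hhdet x hx]; exact one_ne_zero
  obtain ⟨U₃, hU₃, hSU₃, hAU₃⟩ := SmoothNear.exists_isOpen hA
  obtain ⟨U₄, hU₄, hSU₄, hΦU₄⟩ := hΦ
  obtain ⟨U₅, hU₅, hSU₅, hvU₅⟩ := hv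
  -- The fields are smooth on possibly different neighbourhoods of S; the intersection serves them
  -- all, and there g and h are also invertible.
  have hN : IsNullData (U₁ ∩ U₂ ∩ U₃ ∩ U₄ ∩ U₅) S g A Φ :=
    { isOpen := (((hU₁.inter hU₂).inter hU₃).inter hU₄).inter hU₅
      smooth := fun i j => (hgU₁ i j).mono fun x hx => hx.1.1.1.1
      symm := fun i j => funext (hgsymm i j)
      det_ne := fun x hx => hdet₁ x hx.1.1.1.1
      subset := fun x hx => ⟨⟨⟨⟨hSU₁ hx, hSU₂ hx⟩, hSU₃ hx⟩, hSU₄ hx⟩, hSU₅ hx⟩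
      coord := fun x hx => hx.1.2
      threeDim := hdim
      null := fun j hj x hx => by
        fin_cases j
        · exact absurd rfl hj
        · exact hg22 x hx
        · exact hg2α x hx 0
        · exact hg2α x hx 1
      smooth_pot := fun i => (hAU₃ i).mono fun x hx => hx.1.1.2
      smooth_higgs := hΦU₄.mono fun x hx => hx.1.2
      gauge := hA2 }
  have hC : IsConformalSplit (U₁ ∩ U₂ ∩ U₃ ∩ U₄ ∩ U₅) S g h v :=
    { smooth_h := fun α β => (hhU₂ α β).mono fun x hx => hx.1.1.1.2
      smooth_v := hvU₅.mono fun x hx => hx.2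
      det_ne := fun x hx => hdet₂ x hx.1.1.1.2
      det_eq := hhdet
      eq_exp_mul := hgαβ }
  have hD : IsAdaptedData (U₁ ∩ U₂ ∩ U₃ ∩ U₄ ∩ U₅) S g A Φ :=
    { toIsNullData := hN
      defect := fun x hx => hN.null_defect_eq_zero b B V hC hvODE hg12ODE hred22 hruled hpos
        (fun y hy hy1 => hcorner y (hmem y hy hy1)) hx
      -- The trace is 2v_{,2}, and the equation for g_{12} says v_{,2} = 2g^{12} g_{12,2}.
      trace := fun x hx => by
        rw [hC.trace_pd hN.toIsNullSurface hx, hg12ODE x hx]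
        linear_combination (-2 * pd 1 v x) * hN.ginv_mul_g hx }
  have hiff : ∀ x ∈ S, ReducedSystem b B V g A Φ x ↔ GaugeODE b B g A x := fun x hx =>
    reducedSystem_iff_gaugeODE b B hBsymm V hD hx (hdata x hx)
  refine ⟨hiff, fun hred h0 x hx => ?_⟩
  have hz := eq_zero_of_isRuled hD.isOpen hD.subset hruled hpos
    (f := fun y => ((fun β => harmonic g (ang β) y : Fin 2 → ℝ), lorenz g A y))
    ((contDiffOn_pi.2 fun β => hD.contDiffOn_harmonic (ang β)).prodMk
      (hD.contDiffOn_lorenz hD.smooth_pot))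
    (continuousOn_gaugeRate b B hN) (fun y _ c z => gaugeRate_smul b B y c z)
    (fun y hy => pd_eq_gaugeRate b B hN hy ((hiff y hy).1 (hred y hy)))
    (fun y hy hy1 => by
      obtain ⟨h2, h3, hΔ⟩ := h0 y (hmem y hy hy1)
      exact Prod.ext (funext (Fin.forall_fin_two.2 ⟨h2, h3⟩)) hΔ) hx
  obtain ⟨hz1, hz2⟩ := Prod.ext_iff.1 hz
  exact ⟨congrFun hz1 0, congrFun hz1 1, hz2⟩
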